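/- **Model.** There are $n$ processors, each with an input bit and a write-once output bit that is initially blank; a processor *decides* when it writes its output bit. They communicate by messages over channels that identify the sender. An execution is a sequence of *sending steps* (a processor deterministically puts the messages prescribed by its state into the buffers; a second sending step in a row has no effect) and *receiving steps* (a processor receives one message from its buffer and samples a new state from a discrete distribution that depends on its state, the message and the sender). A *sending event* is a sending step in which at least one message is sent. A processor *crashes* in an infinite execution if it takes only finitely many steps. An *adversary* is a deterministic function that maps each partial execution (including all states and message contents) to the next step. It is an *asynchronous adversary causing at most $t$ crash failures* if, in each of its infinite executions, at most $t$ processors crash, all others take infinitely many sending and receiving steps, and every message sent to a processor that does not crash is eventually delivered. An algorithm * is *forgetful* if each message sent by a processor depends only on its input bit and on the messages received and the local randomness sampled since its previous sending event; * is *fully communicative* if every processor is ready to send a message to all $n$ processors at the beginning, and is ready to send a new message to all $n$ processors whenever it has received, since its previous sending event, the most recently sent messages from $n-t$ processors; * achieves *measure one correctness* if, in every partial execution of nonzero probability, no two written output bits differ and every written output bit equals the input bit of some processor; * achieves *measure one termination* if, whatever the adversary does and for all inputs, with probability one the following holds: if at most $t$ processors crash, all others take infinitely many sending and receiving steps, and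 all messages between processors that do not crash are delivered, then every processor that does not crash decides. A *message chain* of length $k$ consists of messages $m_1,\dots,m_k$ such that, for each $i<k$, $m_i$ is received by the sender of $m_{i+1}$ prior to the sending of $m_{i+1}$. The *running time* of an execution is the length of the longest message chain among the messages sent before any processor decides. **Theorem.** Let $c>0$. There are constants $C,\alpha>0$ depending only on $c$ such that the following holds for all integers $n,t$ with $0<t<n$ and $t=\lfloor cn\rfloor$. For every forgetful and fully communicative algorithm for $n$ processors that achieves measure one correctness and measure one termination, there are an asynchronous adversary causing at most $t$ crash failures and a setting of the input bits such that, with probability at least $\tfrac12$, the running time is at least $Ce^{\alpha n}$. -/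

import Mathlib

open MeasureTheory ProbabilityTheory

universe u v

/-- A step of an execution, as it is recorded.
* `send i w`: processor `i` takes a sending step and puts the messages `w` into the buffers
  (`w k` is the message to `k`, or `none`; `w` may be empty).
* `recv i k j m s`: processor `i` receives the message `m` that `j` sent to it in step number `k`
  of the execution, and its new state is `s`.
* `skip`: nothing happens (the adversary asked for the delivery of a message that is not there). -/
inductive ExecStep (n : ℕ) (S : Type u) (M : Type v) : Type (max u v)
  | send (i : Fin n) (w : Fin n → Option M)
  | recv (i : Fin n) (k : ℕ) (j : Fin n) (m : M) (s : S)
  | skip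

/-- What an adversary can ask for: a sending step of `i`, or the delivery to `i` of the message
that was sent to it in step number `k`. -/
inductive AdvMove (n : ℕ) : Type
  | send (i : Fin n)
  | deliver (i : Fin n) (k : ℕ)

/-- A randomized asynchronous message-passing algorithm for `n` processors with input bits and
write-once output bits. Only receiving steps are randomized; `none` is the blank output or the
absent message. -/
structure Algorithm (n : ℕ) : Type (max (u + 1) (v + 1)) where
  /-- local states -/
  State : Type u
  /-- message contents -/
  Msg : Type v
  /-- initial state of a processor with a given input bit -/
  start : Fin n → Bool → State
  /-- output bit -/
  out : State → Option Bool
  /-- `recv i s j m`: law of the new state of `i` when it receives `m` from `j` in state `s` -/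
  recv : Fin n → State → Fin n → Msg → PMF State
  /-- `send i s k`: message to `k` that `i` emits if it takes a sending step in state `s` -/
  send : Fin n → State → Fin n → Option Msg
  /-- state of `i` after a sending step, taken in state `s`, in which it emitted messages -/
  sent : Fin n → State → State
  out_start : ∀ i b, out (start i b) = none
  out_recv : ∀ i s j m, ∀ s' ∈ (recv i s j m).support, ∀ b, out s = some b → out s' = some b
  out_sent : ∀ i s, out (sent i s) = out s
  /-- a second sending step in a row has no effect -/
  send_sent : ∀ i s k, send i (sent i s) k = none

namespace Algorithm

variable {n : ℕ}

/-- Partial executions: the steps made so far, in chronological order. Step number `k` of `h` is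
`h[k]?`. -/
abbrev History (A : Algorithm.{u, v} n) : Type (max u v) := List (ExecStep n A.State A.Msg)

instance (A : Algorithm.{u, v} n) : MeasurableSpace A.History := ⊤

/-- Effect of a step on the states; a sending step without messages has no effect. -/
def applyEvent (A : Algorithm.{u, v} n) (σ : Fin n → A.State) :
    ExecStep n A.State A.Msg → (Fin n → A.State)
  | .send i w => if ∃ k, (w k).isSome then Function.update σ i (A.sent i (σ i)) else σ
  | .recv i _ _ _ s => Function.update σ i s
  | .skip => σ

/-- The states of all processors after the partial execution `h` with inputs `x`. -/
def stateAt (A : Algorithm.{u, v} n) (x : Fin n → Bool) (h : A.History) : Fin n → A.State :=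
  h.foldl A.applyEvent fun i => A.start i (x i)

open Classical in
/-- The message, with its sender, that was sent to `i` in step `k` and is still in its buffer. -/
noncomputable def pending (A : Algorithm.{u, v} n) (h : A.History) (i : Fin n) (k : ℕ) :
    Option (Fin n × A.Msg) :=
  if ∃ j m s, ExecStep.recv i k j m s ∈ h then none
  else match h[k]? with
    | some (.send j w) => (w i).map fun m => (j, m)
    | _ => none

/-- Law of the partial execution that results from `h` when the adversary chooses `a`. -/
noncomputable def stepLaw (A : Algorithm.{u, v} n) (x : Fin n → Bool) (h : A.History) :
    AdvMove n → PMF A.History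
  | .send i => PMF.pure (h ++ [.send i (A.send i (A.stateAt x h i))])
  | .deliver i k =>
    match A.pending h i k with
    | some (j, m) => (A.recv i (A.stateAt x h i) j m).map fun s => h ++ [.recv i k j m s]
    | none => PMF.pure (h ++ [.skip])

/-- Partial executions of nonzero probability (for some behaviour of the adversary). A crashed
processor is one that takes no further steps, so that any such partial execution is possible with
no or few crash failures. -/
inductive Reachable (A : Algorithm.{u, v} n) (x : Fin n → Bool) : A.History → Prop
  | nil : Reachable A x []
  | step (h h' : A.History) (a : AdvMove n) :
      Reachable A x h → h' ∈ (A.stepLaw x h a).support → Reachable A x h'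

/-! ### Adversaries, infinite executions and their law -/

/-- An adversary maps a partial execution (inputs and steps so far, with all states and message
contents) to the next step. -/
abbrev Adversary (A : Algorithm.{u, v} n) : Type (max u v) :=
  (Fin n → Bool) → A.History → AdvMove n

/-- One step of the execution against `adv`, as a kernel that depends on the last history. -/
noncomputable def stepKernel (A : Algorithm.{u, v} n) (adv : A.Adversary) (x : Fin n → Bool)
    (N : ℕ) : Kernel ((_ : Finset.Iic N) → A.History) A.History where
  toFun p := (A.stepLaw x (p ⟨N, by simp⟩) (adv x (p ⟨N, by simp⟩))).toMeasure
  measurable' :=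
    (measurable_from_top (f := fun h : A.History => (A.stepLaw x h (adv x h)).toMeasure)).comp
      (measurable_pi_apply _)

instance (A : Algorithm.{u, v} n) (adv : A.Adversary) (x : Fin n → Bool) (N : ℕ) :
    IsMarkovKernel (A.stepKernel adv x N) :=
  ⟨fun p => by
    change IsProbabilityMeasure (PMF.toMeasure _)
    infer_instance⟩

/-- The law of the infinite execution with inputs `x` against `adv`. An infinite execution is given
by the sequence `ω` of its partial executions, `ω N` consisting of the first `N` steps. -/
noncomputable def runMeasure (A : Algorithm.{u, v} n) (adv : A.Adversary) (x : Fin n → Bool) :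
    Measure (ℕ → A.History) :=
  Kernel.traj (X := fun _ => A.History) (A.stepKernel adv x) 0 fun _ => []

/-- `ω` is an infinite execution that can occur against `adv`. -/
def IsRun (A : Algorithm.{u, v} n) (adv : A.Adversary) (x : Fin n → Bool)
    (ω : ℕ → A.History) : Prop :=
  ω 0 = [] ∧ ∀ N, ω (N + 1) ∈ (A.stepLaw x (ω N) (adv x (ω N))).support

/-- `i` takes infinitely many sending steps. -/
def SendsForever (A : Algorithm.{u, v} n) (ω : ℕ → A.History) (i : Fin n) : Prop :=
  ∀ N₀, ∃ N, N₀ ≤ N ∧ ∃ w, (ω (N + 1))[N]? = some (.send i w)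

/-- `i` takes infinitely many receiving steps. -/
def ReceivesForever (A : Algorithm.{u, v} n) (ω : ℕ → A.History) (i : Fin n) : Prop :=
  ∀ N₀, ∃ N, N₀ ≤ N ∧ ∃ k j m s, (ω (N + 1))[N]? = some (.recv i k j m s)

/-- `i` crashes: it takes only finitely many steps. -/
def Crashes (A : Algorithm.{u, v} n) (ω : ℕ → A.History) (i : Fin n) : Prop :=
  ¬ A.SendsForever ω i ∧ ¬ A.ReceivesForever ω i

/-- At most `t` processors crash and all others take infinitely many sending and receiving
steps. -/
def AtMostCrashes (A : Algorithm.{u, v} n) (t : ℕ) (ω : ℕ → A.History) : Prop :=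
  {i | A.Crashes ω i}.ncard ≤ t ∧
    ∀ i, ¬ A.Crashes ω i → A.SendsForever ω i ∧ A.ReceivesForever ω i

/-- In step `k` of `h`, processor `j` sends the message `m` to `i`. -/
def SentAt (A : Algorithm.{u, v} n) (h : A.History) (k : ℕ) (j i : Fin n) (m : A.Msg) : Prop :=
  ∃ w, h[k]? = some (.send j w) ∧ w i = some m

/-- Every message from `j` to `i` is eventually received. -/
def Delivers (A : Algorithm.{u, v} n) (ω : ℕ → A.History) (j i : Fin n) : Prop :=
  ∀ N k m, A.SentAt (ω N) k j i m → ∃ N' m' s, ExecStep.recv i k j m' s ∈ ω N'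

/-- The asynchronous adversaries that cause at most `t` crash failures: in every infinite execution
at most `t` processors crash, the others take infinitely many steps, and all messages sent to
processors that do not crash are eventually delivered. -/
def IsAsyncAdversary (A : Algorithm.{u, v} n) (t : ℕ) (adv : A.Adversary) : Prop :=
  ∀ x ω, A.IsRun adv x ω →
    A.AtMostCrashes t ω ∧ ∀ j i, ¬ A.Crashes ω i → A.Delivers ω j i

/-! ### Properties of algorithms -/

/-- Measure one correctness: in reachable configurations, any two outputs agree, and any output is
one of the inputs. -/
def Correct (A : Algorithm.{u, v} n) : Prop :=
  ∀ x h, A.Reachable x h →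
    (∀ i j b b', A.out (A.stateAt x h i) = some b → A.out (A.stateAt x h j) = some b' → b = b') ∧
    ∀ i b, A.out (A.stateAt x h i) = some b → ∃ j, x j = b

/-- Measure one termination: whatever the adversary does, with probability zero there are at most
`t` crash failures, the other processors take infinitely many sending and receiving steps and
receive all messages that they send to each other, and yet one of them never decides. -/
def Terminating (A : Algorithm.{u, v} n) (t : ℕ) : Prop :=
  ∀ (adv : A.Adversary) (x : Fin n → Bool), ∀ᵐ ω ∂(A.runMeasure adv x),
    A.AtMostCrashes t ω →
    (∀ j i, ¬ A.Crashes ω j → ¬ A.Crashes ω i → A.Delivers ω j i) →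
    ∀ i, ¬ A.Crashes ω i → ∃ N b, A.out (A.stateAt x (ω N) i) = some b

/-- A sending event of `i`: a sending step in which `i` sends at least one message. -/
def IsSendingEvent (A : Algorithm.{u, v} n) (i : Fin n) (e : ExecStep n A.State A.Msg) : Prop :=
  ∃ w, e = .send i w ∧ ∃ k, (w k).isSome

/-- The messages, with their senders, received by `i` in the steps `h`, in order. -/
def receivedBy (A : Algorithm.{u, v} n) (i : Fin n) (h : A.History) : List (Fin n × A.Msg) :=
  h.filterMap fun (e : ExecStep n A.State A.Msg) => match e with
    | .recv i' _ j m _ => if i' = i then some (j, m) else none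
    | _ => none

/-- Law of the state of `i` after it has received the messages of a list, starting from `s`. -/
noncomputable def recvAll (A : Algorithm.{u, v} n) (i : Fin n) :
    A.State → List (Fin n × A.Msg) → PMF A.State
  | s, [] => PMF.pure s
  | s, (j, m) :: L => (A.recv i s j m).bind fun s' => recvAll A i s' L

/-- Forgetful: each message sent depends only on the input bit and on the messages received and the
local randomness sampled since the previous sending event. In detail, let `i` have its previous
sending event at the end of `h₀` (or none so far, and `h₀` empty) and receive the messages `L` in
the steps `h₁` since. The randomness that `i` samples when it receives `L` determines (`γ`, by which
the state of `i` may be refined) a vector `v` of messages whose law `κ i (x i) L` depends only on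
the input bit and on `L`, and any message that `i` now sends to `k` is `v k`. The law is that
conditional on all that happened up to the end of `h₀`. -/
def Forgetful (A : Algorithm.{u, v} n) : Prop :=
  ∃ κ : Fin n → Bool → List (Fin n × A.Msg) → PMF (Fin n → A.Msg),
    ∀ (x : Fin n → Bool) (h₀ h₁ : A.History), A.Reachable x (h₀ ++ h₁) →
    ∀ i : Fin n, (h₀ = [] ∨ ∃ e, h₀.getLast? = some e ∧ A.IsSendingEvent i e) →
    (∀ e ∈ h₁, ¬ A.IsSendingEvent i e) →
    ∃ γ : A.State → PMF (Fin n → A.Msg),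
      (A.recvAll i (A.stateAt x h₀ i) (A.receivedBy i h₁)).bind γ =
        κ i (x i) (A.receivedBy i h₁) ∧
      ∀ s ∈ (A.recvAll i (A.stateAt x h₀ i) (A.receivedBy i h₁)).support,
        ∀ v ∈ (γ s).support, ∀ k m, A.send i s k = some m → v k = m

/-- The most recent message from `j` to `i` in `h` is the one that was sent in step `k`. -/
def IsLatest (A : Algorithm.{u, v} n) (h : A.History) (j i : Fin n) (k : ℕ) : Prop :=
  (∃ m, A.SentAt h k j i m) ∧ ∀ k' m', A.SentAt h k' j i m' → k' ≤ k

/-- `i` has received the message sent to it in step `k`, and had no sending event since then. -/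
def ReceivedSinceSending (A : Algorithm.{u, v} n) (h : A.History) (i : Fin n) (k : ℕ) : Prop :=
  ∃ (q : ℕ) (j : Fin n) (m : A.Msg) (s : A.State), h[q]? = some (.recv i k j m s) ∧
    ∀ (r : ℕ) (e : ExecStep n A.State A.Msg), h[r]? = some e → A.IsSendingEvent i e → r < q

/-- Fully communicative: a processor is ready to send a message to all `n` processors at the
beginning, and whenever it has received, since its previous sending event, the most recently sent
messages from `n - t` processors. -/
def FullyCommunicative (A : Algorithm.{u, v} n) (t : ℕ) : Prop :=
  (∀ i b k, (A.send i (A.start i b) k).isSome) ∧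
  ∀ x h, A.Reachable x h → ∀ i : Fin n,
    n - t ≤ {j | ∃ k, A.IsLatest h j i k ∧ A.ReceivedSinceSending h i k}.ncard →
    ∀ k, (A.send i (A.stateAt x h i) k).isSome

/-! ### Running time -/

/-- `MessageChain h ℓ a b`: in `h` there are messages `m₁, …, m_ℓ` such that each of them is
received by the sender of the next one prior to the sending of the next one, and `m_ℓ` is the
message sent to `b` in step `a`. -/
inductive MessageChain (A : Algorithm.{u, v} n) (h : A.History) : ℕ → ℕ → Fin n → Prop
  | single (a : ℕ) (j b : Fin n) (m : A.Msg) : A.SentAt h a j b m → MessageChain A h 1 a b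
  | snoc (l a a' q : ℕ) (j b b' : Fin n) (m m' : A.Msg) (s : A.State) :
      MessageChain A h l a b → h[q]? = some (.recv b a j m s) → q < a' →
      A.SentAt h a' b b' m' → MessageChain A h (l + 1) a' b'

/-- No processor has decided. -/
def Undecided (A : Algorithm.{u, v} n) (x : Fin n → Bool) (h : A.History) : Prop :=
  ∀ i, A.out (A.stateAt x h i) = none

/-- The running time of `ω` is at least `r`: at some time before the first decision there is a
message chain of length at least `r`. -/
def RunningTimeAtLeast (A : Algorithm.{u, v} n) (x : Fin n → Bool) (r : ℝ)
    (ω : ℕ → A.History) : Prop :=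
  ∃ N, A.Undecided x (ω N) ∧ ∃ (l a : ℕ) (b : Fin n), A.MessageChain (ω N) l a b ∧ r ≤ l

end Algorithm

/-!
The adversary proceeds in rounds. In a round every processor takes a sending step, and then each
processor `i` receives the messages of the round that come from a set `s i` of at least `n - t`
processors, chosen by the adversary. Full communication makes everybody ready to send at the
beginning of every round (`IsLocalRun.ready`). Forgetfulness gives the randomness of a round a
product structure: given the past, the messages of the next round are independent, and the law of
the messages of `i` depends only on the input of `i` and on what `i` has just received
(`stepsExp_messages`).

The *transcript* of the first `r` rounds consists of the inputs, of all messages that are sent, and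
of the sets chosen by the adversary. It leaves the states open, and it *can decide* `b` if some
execution with this transcript has a processor that has decided `b`. Two transcripts that agree on
all messages that are received cannot decide differently (`not_canDecide_both`): if `a` has decided
`false` in one of the executions and somebody has decided `true` in the other, then crash `a` in the
second execution and wait, by termination, until another processor has decided, which by correctness
is for `true`. Since processors act locally, `a` can follow the first execution while the others
follow the second one (`IsLocalRun.mix`), and this execution has two different decisions.

Put `ε = exp (-t² / (2 n))`. A transcript *leans* to `b` with `k + 1` rounds to go if, for every
choice of the adversary, the next round leads with probability more than `ε` to a transcript that
leans to `b` with `k` rounds to go; with no rounds to go, leaning means that it can decide `b`. The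
isoperimetric inequality `exists_close_of_lt_iterExp` for product measures says that two sets of
probability more than `ε` contain points that differ in fewer than `t` coordinates, not counting one
coordinate `w` in which the two measures may be different. By induction on `k`, two transcripts
which agree on the received messages and whose last messages differ in fewer than `t` processors and
perhaps in `w` do not lean to different decisions (`not_leans_both`): the adversary can withhold the
last messages of these processors, after which the laws of the next messages are the same, except
for that of `w` if the input of `w` is different.

Two consequences follow, each by changing one processor at a time. Some inputs lean to no decision
at the start: the all-`false` inputs cannot lean to `true`, the all-`true` inputs cannot lean to
`false`, and neighbouring inputs do not lean to different decisions (`exists_not_leans`). And if a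
transcript leans to no decision, some choice of the adversary makes it unlikely, for both decisions
at once, that the next transcript leans to it: on a path from a choice that is good against `false`
to one that is good against `true`, neighbouring choices cannot be bad for different decisions
(`exists_leanProb_le`).

The adversary makes these choices for `T` rounds, where `T` is about `1 / (4 ε)`, and is fair
afterwards; no processor ever crashes, since late messages are delivered in the end. With
probability at least `1 - 2 ε T ≥ 1 / 2` the transcript of the `T` rounds leans to no decision; then
nobody has decided, and there is a message chain of length `T + 1`. As `t` is at least `c n / 2`,
this number is at least `exp (c² n / 8) / 4`.
-/

/-! ### Resampling of coordinates -/

open scoped ENNReal in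
/-- Expectation of `f` when the coordinates in the list `l` are resampled independently, coordinate
`i` with law `μ i`, and the other coordinates are those of the given point. -/
noncomputable def iterExp {ι Ω : Type*} [DecidableEq ι] (μ : ι → PMF Ω) :
    List ι → ((ι → Ω) → ℝ≥0∞) → (ι → Ω) → ℝ≥0∞
  | [], f, y => f y
  | i :: l, f, y => ∑' ω, μ i ω * iterExp μ l f (Function.update y i ω)

section IterExp

open scoped ENNReal

variable {ι Ω Ω' : Type*} [DecidableEq ι]

theorem PMF.tsum_mul_const (p : PMF Ω) (c : ℝ≥0∞) : ∑' ω, p ω * c = c := by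
  rw [ENNReal.tsum_mul_right, p.tsum_coe, one_mul]

theorem PMF.tsum_mul_le (p : PMF Ω) {f : Ω → ℝ≥0∞} {c : ℝ≥0∞} (h : ∀ ω, f ω ≤ c) :
    ∑' ω, p ω * f ω ≤ c := by
  refine (ENNReal.tsum_le_tsum fun ω => ?_).trans (p.tsum_mul_const c).le
  gcongr
  exact h ω

theorem PMF.tsum_congr_support (p : PMF Ω) {f g : Ω → ℝ≥0∞} (h : ∀ ω ∈ p.support, f ω = g ω) :
    ∑' ω, p ω * f ω = ∑' ω, p ω * g ω := by
  refine tsum_congr fun ω => ?_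
  by_cases hω : p ω = 0
  · simp [hω]
  · rw [h ω ((p.mem_support_iff ω).2 hω)]

theorem PMF.tsum_le_support (p : PMF Ω) {f g : Ω → ℝ≥0∞} (h : ∀ ω ∈ p.support, f ω ≤ g ω) :
    ∑' ω, p ω * f ω ≤ ∑' ω, p ω * g ω := by
  refine ENNReal.tsum_le_tsum fun ω => ?_
  by_cases hω : p ω = 0
  · simp [hω]
  · gcongr
    exact h ω ((p.mem_support_iff ω).2 hω)

theorem PMF.tsum_pure_mul (a : Ω) (f : Ω → ℝ≥0∞) : ∑' ω, PMF.pure a ω * f ω = f a := by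
  rw [tsum_eq_single a fun b hb => by simp [PMF.pure_apply, hb]]
  simp [PMF.pure_apply]

theorem PMF.tsum_bind_mul (p : PMF Ω) (q : Ω → PMF Ω') (f : Ω' → ℝ≥0∞) :
    ∑' a, p.bind q a * f a = ∑' ω, p ω * ∑' a, q ω a * f a := by
  simp only [PMF.bind_apply, ← ENNReal.tsum_mul_right, ← ENNReal.tsum_mul_left]
  rw [ENNReal.tsum_comm]
  simp only [mul_assoc]

theorem PMF.tsum_map_mul (p : PMF Ω) (g : Ω → Ω') (f : Ω' → ℝ≥0∞) :
    ∑' a, p.map g a * f a = ∑' ω, p ω * f (g ω) := by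
  rw [← PMF.bind_pure_comp, PMF.tsum_bind_mul]
  simp only [Function.comp_apply, PMF.tsum_pure_mul]

/-- Resampling does not depend on the values to be resampled. -/
theorem iterExp_congr (μ : ι → PMF Ω) (l : List ι) (f : (ι → Ω) → ℝ≥0∞) (y y' : ι → Ω)
    (h : ∀ i, i ∉ l → y i = y' i) : iterExp μ l f y = iterExp μ l f y' := by
  induction l generalizing y y' with
  | nil => rw [show y = y' from funext fun i => h i (by simp)]
  | cons i l ih =>
    refine tsum_congr fun ω => ?_
    congr 1
    refine ih _ _ fun j hj => ?_
    by_cases hji : j = i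
    · subst hji; simp
    · simp only [Function.update_of_ne hji]
      exact h j (by simp [hji, hj])

theorem iterExp_mono (μ : ι → PMF Ω) (l : List ι) {f g : (ι → Ω) → ℝ≥0∞} (y : ι → Ω)
    (h : ∀ z, f z ≤ g z) : iterExp μ l f y ≤ iterExp μ l g y := by
  induction l generalizing y with
  | nil => exact h y
  | cons i l ih => exact ENNReal.tsum_le_tsum fun ω => by gcongr; exact ih _

theorem iterExp_add (μ : ι → PMF Ω) (l : List ι) (f g : (ι → Ω) → ℝ≥0∞) (y : ι → Ω) :
    iterExp μ l (fun z => f z + g z) y = iterExp μ l f y + iterExp μ l g y := by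
  induction l generalizing y with
  | nil => rfl
  | cons i l ih => simp only [iterExp, ih, mul_add, ENNReal.tsum_add]

theorem iterExp_const (μ : ι → PMF Ω) (l : List ι) (c : ℝ≥0∞) (y : ι → Ω) :
    iterExp μ l (fun _ => c) y = c := by
  induction l generalizing y with
  | nil => rfl
  | cons i l ih => simp only [iterExp, ih, PMF.tsum_mul_const]

theorem iterExp_const_mul (μ : ι → PMF Ω) (l : List ι) (c : ℝ≥0∞) (f : (ι → Ω) → ℝ≥0∞)
    (y : ι → Ω) : iterExp μ l (fun z => c * f z) y = c * iterExp μ l f y := by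
  induction l generalizing y with
  | nil => rfl
  | cons i l ih =>
    simp only [iterExp, ih, ← ENNReal.tsum_mul_left]
    exact tsum_congr fun ω => by ring

/-- A function of one coordinate sees only the law of that coordinate. -/
theorem iterExp_of_coordinate (μ : ι → PMF Ω) (l : List ι) (hl : l.Nodup) (i : ι) (hi : i ∈ l)
    (f : Ω → ℝ≥0∞) (y : ι → Ω) :
    iterExp μ l (fun z => f (z i)) y = ∑' ω, μ i ω * f ω := by
  have key : ∀ (l : List ι), i ∉ l → ∀ y : ι → Ω, iterExp μ l (fun z => f (z i)) y = f (y i) := by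
    intro l
    induction l with
    | nil => intro _ y; rfl
    | cons j l ih =>
      intro h y
      rw [List.mem_cons, not_or] at h
      simp only [iterExp, ih h.2, Function.update_of_ne h.1, PMF.tsum_mul_const]
  induction l generalizing y with
  | nil => simp at hi
  | cons j l ih =>
    rw [List.nodup_cons] at hl
    by_cases hij : i = j
    · subst hij
      simp only [iterExp, key l hl.1, Function.update_self]
    · simp only [iterExp, ih hl.2 (by simpa [hij] using hi), PMF.tsum_mul_const]

/-- Change of variables, applied to each coordinate. -/
theorem iterExp_comp (μ : ι → PMF Ω) (μ' : ι → PMF Ω') (g : ι → Ω → Ω') (l : List ι)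
    (h : ∀ i ∈ l, (μ i).map (g i) = μ' i) (f : (ι → Ω') → ℝ≥0∞) (y : ι → Ω) :
    iterExp μ l (fun z => f fun i => g i (z i)) y = iterExp μ' l f fun i => g i (y i) := by
  induction l generalizing y with
  | nil => rfl
  | cons i l ih =>
    simp only [iterExp, ← h i (by simp), PMF.tsum_map_mul]
    refine tsum_congr fun ω => ?_
    rw [ih fun j hj => h j (by simp [hj])]
    congr 2
    funext j
    by_cases hj : j = i
    · subst hj; simp
    · simp [Function.update_of_ne hj]

/-! ### Isoperimetry in product spaces -/

/-- One-coordinate case: the bound is `1` on the diagonal and `θ` off the diagonal. -/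
theorem tsum_mul_tsum_le (p : PMF Ω) (F G : Ω → ℝ≥0∞) (θ c : ℝ) (hθ : 1 ≤ θ) (hc : 0 ≤ c)
    (h₁ : ∀ ω, F ω * G ω ≤ ENNReal.ofReal c)
    (h₂ : ∀ ω ω', F ω * G ω' ≤ ENNReal.ofReal (θ * c)) :
    (∑' ω, p ω * F ω) * (∑' ω, p ω * G ω) ≤ ENNReal.ofReal ((1 + θ) ^ 2 / (4 * θ) * c) := by
  set M : ℝ≥0∞ := ⨆ ω, F ω with hM
  have hFM : ∀ ω, F ω ≤ M := fun ω => le_iSup F ω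
  have hMG : ∀ ω, M * G ω ≤ ENNReal.ofReal (θ * c) := fun ω => by
    rw [hM, ENNReal.iSup_mul]
    exact iSup_le fun ω' => h₂ ω' ω
  clear_value M
  by_cases hM0 : M = 0
  · have : ∀ ω, F ω = 0 := fun ω => le_antisymm (hM0 ▸ hFM ω) bot_le
    simp [this]
  by_cases hMt : M = ⊤
  · have : ∀ ω, G ω = 0 := fun ω => by
      by_contra hG
      have := hMG ω
      rw [hMt, ENNReal.top_mul hG] at this
      exact ENNReal.ofReal_ne_top (top_le_iff.1 this)
    simp [this]
  have hθ0 : 0 < θ := by linarith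
  have hM0' : 0 < M.toReal := ENNReal.toReal_pos hM0 hMt
  have hEF : ∑' ω, p ω * F ω ≤ M := p.tsum_mul_le hFM
  have hGb : ∀ ω, G ω ≤ ENNReal.ofReal (θ * c) / M := fun ω => by
    rw [ENNReal.le_div_iff_mul_le (Or.inl hM0) (Or.inl hMt), mul_comm]
    exact hMG ω
  have hGt : ENNReal.ofReal (θ * c) / M ≠ ⊤ := ENNReal.div_ne_top ENNReal.ofReal_ne_top hM0
  have hEG : ∑' ω, p ω * G ω ≤ ENNReal.ofReal (θ * c) / M := p.tsum_mul_le hGb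
  -- `θ u + z ≤ θ + 1` whenever `u ≤ 1`, `z ≤ θ` and `u z ≤ 1`; here `u = F / M`, `z = M G / c`
  have point : ∀ ω, ENNReal.ofReal (θ * c) * F ω + (M * M) * G ω
      ≤ ENNReal.ofReal ((θ + 1) * c) * M := by
    intro ω
    have hF' : F ω ≠ ⊤ := ne_top_of_le_ne_top hMt (hFM ω)
    have hG' : G ω ≠ ⊤ := ne_top_of_le_ne_top hGt (hGb ω)
    obtain ⟨m, rfl⟩ : ∃ m : NNReal, M = m := ⟨M.toNNReal, (ENNReal.coe_toNNReal hMt).symm⟩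
    obtain ⟨f, hf⟩ : ∃ f : NNReal, F ω = f := ⟨_, (ENNReal.coe_toNNReal hF').symm⟩
    obtain ⟨g, hg⟩ : ∃ g : NNReal, G ω = g := ⟨_, (ENNReal.coe_toNNReal hG').symm⟩
    have a1 := hFM ω
    have a2 := hMG ω
    have a3 := h₁ ω
    rw [hf] at a1 a3 ⊢
    rw [hg] at a2 a3 ⊢
    have b1 : (f : ℝ) ≤ m := by exact_mod_cast a1
    have b2 : (m : ℝ) * g ≤ θ * c := by
      rw [← ENNReal.coe_mul, ← ENNReal.ofReal_coe_nnreal, ENNReal.ofReal_le_ofReal_iff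
        (by positivity)] at a2
      simpa using a2
    have b3 : (f : ℝ) * g ≤ c := by
      rw [← ENNReal.coe_mul, ← ENNReal.ofReal_coe_nnreal, ENNReal.ofReal_le_ofReal_iff hc] at a3
      simpa using a3
    rw [← ENNReal.ofReal_coe_nnreal (p := f), ← ENNReal.ofReal_coe_nnreal (p := g),
      ← ENNReal.ofReal_coe_nnreal (p := m), ← ENNReal.ofReal_mul (by positivity),
      ← ENNReal.ofReal_mul (by positivity), ← ENNReal.ofReal_mul (by positivity),
      ← ENNReal.ofReal_mul (by positivity), ← ENNReal.ofReal_add (by positivity) (by positivity)]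
    refine ENNReal.ofReal_le_ofReal ?_
    have hm : (0 : ℝ) ≤ m := m.2
    nlinarith [mul_nonneg (sub_nonneg.2 b1) (sub_nonneg.2 b2),
      mul_nonneg hm (sub_nonneg.2 b3)]
  have sum : ENNReal.ofReal (θ * c) * (∑' ω, p ω * F ω) + (M * M) * (∑' ω, p ω * G ω)
      ≤ ENNReal.ofReal ((θ + 1) * c) * M := by
    rw [← ENNReal.tsum_mul_left, ← ENNReal.tsum_mul_left, ← ENNReal.tsum_add]
    refine le_trans (le_of_eq ?_) (p.tsum_mul_le point)
    exact tsum_congr fun ω => by ring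
  set X := ∑' ω, p ω * F ω
  set Y := ∑' ω, p ω * G ω
  have hX : X ≠ ⊤ := ne_top_of_le_ne_top hMt hEF
  have hY : Y ≠ ⊤ := ne_top_of_le_ne_top hGt hEG
  obtain ⟨m, hm⟩ : ∃ m : NNReal, M = m := ⟨M.toNNReal, (ENNReal.coe_toNNReal hMt).symm⟩
  obtain ⟨f, hf⟩ : ∃ f : NNReal, X = f := ⟨_, (ENNReal.coe_toNNReal hX).symm⟩
  obtain ⟨g, hg⟩ : ∃ g : NNReal, Y = g := ⟨_, (ENNReal.coe_toNNReal hY).symm⟩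
  rw [hm] at sum hM0'
  rw [hf, hg] at sum ⊢
  rw [← ENNReal.ofReal_coe_nnreal (p := f), ← ENNReal.ofReal_coe_nnreal (p := g),
    ← ENNReal.ofReal_coe_nnreal (p := m), ← ENNReal.ofReal_mul (by positivity),
    ← ENNReal.ofReal_mul (by positivity), ← ENNReal.ofReal_mul (by positivity),
    ← ENNReal.ofReal_mul (by positivity), ← ENNReal.ofReal_add (by positivity) (by positivity),
    ENNReal.ofReal_le_ofReal_iff (by positivity)] at sum
  rw [← ENNReal.ofReal_coe_nnreal (p := f), ← ENNReal.ofReal_coe_nnreal (p := g),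
    ← ENNReal.ofReal_mul (by positivity)]
  refine ENNReal.ofReal_le_ofReal ?_
  have hm0 : (0 : ℝ) < m := by simpa using hM0'
  rcases hc.eq_or_lt with rfl | hc0
  · have hg0 : (m : ℝ) * m * g ≤ 0 := by nlinarith
    have : (g : ℝ) ≤ 0 := by
      by_contra hgp
      push Not at hgp
      have : 0 < (m : ℝ) * m * g := by positivity
      linarith
    have : (g : ℝ) = 0 := le_antisymm this g.2
    simp [this]
  · rw [div_mul_eq_mul_div, le_div_iff₀ (by positivity)]
    -- AM-GM for the two summands
    have h4 : 4 * ((θ * c * f) * (m * m * g)) ≤ ((θ + 1) * c * m) ^ 2 := by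
      have hs : 0 ≤ θ * c * f + m * m * g := by positivity
      nlinarith [sq_nonneg (θ * c * f - m * m * g), mul_le_mul sum sum hs (by positivity)]
    have : (m : ℝ) ^ 2 * c * (f * g * (4 * θ)) ≤ (m : ℝ) ^ 2 * c * ((1 + θ) ^ 2 * c) := by
      nlinarith
    exact le_of_mul_le_mul_left this (by positivity)

/-- Functional form of the isoperimetric inequality: two families of laws agree except possibly in
coordinate `w`, which the exponent does not count. -/
theorem iterExp_mul_iterExp_le (μ μ' : ι → PMF Ω) (w : ι) (hμ : ∀ i, i ≠ w → μ i = μ' i)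
    [DecidableEq Ω] (θ : ℝ) (hθ : 1 ≤ θ) (f g : (ι → Ω) → ℝ≥0∞) (l : List ι) (hl : l.Nodup) :
    ∀ (c : ℝ), 0 ≤ c → ∀ y y' : ι → Ω,
      (∀ z z' : ι → Ω, (∀ i, i ∉ l → z i = y i) → (∀ i, i ∉ l → z' i = y' i) →
        f z * g z' ≤ ENNReal.ofReal (θ ^ (l.filter fun i => i ≠ w ∧ z i ≠ z' i).length * c)) →
      iterExp μ l f y * iterExp μ' l g y' ≤
        ENNReal.ofReal (((1 + θ) ^ 2 / (4 * θ)) ^ l.length * c) := by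
  have hθ0 : 0 < θ := by linarith
  have hK : 1 ≤ (1 + θ) ^ 2 / (4 * θ) := by
    rw [le_div_iff₀ (by positivity)]
    nlinarith [sq_nonneg (θ - 1)]
  induction l with
  | nil => intro c hc y y' h; simpa [iterExp] using h y y' (by simp) (by simp)
  | cons i l ih =>
    intro c hc y y' h
    rw [List.nodup_cons] at hl
    set K := (1 + θ) ^ 2 / (4 * θ)
    have upd : ∀ (y z : ι → Ω) (ω : Ω), (∀ j, j ∉ l → z j = Function.update y i ω j) →
        z i = ω ∧ ∀ j, j ∉ i :: l → z j = y j := by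
      intro y z ω hz
      refine ⟨by simpa using hz i hl.1, fun j hj => ?_⟩
      rw [List.mem_cons, not_or] at hj
      simpa [Function.update_of_ne hj.1] using hz j hj.2
    have off : ∀ ω ω', i = w ∨ ω = ω' →
        iterExp μ l f (Function.update y i ω) * iterExp μ' l g (Function.update y' i ω')
          ≤ ENNReal.ofReal (K ^ l.length * c) := by
      intro ω ω' hω
      refine ih hl.2 c hc _ _ fun z z' hz hz' => ?_
      obtain ⟨e1, e2⟩ := upd y z ω hz
      obtain ⟨e1', e2'⟩ := upd y' z' ω' hz'
      have := h z z' e2 e2'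
      rwa [List.filter_cons_of_neg] at this
      rcases hω with hw | hw <;> simp [hw, e1, e1']
    have on : ∀ ω ω',
        iterExp μ l f (Function.update y i ω) * iterExp μ' l g (Function.update y' i ω')
          ≤ ENNReal.ofReal (K ^ l.length * (θ * c)) := by
      intro ω ω'
      refine ih hl.2 _ (by positivity) _ _ fun z z' hz hz' => ?_
      obtain ⟨e1, e2⟩ := upd y z ω hz
      obtain ⟨e1', e2'⟩ := upd y' z' ω' hz'
      refine (h z z' e2 e2').trans (ENNReal.ofReal_le_ofReal ?_)
      rw [← mul_assoc, ← pow_succ]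
      refine mul_le_mul_of_nonneg_right (pow_le_pow_right₀ hθ ?_) hc
      · rw [List.filter_cons]
        split_ifs <;> simp
    rw [iterExp, iterExp, List.length_cons]
    by_cases hiw : i = w
    · have : ∀ ω, iterExp μ l f (Function.update y i ω) *
          ∑' ω', μ' i ω' * iterExp μ' l g (Function.update y' i ω')
            ≤ ENNReal.ofReal (K ^ l.length * c) := fun ω => by
        rw [← ENNReal.tsum_mul_left]
        refine le_trans (le_of_eq (tsum_congr fun ω' => ?_))
          ((μ' i).tsum_mul_le fun ω' => off ω ω' (Or.inl hiw))
        ring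
      rw [← ENNReal.tsum_mul_right]
      refine le_trans (le_of_eq (tsum_congr fun ω => by rw [mul_assoc]))
        (((μ i).tsum_mul_le this).trans (ENNReal.ofReal_le_ofReal ?_))
      rw [pow_succ]
      have : 0 ≤ K ^ l.length * c := by positivity
      nlinarith
    · rw [hμ i hiw]
      refine (tsum_mul_tsum_le (μ' i) _ _ θ (K ^ l.length * c) hθ (by positivity)
        (fun ω => off ω ω (Or.inr rfl)) fun ω ω' => ?_).trans (le_of_eq ?_)
      · convert on ω ω' using 2; ring
      · congr 1; ring

/-- Two sets that both have probability more than `exp (-t² / (2 m))`, where `m` is the number of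
coordinates, contain points that differ in less than `t` coordinates other than `w`, even if the law
of coordinate `w` is not the same for the two sets. -/
theorem exists_close_of_lt_iterExp (μ μ' : ι → PMF Ω) (w : ι) (hμ : ∀ i, i ≠ w → μ i = μ' i)
    [DecidableEq Ω] (s s' : Set (ι → Ω)) (l : List ι) (hl : l.Nodup) (hl' : ∀ i, i ∈ l) (t : ℕ)
    (y y' : ι → Ω)
    (hs : ENNReal.ofReal (Real.exp (-(t : ℝ) ^ 2 / (2 * l.length))) <
      iterExp μ l (s.indicator 1) y)
    (hs' : ENNReal.ofReal (Real.exp (-(t : ℝ) ^ 2 / (2 * l.length))) <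
      iterExp μ' l (s'.indicator 1) y') :
    ∃ z ∈ s, ∃ z' ∈ s', (l.filter fun i => i ≠ w ∧ z i ≠ z' i).length < t := by
  by_contra hcon
  push Not at hcon
  have hpos : 0 < l.length := List.length_pos_of_mem (hl' w)
  obtain ⟨m, hm⟩ : ∃ m : ℝ, (l.length : ℝ) = m := ⟨_, rfl⟩
  rw [hm] at hs hs'
  have hm0 : 0 < m := by rw [← hm]; exact_mod_cast hpos
  set θ := Real.exp (2 * t / m) with hθd
  have hθ : 1 ≤ θ := Real.one_le_exp (by positivity)
  have key := iterExp_mul_iterExp_le μ μ' w hμ θ hθ (s.indicator 1)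
    (fun z => ENNReal.ofReal (θ ^ t) * s'.indicator 1 z) l hl 1 zero_le_one y y' ?_
  · rw [iterExp_const_mul, mul_one] at key
    have hK : (1 + θ) ^ 2 / (4 * θ) ≤ Real.exp ((t / m) ^ 2) := by
      have hsq : θ = Real.exp (t / m) * Real.exp (t / m) := by rw [← Real.exp_add, hθd]; ring_nf
      have hcosh : (1 + θ) ^ 2 / (4 * θ) = Real.cosh (t / m) ^ 2 := by
        have he : Real.exp (t / m) ≠ 0 := (Real.exp_pos _).ne'
        rw [Real.cosh_eq, Real.exp_neg, hsq]
        field_simp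
        ring
      rw [hcosh, show ((t : ℝ) / m) ^ 2 = (t / m) ^ 2 / 2 + (t / m) ^ 2 / 2 by ring, Real.exp_add,
        ← sq]
      have := Real.cosh_le_exp_half_sq (t / m)
      gcongr
    have hKm : ((1 + θ) ^ 2 / (4 * θ)) ^ l.length ≤ Real.exp (t ^ 2 / m) := by
      refine (pow_le_pow_left₀ (by positivity) hK _).trans (le_of_eq ?_)
      rw [← Real.exp_nat_mul, hm]
      congr 1
      field_simp
    have hθt : θ ^ t = Real.exp (2 * t ^ 2 / m) := by
      rw [hθd, ← Real.exp_nat_mul]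
      congr 1
      ring
    set ε := Real.exp (-(t : ℝ) ^ 2 / (2 * m)) with hε
    have hlow : ENNReal.ofReal ε * (ENNReal.ofReal (θ ^ t) * ENNReal.ofReal ε) <
        iterExp μ l (s.indicator 1) y * (ENNReal.ofReal (θ ^ t) * iterExp μ' l (s'.indicator 1) y')
        := by
      have hθp : 0 < θ ^ t := by positivity
      refine ENNReal.mul_lt_mul hs ?_
      exact (ENNReal.mul_lt_mul_iff_right (by simpa using hθp) ENNReal.ofReal_ne_top).2 hs'
    have := hlow.trans_le (key.trans (ENNReal.ofReal_le_ofReal hKm))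
    rw [← ENNReal.ofReal_mul (by positivity), ← ENNReal.ofReal_mul (by positivity), hθt, hε,
      ← Real.exp_add, ← Real.exp_add] at this
    refine this.ne ?_
    congr 2
    field_simp
    ring
  · intro z z' _ _
    by_cases hz : z ∈ s
    · by_cases hz' : z' ∈ s'
      · simp only [Set.indicator_of_mem hz, Set.indicator_of_mem hz', Pi.one_apply, mul_one,
          one_mul]
        exact ENNReal.ofReal_le_ofReal (pow_le_pow_right₀ hθ (hcon z hz z' hz'))
      · simp [hz']
    · simp [hz]

end IterExp

/-! ### The law of executions -/

namespace Algorithm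

open scoped ENNReal

variable {n : ℕ} (A : Algorithm.{u, v} n)

theorem lintegral_toMeasure (p : PMF A.History) (g : A.History → ℝ≥0∞) :
    ∫⁻ h, g h ∂p.toMeasure = ∑' h, p h * g h := by
  rw [← p.restrict_toMeasure_support, lintegral_countable _ p.support_countable,
    tsum_subtype p.support fun h => g h * p.toMeasure {h}]
  refine tsum_congr fun h => ?_
  by_cases hh : h ∈ p.support
  · rw [Set.indicator_of_mem hh, p.toMeasure_apply_singleton h trivial, mul_comm]
  · rw [Set.indicator_of_notMem hh, (p.apply_eq_zero_iff h).2 hh, zero_mul]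

/-- Joint law of two consecutive partial executions. -/
theorem lintegral_run_succ (adv : A.Adversary) (x : Fin n → Bool) (N : ℕ)
    (f g : A.History → ℝ≥0∞) :
    ∫⁻ ω, f (ω N) * g (ω (N + 1)) ∂A.runMeasure adv x =
      ∫⁻ ω, f (ω N) * ∑' h', A.stepLaw x (ω N) (adv x (ω N)) h' * g h' ∂A.runMeasure adv x := by
  have hm : ∀ (k : ℕ) (f : A.History → ℝ≥0∞),
      Measurable fun ω : ℕ → A.History => f (ω k) := fun k f =>
    (measurable_from_top (f := f)).comp (measurable_pi_apply k)
  have hmp : ∀ f : A.History → ℝ≥0∞,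
      Measurable fun p : (Π _ : Finset.Iic N, A.History) => f (p ⟨N, by simp⟩) := fun f =>
    (measurable_from_top (f := f)).comp (measurable_pi_apply _)
  have h₁ := Kernel.partialTraj_compProd_traj (X := fun _ => A.History) (κ := A.stepKernel adv x)
    (Nat.zero_le N) (fun _ => [])
  have h₂ := Kernel.traj_map_frestrictLe_apply (X := fun _ => A.History) (κ := A.stepKernel adv x)
    0 N (fun _ => [])
  have hF : Measurable fun p : (Π _ : Finset.Iic N, A.History) × (ℕ → A.History) =>
      f (p.1 ⟨N, by simp⟩) * g (p.2 (N + 1)) :=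
    ((hmp f).comp measurable_fst).mul ((hm (N + 1) g).comp measurable_snd)
  have hG : Measurable fun p : (Π _ : Finset.Iic N, A.History) =>
      f (p ⟨N, by simp⟩) * ∑' h', A.stepLaw x (p ⟨N, by simp⟩) (adv x (p ⟨N, by simp⟩)) h' * g h' :=
    hmp fun h => f h * ∑' h', A.stepLaw x h (adv x h) h' * g h'
  have hr : Measurable fun ω : ℕ → A.History =>
      ((Preorder.frestrictLe N ω, ω) : (Π _ : Finset.Iic N, A.History) × (ℕ → A.History)) := by
    fun_prop
  calc ∫⁻ ω, f (ω N) * g (ω (N + 1)) ∂A.runMeasure adv x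
      = ∫⁻ p, f (p.1 ⟨N, by simp⟩) * g (p.2 (N + 1)) ∂((Kernel.traj (X := fun _ => A.History)
          (A.stepKernel adv x) 0 fun _ => []).map fun ω => (Preorder.frestrictLe N ω, ω)) := by
        rw [lintegral_map hF hr]; rfl
    _ = ∫⁻ p, f (p ⟨N, by simp⟩) * ∑' h', A.stepLaw x (p ⟨N, by simp⟩) (adv x (p ⟨N, by simp⟩)) h'
          * g h' ∂(Kernel.partialTraj (X := fun _ => A.History) (A.stepKernel adv x) 0 N
            fun _ => []) := by
        rw [← h₁, Measure.lintegral_compProd hF]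
        refine lintegral_congr fun p => ?_
        change ∫⁻ ω : ℕ → A.History, f (p ⟨N, by simp⟩) * g (ω (N + 1)) ∂_ = _
        rw [lintegral_const_mul _ (hm (N + 1) g)]
        congr 1
        have h₃ := congrArg (fun κ => κ p)
          (Kernel.map_traj_succ_self (X := fun _ => A.History) (κ := A.stepKernel adv x) (a := N))
        rw [Kernel.map_apply _ (measurable_pi_apply _)] at h₃
        have : ∫⁻ ω, g (ω (N + 1)) ∂(Kernel.traj (X := fun _ => A.History) (A.stepKernel adv x) N p)
            = ∫⁻ h, g h ∂(A.stepKernel adv x N p) := by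
          rw [← h₃, lintegral_map measurable_from_top (measurable_pi_apply _)]
        rw [this]
        change ∫⁻ h, g h ∂(PMF.toMeasure _) = _
        exact A.lintegral_toMeasure _ g
    _ = _ := by
        rw [← h₂, lintegral_map hG (by fun_prop)]; rfl

instance (adv : A.Adversary) (x : Fin n → Bool) : IsProbabilityMeasure (A.runMeasure adv x) := by
  unfold runMeasure
  infer_instance

theorem measurable_run_apply (N : ℕ) (f : A.History → ℝ≥0∞) :
    Measurable fun ω : ℕ → A.History => f (ω N) :=
  (measurable_from_top (f := f)).comp (measurable_pi_apply N)

theorem measurableSet_run_apply (N : ℕ) (s : Set A.History) :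
    MeasurableSet {ω : ℕ → A.History | ω N ∈ s} :=
  measurable_pi_apply (X := fun _ : ℕ => A.History) N (show MeasurableSet s from trivial)

theorem lintegral_run_indicator (adv : A.Adversary) (x : Fin n → Bool) (N : ℕ)
    (s : Set A.History) :
    ∫⁻ ω, s.indicator 1 (ω N) ∂A.runMeasure adv x = A.runMeasure adv x {ω | ω N ∈ s} := by
  rw [← lintegral_indicator_one (A.measurableSet_run_apply N s)]
  rfl

/-- Expectation of `f` of the partial execution that is reached `m` steps after `h`. -/
noncomputable def stepsExp (adv : A.Adversary) (x : Fin n → Bool) :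
    ℕ → (A.History → ℝ≥0∞) → A.History → ℝ≥0∞
  | 0, f, h => f h
  | m + 1, f, h => ∑' h', A.stepLaw x h (adv x h) h' * stepsExp adv x m f h'

theorem lintegral_run_add (adv : A.Adversary) (x : Fin n → Bool) (N m : ℕ)
    (f : A.History → ℝ≥0∞) :
    ∫⁻ ω, f (ω (N + m)) ∂A.runMeasure adv x =
      ∫⁻ ω, A.stepsExp adv x m f (ω N) ∂A.runMeasure adv x := by
  induction m generalizing N with
  | zero => rfl
  | succ m ih =>
    rw [show N + (m + 1) = (N + 1) + m by ring, ih (N + 1)]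
    simpa [stepsExp] using A.lintegral_run_succ adv x N 1 (A.stepsExp adv x m f)

theorem stepsExp_le {adv : A.Adversary} {x : Fin n → Bool} {f : A.History → ℝ≥0∞} {c : ℝ≥0∞}
    (hf : ∀ g, f g ≤ c) (m : ℕ) (h : A.History) : A.stepsExp adv x m f h ≤ c := by
  induction m generalizing h with
  | zero => exact hf h
  | succ m ih => exact PMF.tsum_mul_le _ ih

theorem run_zero (adv : A.Adversary) (x : Fin n → Bool) :
    ∀ᵐ ω ∂A.runMeasure adv x, ω 0 = [] := by
  have h₂ := Kernel.traj_map_frestrictLe_apply (X := fun _ => A.History)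
    (κ := A.stepKernel adv x) 0 0 (fun _ => [])
  rw [Kernel.partialTraj_self, Kernel.id_apply] at h₂
  have : ∀ᵐ p ∂((A.runMeasure adv x).map (Preorder.frestrictLe 0)),
      p ⟨0, by simp⟩ = ([] : A.History) := by
    rw [runMeasure, h₂, ae_dirac_iff]
    · exact measurable_pi_apply (X := fun _ : Finset.Iic 0 => A.History) _
        (show MeasurableSet ({[]} : Set A.History) from trivial)
  exact ae_of_ae_map (by fun_prop) this

/-- Almost every infinite execution takes only steps of positive probability. Since the space of
partial executions may be uncountable, this uses that the partial executions of each length lie,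
almost surely, in a countable set. -/
theorem ae_isRun (adv : A.Adversary) (x : Fin n → Bool) :
    ∀ᵐ ω ∂A.runMeasure adv x, A.IsRun adv x ω := by
  have hcount : ∀ N, ∃ s : Set A.History, s.Countable ∧
      ∀ᵐ ω ∂A.runMeasure adv x, ω N ∈ s := by
    intro N
    induction N with
    | zero =>
      exact ⟨{[]}, Set.countable_singleton _, A.run_zero adv x⟩
    | succ N ih =>
      obtain ⟨s, hs, hae⟩ := ih
      refine ⟨⋃ h ∈ s, (A.stepLaw x h (adv x h)).support,
        hs.biUnion fun h _ => PMF.support_countable _, ?_⟩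
      set s' := ⋃ h ∈ s, (A.stepLaw x h (adv x h)).support with hs'
      have h₁ := A.lintegral_run_add adv x N 1 (s'ᶜ.indicator 1)
      rw [lintegral_run_indicator] at h₁
      rw [ae_iff]
      refine Eq.trans h₁ ?_
      rw [lintegral_eq_zero_iff (A.measurable_run_apply N _)]
      filter_upwards [hae] with ω hω
      simp only [stepsExp, Pi.zero_apply, ENNReal.tsum_eq_zero, mul_eq_zero]
      intro h'
      by_cases hh : h' ∈ (A.stepLaw x (ω N) (adv x (ω N))).support
      · right
        have : h' ∈ s' := Set.mem_biUnion hω hh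
        simp [this]
      · left
        exact (PMF.apply_eq_zero_iff _ _).2 hh
  have hstep : ∀ N, ∀ᵐ ω ∂A.runMeasure adv x,
      ω (N + 1) ∈ (A.stepLaw x (ω N) (adv x (ω N))).support := by
    intro N
    obtain ⟨s, hs, hae⟩ := hcount N
    have hone : ∀ h ∈ s, ∀ᵐ ω ∂A.runMeasure adv x,
        ω N = h → ω (N + 1) ∈ (A.stepLaw x h (adv x h)).support := by
      intro h _
      set g : A.History → ℝ≥0∞ := (A.stepLaw x h (adv x h)).supportᶜ.indicator 1
      have h₁ := A.lintegral_run_succ adv x N (({h} : Set A.History).indicator 1) g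
      have h₂ : ∫⁻ ω, ({h} : Set A.History).indicator 1 (ω N) * g (ω (N + 1))
          ∂A.runMeasure adv x = 0 := by
        rw [h₁]
        refine (lintegral_congr fun ω => ?_).trans lintegral_zero
        by_cases hω : ω N = h
        · rw [hω]
          refine mul_eq_zero_of_right _ (ENNReal.tsum_eq_zero.2 fun h' => ?_)
          by_cases hh : h' ∈ (A.stepLaw x h (adv x h)).support
          · simp [g, hh]
          · rw [(PMF.apply_eq_zero_iff _ _).2 hh, zero_mul]
        · simp [hω]
      have h₃ := (lintegral_eq_zero_iff ((A.measurable_run_apply N _).mul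
        (A.measurable_run_apply (N + 1) g))).1 h₂
      filter_upwards [h₃] with ω hω hωN
      by_contra hcon
      have : (1 : ℝ≥0∞) = 0 := by
        have h₃ : ({h} : Set A.History).indicator 1 (ω N) * g (ω (N + 1)) = 0 := hω
        have hg : g (ω (N + 1)) = 1 := Set.indicator_of_mem hcon _
        rwa [hωN, Set.indicator_of_mem (Set.mem_singleton h), hg, Pi.one_apply, one_mul] at h₃
      exact one_ne_zero this
    rw [← ae_ball_iff hs] at hone
    filter_upwards [hae, hone] with ω h₁ h₂
    exact h₂ _ h₁ rfl
  filter_upwards [A.run_zero adv x, ae_all_iff.2 hstep] with ω h₁ h₂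
  exact ⟨h₁, h₂⟩

/-- A finite sequence of steps of positive probability has positive probability. -/
theorem runMeasure_pos (adv : A.Adversary) (x : Fin n → Bool) (h : ℕ → A.History) (N : ℕ)
    (h0 : h 0 = []) (hstep : ∀ q < N, h (q + 1) ∈ (A.stepLaw x (h q) (adv x (h q))).support) :
    0 < A.runMeasure adv x {ω | ω N = h N} := by
  induction N with
  | zero =>
    have : A.runMeasure adv x {ω | ω 0 = h 0} = 1 := by
      rw [h0]
      exact (prob_compl_eq_zero_iff
        (A.measurableSet_run_apply 0 {[]})).1 (A.run_zero adv x)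
    rw [this]
    exact one_pos
  | succ N ih =>
    have ih := ih fun q hq => hstep q (by omega)
    have h₁ := A.lintegral_run_add adv x N 1 (({h (N + 1)} : Set A.History).indicator 1)
    rw [lintegral_run_indicator] at h₁
    change 0 < A.runMeasure adv x {ω | ω (N + 1) ∈ ({h (N + 1)} : Set A.History)}
    rw [h₁, lintegral_pos_iff_support (A.measurable_run_apply N _)]
    refine ih.trans_le (measure_mono fun ω hω => ?_)
    have hω : ω N = h N := hω
    simp only [stepsExp, Function.mem_support, hω]
    refine fun h₀ => ?_
    have := ENNReal.tsum_eq_zero.1 h₀ (h (N + 1))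
    rw [Set.indicator_of_mem (Set.mem_singleton _), Pi.one_apply, mul_one] at this
    exact (PMF.mem_support_iff _ _).1 (hstep N (by omega)) this

end Algorithm

/-! ### Local runs -/

/-- The processor that takes the step. -/
def AdvMove.owner {n : ℕ} : AdvMove n → Fin n
  | .send i => i
  | .deliver i _ => i

namespace Algorithm

variable {n : ℕ} (A : Algorithm.{u, v} n)

open Classical in
/-- The message, with its sender, that is delivered to `i` in step `q` if the adversary then asks
for the one sent in step `k`. The moves of the adversary are `mv`, and `σ k j` is the state of `j`
after `k` steps. -/
noncomputable def inbox (mv : ℕ → AdvMove n) (σ : ℕ → Fin n → A.State) (q : ℕ) (i : Fin n)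
    (k : ℕ) : Option (Fin n × A.Msg) :=
  if k < q ∧ ∀ q', k < q' → q' < q → mv q' ≠ .deliver i k then
    match mv k with
    | .send j => (A.send j (σ k j) i).map fun m => (j, m)
    | .deliver _ _ => none
  else none

/-- The states before and after step `q` are related as the move `mv q` demands. -/
def LocalStep (mv : ℕ → AdvMove n) (σ : ℕ → Fin n → A.State) (q : ℕ) : Prop :=
  match mv q with
  | .send i => σ (q + 1) =
      if ∃ k, (A.send i (σ q i) k).isSome then Function.update (σ q) i (A.sent i (σ q i)) else σ q
  | .deliver i k =>
    match A.inbox mv σ q i k with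
    | some (j, m) => ∃ s ∈ (A.recv i (σ q i) j m).support, σ (q + 1) = Function.update (σ q) i s
    | none => σ (q + 1) = σ q

/-- The first `N` steps of an execution in which the adversary makes the moves `mv`, given by the
states of the processors. The condition on a processor involves the others only through the messages
that it receives, so that executions can be recombined processor by processor. -/
structure IsLocalRun (mv : ℕ → AdvMove n) (x : Fin n → Bool) (σ : ℕ → Fin n → A.State)
    (N : ℕ) : Prop where
  start : σ 0 = fun i => A.start i (x i)
  step : ∀ q < N, A.LocalStep mv σ q

/-- What is recorded in step `q`. -/
noncomputable def record (mv : ℕ → AdvMove n) (σ : ℕ → Fin n → A.State) (q : ℕ) :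
    ExecStep n A.State A.Msg :=
  match mv q with
  | .send i => .send i (A.send i (σ q i))
  | .deliver i k =>
    match A.inbox mv σ q i k with
    | some (j, m) => .recv i k j m (σ (q + 1) i)
    | none => .skip

/-- The partial execution that consists of the first `N` steps. -/
noncomputable def hist (mv : ℕ → AdvMove n) (σ : ℕ → Fin n → A.State) (N : ℕ) : A.History :=
  (List.range N).map (A.record mv σ)

variable {A} {mv : ℕ → AdvMove n} {σ : ℕ → Fin n → A.State} {x : Fin n → Bool} {N : ℕ}

theorem hist_length : (A.hist mv σ N).length = N := by simp [hist]

theorem hist_succ (q : ℕ) : A.hist mv σ (q + 1) = A.hist mv σ q ++ [A.record mv σ q] := by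
  simp [hist, List.range_succ]

theorem getElem?_hist {k : ℕ} (h : k < N) : (A.hist mv σ N)[k]? = some (A.record mv σ k) := by
  simp [hist, h]

theorem getElem?_hist_eq_some {k : ℕ} {e : ExecStep n A.State A.Msg} :
    (A.hist mv σ N)[k]? = some e ↔ k < N ∧ A.record mv σ k = e := by
  simp only [hist, List.getElem?_map, Option.map_eq_some_iff, List.getElem?_eq_some_iff,
    List.length_range, List.getElem_range]
  constructor
  · rintro ⟨a, ⟨h, rfl⟩, rfl⟩; exact ⟨h, rfl⟩
  · rintro ⟨h, rfl⟩; exact ⟨k, ⟨h, rfl⟩, rfl⟩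

theorem mem_hist {e : ExecStep n A.State A.Msg} :
    e ∈ A.hist mv σ N ↔ ∃ q < N, A.record mv σ q = e := by
  simp [hist]

theorem take_hist {q : ℕ} (h : q ≤ N) : (A.hist mv σ N).take q = A.hist mv σ q := by
  simp [hist, ← List.map_take, List.take_range, h]

theorem record_send {q : ℕ} {i : Fin n} (h : mv q = .send i) :
    A.record mv σ q = .send i (A.send i (σ q i)) := by
  simp [record, h]

theorem record_eq_send {q : ℕ} {i : Fin n} {w : Fin n → Option A.Msg}
    (h : A.record mv σ q = .send i w) : mv q = .send i ∧ w = A.send i (σ q i) := by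
  unfold record at h
  split at h
  · rename_i i' hi'
    injection h with h₁ h₂
    subst h₁
    exact ⟨hi', h₂.symm⟩
  · split at h <;> simp at h

theorem record_deliver {q : ℕ} {i : Fin n} {k : ℕ} {j : Fin n} {m : A.Msg}
    (h : mv q = .deliver i k) (h' : A.inbox mv σ q i k = some (j, m)) :
    A.record mv σ q = .recv i k j m (σ (q + 1) i) := by
  simp [record, h, h']

theorem record_skip {q : ℕ} {i : Fin n} {k : ℕ}
    (h : mv q = .deliver i k) (h' : A.inbox mv σ q i k = none) :
    A.record mv σ q = .skip := by
  simp [record, h, h']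

theorem record_eq_recv {q : ℕ} {i : Fin n} {k : ℕ} {j : Fin n} {m : A.Msg} {s : A.State}
    (h : A.record mv σ q = .recv i k j m s) :
    mv q = .deliver i k ∧ A.inbox mv σ q i k = some (j, m) ∧ s = σ (q + 1) i := by
  unfold record at h
  split at h
  · simp at h
  · rename_i i' k' hi'
    split at h
    · rename_i j' m' hj
      injection h with h₁ h₂ h₃ h₄ h₅
      subst h₁ h₂ h₃ h₄
      exact ⟨hi', hj, h₅.symm⟩
    · simp at h

theorem inbox_eq_some {q : ℕ} {i : Fin n} {k : ℕ} {j : Fin n} {m : A.Msg} :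
    A.inbox mv σ q i k = some (j, m) ↔
      k < q ∧ (∀ q', k < q' → q' < q → mv q' ≠ .deliver i k) ∧ mv k = .send j ∧
        A.send j (σ k j) i = some m := by
  unfold inbox
  split_ifs with h
  · split
    · rename_i j' hj'
      simp only [Option.map_eq_some_iff, Prod.mk.injEq, hj', AdvMove.send.injEq]
      constructor
      · rintro ⟨m', h₁, rfl, rfl⟩
        exact ⟨h.1, h.2, rfl, h₁⟩
      · rintro ⟨-, -, rfl, h₂⟩
        exact ⟨m, h₂, rfl, rfl⟩
    · rename_i hj'
      simp [hj']
  · simp only [false_iff]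
    rintro ⟨h₁, h₂, -⟩
    exact h ⟨h₁, h₂⟩

theorem inbox_self (q : ℕ) (i : Fin n) : A.inbox mv σ q i q = none := by
  simp [inbox]

/-- The first request for a message that is there is granted. -/
theorem exists_record_recv {q : ℕ} {i : Fin n} {k : ℕ} {j : Fin n} {m : A.Msg} (hk : k < q)
    (hq : mv q = .deliver i k) (hs : mv k = .send j) (hm : A.send j (σ k j) i = some m) :
    ∃ q' ≤ q, k < q' ∧ A.record mv σ q' = .recv i k j m (σ (q' + 1) i) := by
  classical
  have hex : ∃ q', k < q' ∧ mv q' = .deliver i k := ⟨q, hk, hq⟩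
  have hmin := Nat.find_spec hex
  refine ⟨Nat.find hex, Nat.find_min' hex ⟨hk, hq⟩, hmin.1, record_deliver hmin.2 ?_⟩
  refine inbox_eq_some.2 ⟨hmin.1, fun q' h₁ h₂ h₃ => ?_, hs, hm⟩
  exact Nat.find_min hex h₂ ⟨h₁, h₃⟩

theorem pending_hist (i : Fin n) (k : ℕ) :
    A.pending (A.hist mv σ N) i k = A.inbox mv σ N i k := by
  have hval : ∀ j m, A.pending (A.hist mv σ N) i k = some (j, m) ↔
      A.inbox mv σ N i k = some (j, m) := by
    intro j m
    rw [inbox_eq_some]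
    unfold pending
    split_ifs with h
    · simp only [false_iff]
      rintro ⟨-, hfresh, -⟩
      obtain ⟨j', m', s, hmem⟩ := h
      obtain ⟨q, hq, hrec⟩ := mem_hist.1 hmem
      obtain ⟨h₁, h₂, -⟩ := record_eq_recv hrec
      exact hfresh q (inbox_eq_some.1 h₂).1 hq h₁
    · have hval : (∃ w, (A.hist mv σ N)[k]? = some (.send j w) ∧ w i = some m) ↔
          k < N ∧ mv k = .send j ∧ A.send j (σ k j) i = some m := by
        constructor
        · rintro ⟨w, hw, hwm⟩
          obtain ⟨h₁, h₂⟩ := getElem?_hist_eq_some.1 hw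
          obtain ⟨h₃, rfl⟩ := record_eq_send h₂
          exact ⟨h₁, h₃, hwm⟩
        · rintro ⟨h₁, h₂, h₃⟩
          exact ⟨_, by rw [getElem?_hist h₁, record_send h₂], h₃⟩
      have hfresh : k < N → mv k = .send j → A.send j (σ k j) i = some m →
          ∀ q', k < q' → q' < N → mv q' ≠ .deliver i k := by
        intro _ h₂ h₃ q' h₄ h₅ h₆
        obtain ⟨q'', h₇, -, h₈⟩ := exists_record_recv h₄ h₆ h₂ h₃
        exact h ⟨j, m, _, mem_hist.2 ⟨q'', by omega, h₈⟩⟩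
      trans (∃ w, (A.hist mv σ N)[k]? = some (.send j w) ∧ w i = some m)
      · split
        · rename_i j' w hw
          simp only [Option.map_eq_some_iff, Prod.mk.injEq, hw, Option.some.injEq,
            ExecStep.send.injEq]
          constructor
          · rintro ⟨m', h₁, rfl, rfl⟩
            exact ⟨w, ⟨rfl, rfl⟩, h₁⟩
          · rintro ⟨w', ⟨rfl, rfl⟩, h₁⟩
            exact ⟨m, h₁, rfl, rfl⟩
        · rename_i hne
          simp only [reduceCtorEq, false_iff]
          rintro ⟨w, hw, -⟩
          exact hne _ _ hw
      · rw [hval]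
        constructor
        · rintro ⟨h₁, h₂, h₃⟩
          exact ⟨h₁, hfresh h₁ h₂ h₃, h₂, h₃⟩
        · rintro ⟨h₁, -, h₂, h₃⟩
          exact ⟨h₁, h₂, h₃⟩
  refine Option.ext fun p => ?_
  obtain ⟨j, m⟩ := p
  simpa using hval j m

theorem stateAt_append (h h' : A.History) :
    A.stateAt x (h ++ h') = h'.foldl A.applyEvent (A.stateAt x h) := by
  simp [stateAt]

theorem IsLocalRun.mono (h : A.IsLocalRun mv x σ N) {N' : ℕ} (hN : N' ≤ N) :
    A.IsLocalRun mv x σ N' :=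
  ⟨h.start, fun q hq => h.step q (by omega)⟩

theorem applyEvent_record {q : ℕ} (h : A.LocalStep mv σ q) :
    A.applyEvent (σ q) (A.record mv σ q) = σ (q + 1) := by
  unfold LocalStep at h
  split at h
  · rename_i i hi
    rw [record_send hi, h]
    simp only [applyEvent]
  · rename_i i k hi
    split at h
    · rename_i j m hm
      obtain ⟨s, -, hs⟩ := h
      rw [record_deliver hi hm, hs]
      simp [applyEvent]
    · rename_i hm
      rw [record_skip hi hm, h]
      rfl

theorem IsLocalRun.stateAt_hist (h : A.IsLocalRun mv x σ N) {q : ℕ} (hq : q ≤ N) :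
    A.stateAt x (A.hist mv σ q) = σ q := by
  induction q with
  | zero => exact h.start.symm
  | succ q ih =>
    rw [hist_succ, stateAt_append, ih (by omega)]
    exact applyEvent_record (h.step q (by omega))

theorem IsLocalRun.hist_succ_mem (h : A.IsLocalRun mv x σ N) {q : ℕ} (hq : q < N) :
    A.hist mv σ (q + 1) ∈ (A.stepLaw x (A.hist mv σ q) (mv q)).support := by
  have hst := h.stateAt_hist hq.le
  have hstep := h.step q hq
  rw [hist_succ]
  unfold LocalStep at hstep
  split at hstep
  · rename_i i hi
    simp [stepLaw, record_send hi, hi, hst]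
  · rename_i i k hi
    simp only [stepLaw, hi]
    rw [pending_hist]
    split at hstep
    · rename_i j m hm
      obtain ⟨s, hs, hs'⟩ := hstep
      rw [record_deliver hi hm, hs', hst]
      simp only [Function.update_self, PMF.support_map, Set.mem_image]
      exact ⟨s, hs, rfl⟩
    · rename_i hm
      rw [record_skip hi hm]
      simp

theorem IsLocalRun.reachable (h : A.IsLocalRun mv x σ N) {q : ℕ} (hq : q ≤ N) :
    A.Reachable x (A.hist mv σ q) := by
  induction q with
  | zero => exact .nil
  | succ q ih => exact .step _ _ _ (ih (by omega)) (h.hist_succ_mem (by omega))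

/-- Every execution is a local run. -/
theorem isLocalRun_of_steps (mv : ℕ → AdvMove n) (x : Fin n → Bool) (ω : ℕ → A.History) (N : ℕ)
    (h0 : ω 0 = []) (hstep : ∀ q < N, ω (q + 1) ∈ (A.stepLaw x (ω q) (mv q)).support) :
    A.IsLocalRun mv x (fun q => A.stateAt x (ω q)) N ∧
      ∀ q ≤ N, ω q = A.hist mv (fun q => A.stateAt x (ω q)) q := by
  set σ : ℕ → Fin n → A.State := fun q => A.stateAt x (ω q) with hσ
  have key : ∀ q < N, ω q = A.hist mv σ q →
      ω (q + 1) = A.hist mv σ (q + 1) ∧ A.LocalStep mv σ q := by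
    intro q hq hω
    have hs := hstep q hq
    have hst : ∀ q, A.stateAt x (ω q) = σ q := fun _ => rfl
    rw [hist_succ, ← hω]
    unfold LocalStep
    split
    · rename_i i hi
      rw [hi] at hs
      simp only [stepLaw, PMF.support_pure, Set.mem_singleton_iff] at hs
      rw [record_send hi, hs]
      refine ⟨rfl, ?_⟩
      rw [hσ]
      simp only [hs, stateAt_append, List.foldl_cons, List.foldl_nil, applyEvent]
    · rename_i i k hi
      rw [hi] at hs
      simp only [stepLaw] at hs
      rw [hω, pending_hist, ← hω] at hs
      split
      · rename_i j m hm
        rw [hm] at hs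
        simp only [PMF.support_map, Set.mem_image] at hs
        obtain ⟨s, hs, hs'⟩ := hs
        have hup : σ (q + 1) = Function.update (σ q) i s := by
          rw [hσ]
          simp only [← hs', stateAt_append, List.foldl_cons, List.foldl_nil, applyEvent]
        rw [record_deliver hi hm, ← hs', hup]
        exact ⟨by simp, s, hs, rfl⟩
      · rename_i hm
        rw [hm] at hs
        simp only [PMF.support_pure, Set.mem_singleton_iff] at hs
        rw [record_skip hi hm, hs]
        refine ⟨rfl, ?_⟩
        rw [hσ]
        simp only [hs, stateAt_append, List.foldl_cons, List.foldl_nil, applyEvent]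
  have hall : ∀ q ≤ N, ω q = A.hist mv σ q := by
    intro q hq
    induction q with
    | zero => rw [h0]; rfl
    | succ q ih => exact (key q (by omega) (ih (by omega))).1
  refine ⟨⟨?_, fun q hq => (key q hq (hall q hq.le)).2⟩, hall⟩
  change A.stateAt x (ω 0) = _
  rw [h0]
  rfl

theorem IsRun.isLocalRun {adv : A.Adversary} {ω : ℕ → A.History} (h : A.IsRun adv x ω) (N : ℕ) :
    A.IsLocalRun (fun q => adv x (ω q)) x (fun q => A.stateAt x (ω q)) N :=
  (isLocalRun_of_steps _ x ω N h.1 fun q _ => h.2 q).1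

theorem IsRun.eq_hist {adv : A.Adversary} {ω : ℕ → A.History} (h : A.IsRun adv x ω) (q : ℕ) :
    ω q = A.hist (fun q => adv x (ω q)) (fun q => A.stateAt x (ω q)) q :=
  (isLocalRun_of_steps _ x ω q h.1 fun q _ => h.2 q).2 q le_rfl

theorem LocalStep.eq_of_ne {q : ℕ} (h : A.LocalStep mv σ q) {i : Fin n}
    (hi : (mv q).owner ≠ i) : σ (q + 1) i = σ q i := by
  unfold LocalStep at h
  split at h
  · rename_i i' hi'
    rw [hi'] at hi
    rw [h]
    split_ifs
    · exact Function.update_of_ne (Ne.symm hi) _ _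
    · rfl
  · rename_i i' k hi'
    rw [hi'] at hi
    split at h
    · obtain ⟨s, -, hs⟩ := h
      rw [hs]
      exact Function.update_of_ne (Ne.symm hi) _ _
    · rw [h]

/-- A processor that does not act keeps its state. -/
theorem IsLocalRun.eq_of_forall_ne (h : A.IsLocalRun mv x σ N) {q q' : ℕ} (hq : q ≤ q')
    (hq' : q' ≤ N) {i : Fin n} (hi : ∀ p, q ≤ p → p < q' → (mv p).owner ≠ i) :
    σ q' i = σ q i := by
  induction q', hq using Nat.le_induction with
  | base => rfl
  | succ q' hqq ih =>
    rw [(h.step q' (by omega)).eq_of_ne (hi q' hqq (by omega))]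
    exact ih (by omega) fun p h₁ h₂ => hi p h₁ (by omega)

theorem LocalStep.out_eq {q : ℕ} (h : A.LocalStep mv σ q) {i : Fin n} {b : Bool}
    (hb : A.out (σ q i) = some b) : A.out (σ (q + 1) i) = some b := by
  by_cases hi : (mv q).owner = i
  · unfold LocalStep at h
    split at h
    · rename_i i' hi'
      rw [hi'] at hi
      change i' = i at hi
      subst hi
      rw [h]
      split_ifs
      · rw [Function.update_self, A.out_sent, hb]
      · exact hb
    · rename_i i' k hi'
      rw [hi'] at hi
      change i' = i at hi
      subst hi
      split at h
      · obtain ⟨s, hs, hs'⟩ := h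
        rw [hs', Function.update_self]
        exact A.out_recv _ _ _ _ s hs b hb
      · rw [h, hb]
  · rw [h.eq_of_ne hi, hb]

theorem IsLocalRun.out_eq (h : A.IsLocalRun mv x σ N) {q q' : ℕ} (hq : q ≤ q') (hq' : q' ≤ N)
    {i : Fin n} {b : Bool} (hb : A.out (σ q i) = some b) : A.out (σ q' i) = some b := by
  induction q', hq using Nat.le_induction with
  | base => exact hb
  | succ q' hqq ih => exact (h.step q' (by omega)).out_eq (ih (by omega))

end Algorithm

/-! ### Round plans -/

/-- The slots of a round: a sending step of `i`, one delivery of an old message, and the delivery to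
`i` of the message that `j` has sent in this round. -/
inductive Slot (n : ℕ) : Type
  | send (i : Fin n)
  | late
  | deliver (i j : Fin n)

/-- The number of steps in a round. -/
def roundLength (n : ℕ) : ℕ := n + 1 + n * n

/-- Position in a round of the delivery to `i` of the message of `j`. -/
def deliverPos {n : ℕ} (i j : Fin n) : ℕ := n + 1 + finProdFinEquiv (i, j)

/-- The slot of the step with number `q`. -/
def slotAt (n q : ℕ) : Slot n :=
  if h : q % roundLength n < n then .send ⟨q % roundLength n, h⟩
  else if h : n < q % roundLength n ∧ q % roundLength n - (n + 1) < n * n then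
    .deliver (finProdFinEquiv.symm ⟨_, h.2⟩).1 (finProdFinEquiv.symm ⟨_, h.2⟩).2
  else .late

section Slots

variable {n : ℕ}

theorem roundLength_pos : 0 < roundLength n := by unfold roundLength; omega

theorem lt_roundLength : n < roundLength n := by unfold roundLength; omega

theorem lt_deliverPos (i j : Fin n) : n < deliverPos i j := by unfold deliverPos; omega

theorem deliverPos_lt (i j : Fin n) : deliverPos i j < roundLength n := by
  unfold deliverPos roundLength
  have := (finProdFinEquiv (i, j)).isLt
  omega

theorem deliverPos_eq (i j : Fin n) : deliverPos i j = n + 1 + (j + n * i) := rfl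

theorem div_roundLength {r p : ℕ} (hp : p < roundLength n) :
    (r * roundLength n + p) / roundLength n = r := by
  rw [mul_comm, Nat.mul_add_div roundLength_pos, Nat.div_eq_of_lt hp, add_zero]

theorem mod_roundLength {r p : ℕ} (hp : p < roundLength n) :
    (r * roundLength n + p) % roundLength n = p := by
  rw [mul_comm, Nat.mul_add_mod, Nat.mod_eq_of_lt hp]

theorem lt_of_mul_add_lt {r r' p p' : ℕ} (h : r * roundLength n + p < r' * roundLength n + p')
    (hp : p' < roundLength n) : r ≤ r' := by
  by_contra hr
  have : (r' + 1) * roundLength n ≤ r * roundLength n := Nat.mul_le_mul_right _ (by omega)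
  rw [Nat.succ_mul] at this
  omega

theorem mul_add_inj {r r' p p' : ℕ} (h : r * roundLength n + p = r' * roundLength n + p')
    (hp : p < roundLength n) (hp' : p' < roundLength n) : r = r' ∧ p = p' := by
  have h₁ := congrArg (· / roundLength n) h
  have h₂ := congrArg (· % roundLength n) h
  simp only [div_roundLength hp, div_roundLength hp', mod_roundLength hp, mod_roundLength hp']
    at h₁ h₂
  exact ⟨h₁, h₂⟩

theorem slotAt_send (r : ℕ) (i : Fin n) : slotAt n (r * roundLength n + i) = .send i := by
  have := i.isLt
  have h : (r * roundLength n + i) % roundLength n = i :=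
    mod_roundLength (this.trans lt_roundLength)
  simp [slotAt, h]

theorem slotAt_late (r : ℕ) : slotAt n (r * roundLength n + n) = .late := by
  simp [slotAt, mod_roundLength (lt_roundLength (n := n))]

theorem slotAt_deliver (r : ℕ) (i j : Fin n) :
    slotAt n (r * roundLength n + deliverPos i j) = .deliver i j := by
  have h₁ := lt_deliverPos i j
  have h₂ : deliverPos i j - (n + 1) = finProdFinEquiv (i, j) := by
    unfold deliverPos; omega
  have h₃ := (finProdFinEquiv (i, j)).isLt
  have hc : n < (r * roundLength n + deliverPos i j) % roundLength n ∧
      (r * roundLength n + deliverPos i j) % roundLength n - (n + 1) < n * n := by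
    rw [mod_roundLength (deliverPos_lt i j)]
    exact ⟨h₁, by omega⟩
  unfold slotAt
  rw [dif_neg (by rw [mod_roundLength (deliverPos_lt i j)]; omega), dif_pos hc]
  have h₄ : (⟨(r * roundLength n + deliverPos i j) % roundLength n - (n + 1), hc.2⟩ :
      Fin (n * n)) = finProdFinEquiv (i, j) := by
    ext
    simp only [mod_roundLength (deliverPos_lt i j), h₂]
  rw [h₄, Equiv.symm_apply_apply]

/-- Every step falls into one of the slots of a round. -/
theorem exists_slot (n q : ℕ) :
    (∃ r, ∃ i : Fin n, q = r * roundLength n + i) ∨ (∃ r, q = r * roundLength n + n) ∨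
      ∃ r, ∃ i j : Fin n, q = r * roundLength n + deliverPos i j := by
  have hq : q = q / roundLength n * roundLength n + q % roundLength n := by
    rw [mul_comm]; exact (Nat.div_add_mod _ _).symm
  have hp := Nat.mod_lt q (roundLength_pos (n := n))
  rcases lt_trichotomy (q % roundLength n) n with h | h | h
  · exact .inl ⟨_, ⟨_, h⟩, hq⟩
  · exact .inr (.inl ⟨_, by rw [h] at hq; exact hq⟩)
  · have h' : q % roundLength n - (n + 1) < n * n := by
      unfold roundLength at hp h ⊢; omega
    refine .inr (.inr ⟨q / roundLength n, (finProdFinEquiv.symm ⟨_, h'⟩).1,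
      (finProdFinEquiv.symm ⟨_, h'⟩).2, ?_⟩)
    unfold deliverPos
    rw [Prod.mk.eta, Equiv.apply_symm_apply]
    simp only
    omega

end Slots

/-- A nonadaptive schedule of rounds. In each round before `horizon`, every processor takes a
sending step, and then `i` receives those messages of the round that come from `hear r i`. From
round `horizon` on, only the processors in `alive` take steps; each of them receives in each round
all messages that they have sent in the round, and old messages are delivered as well. -/
structure Plan (n : ℕ) where
  /-- the senders of the messages that `i` receives in round `r` -/
  hear : ℕ → Fin n → Finset (Fin n)
  /-- the round from which on the execution is fair -/
  horizon : ℕ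
  /-- the processors that do not crash -/
  alive : Finset (Fin n)

namespace Plan

variable {n : ℕ} (P : Plan n)

/-- `i` takes steps in round `r`. -/
def AliveAt (r : ℕ) (i : Fin n) : Prop := r < P.horizon ∨ i ∈ P.alive

/-- The senders of the messages of round `r` that `i` receives in round `r`. -/
def hearAt (r : ℕ) (i : Fin n) : Finset (Fin n) :=
  if r < P.horizon then P.hear r i else if i ∈ P.alive then P.alive else ∅

/-- Everybody hears at least `n - t` processors in each round. -/
def Legal (t : ℕ) : Prop :=
  (∀ r < P.horizon, ∀ i, n - t ≤ (P.hear r i).card) ∧ n - t ≤ P.alive.card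

variable {P}

theorem AliveAt.of_succ {r : ℕ} {i : Fin n} (h : P.AliveAt (r + 1) i) : P.AliveAt r i := by
  exact h.imp (by omega) id

theorem aliveAt_of_mem_hearAt {r : ℕ} {i j : Fin n} (h : j ∈ P.hearAt r i) : P.AliveAt r j := by
  unfold hearAt at h
  unfold AliveAt
  split_ifs at h with h₁ h₂
  · exact .inl h₁
  · exact .inr h
  · simp at h

theorem Legal.card_hearAt {t : ℕ} (hP : P.Legal t) {r : ℕ} {i : Fin n} (h : P.AliveAt r i) :
    n - t ≤ (P.hearAt r i).card := by
  unfold hearAt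
  split_ifs with h₁ h₂
  · exact hP.1 r h₁ i
  · exact hP.2
  · exact absurd h (by simp [AliveAt, h₁, h₂])

theorem mem_hearAt_of_le {r : ℕ} {i j : Fin n} (hr : P.horizon ≤ r) (hi : i ∈ P.alive)
    (hj : j ∈ P.alive) : j ∈ P.hearAt r i := by
  rw [Plan.hearAt, if_neg (by omega), if_pos hi]
  exact hj

variable [NeZero n] (P)

/-- Receiver of the old message whose delivery is requested in round `r`. -/
def lateReceiver (n r : ℕ) [NeZero n] : Fin n := Fin.ofNat n (Nat.unpair r).1

/-- Step in which the old message was sent whose delivery is requested in round `r`. The number `r`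
encodes receiver, step and a third number, so that each request recurs in arbitrarily late
rounds. -/
def lateStep (r : ℕ) : ℕ := (Nat.unpair (Nat.unpair r).2).1

open Classical in
/-- The move in step `q`. In step `q` the request `deliver i q` has no effect, since only a message
that was sent in an earlier step can be delivered; it serves as an idle move of `i`. In this way the
processor that may act in step `q` depends on `q` alone. -/
noncomputable def move (q : ℕ) : AdvMove n :=
  match slotAt n q with
  | .send i => if P.AliveAt (q / roundLength n) i then .send i else .deliver i q
  | .late =>
    if P.horizon ≤ q / roundLength n ∧ lateReceiver n (q / roundLength n) ∈ P.alive ∧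
        lateStep (q / roundLength n) < q / roundLength n * roundLength n ∧
        ∃ j ∈ P.alive, slotAt n (lateStep (q / roundLength n)) = .send j then
      .deliver (lateReceiver n (q / roundLength n)) (lateStep (q / roundLength n))
    else .deliver (lateReceiver n (q / roundLength n)) q
  | .deliver i j =>
    if j ∈ P.hearAt (q / roundLength n) i then
      .deliver i (q / roundLength n * roundLength n + j)
    else .deliver i q

/-- The processor that may act in step `q` of a round plan. -/
def slotOwner (n q : ℕ) [NeZero n] : Fin n :=
  match slotAt n q with
  | .send i => i
  | .late => lateReceiver n (q / roundLength n)
  | .deliver i _ => i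

theorem owner_move (q : ℕ) : (P.move q).owner = slotOwner n q := by
  unfold move slotOwner
  split <;> split_ifs <;> rfl

variable {P}

theorem move_send (r : ℕ) (i : Fin n) (h : P.AliveAt r i) :
    P.move (r * roundLength n + i) = .send i := by
  classical
  have hi := i.isLt.trans lt_roundLength
  simp [move, slotAt_send, div_roundLength hi, h]

theorem move_deliver (r : ℕ) (i j : Fin n) (h : j ∈ P.hearAt r i) :
    P.move (r * roundLength n + deliverPos i j) = .deliver i (r * roundLength n + j) := by
  simp [move, slotAt_deliver, div_roundLength (deliverPos_lt i j), h]

theorem move_deliver_of_notMem (r : ℕ) (i j : Fin n) (h : j ∉ P.hearAt r i) :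
    P.move (r * roundLength n + deliverPos i j) =
      .deliver i (r * roundLength n + deliverPos i j) := by
  simp [move, slotAt_deliver, div_roundLength (deliverPos_lt i j), h]

theorem move_late {r : ℕ} (h₁ : P.horizon ≤ r) (h₂ : lateReceiver n r ∈ P.alive)
    (h₃ : lateStep r < r * roundLength n) (h₄ : ∃ j ∈ P.alive, slotAt n (lateStep r) = .send j) :
    P.move (r * roundLength n + n) = .deliver (lateReceiver n r) (lateStep r) := by
  classical
  simp only [move, slotAt_late, div_roundLength (n := n) (p := n) lt_roundLength]
  rw [if_pos ⟨h₁, h₂, h₃, h₄⟩]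

theorem move_late_of_lt {r : ℕ} (h : r < P.horizon) :
    P.move (r * roundLength n + n) =
      .deliver (lateReceiver n r) (r * roundLength n + n) := by
  classical
  simp only [move, slotAt_late, div_roundLength (n := n) (p := n) lt_roundLength]
  rw [if_neg fun h' => absurd h'.1 (by omega)]

theorem move_eq_send {q : ℕ} {i : Fin n} (h : P.move q = .send i) :
    ∃ r, q = r * roundLength n + i ∧ P.AliveAt r i := by
  classical
  rcases exists_slot n q with ⟨r, i', rfl⟩ | ⟨r, rfl⟩ | ⟨r, i', j, rfl⟩
  · have hi := i'.isLt.trans lt_roundLength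
    simp only [move, slotAt_send, div_roundLength hi] at h
    split_ifs at h with h₁
    injection h with h
    subst h
    exact ⟨r, rfl, h₁⟩
  · simp only [move, slotAt_late] at h
    split_ifs at h
  · simp only [move, slotAt_deliver] at h
    split_ifs at h

/-- The requests for messages are those of the current round and those for old messages. -/
theorem move_eq_deliver {q : ℕ} {i : Fin n} {k : ℕ} (h : P.move q = .deliver i k) (hk : k < q) :
    (∃ r j, q = r * roundLength n + deliverPos i j ∧ k = r * roundLength n + j ∧
      j ∈ P.hearAt r i) ∨
    ∃ r, q = r * roundLength n + n ∧ P.horizon ≤ r ∧ i ∈ P.alive ∧ k < r * roundLength n ∧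
      ∃ j ∈ P.alive, slotAt n k = .send j := by
  classical
  rcases exists_slot n q with ⟨r, i', rfl⟩ | ⟨r, rfl⟩ | ⟨r, i', j, rfl⟩
  · simp only [move, slotAt_send] at h
    split_ifs at h with h₁
    injection h with h₂ h₃
    omega
  · simp only [move, slotAt_late, div_roundLength (n := n) (p := n) lt_roundLength] at h
    split_ifs at h with h₁
    · injection h with h₂ h₃
      subst h₂ h₃
      exact .inr ⟨r, rfl, h₁⟩
    · injection h with h₂ h₃
      omega
  · simp only [move, slotAt_deliver, div_roundLength (deliverPos_lt i' j)] at h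
    split_ifs at h with h₁
    · injection h with h₂ h₃
      subst h₂ h₃
      exact .inl ⟨r, j, rfl, rfl, h₁⟩
    · injection h with h₂ h₃
      omega

/-- The messages of a round are not requested before their slot. -/
theorem move_ne_deliver {r : ℕ} {i j : Fin n} (q : ℕ)
    (h₁ : r * roundLength n + j < q) (h₂ : q < r * roundLength n + deliverPos i j) :
    P.move q ≠ .deliver i (r * roundLength n + j) := by
  intro h
  have hj := j.isLt.trans (lt_roundLength)
  rcases move_eq_deliver h h₁ with ⟨r', j', rfl, h₄, -⟩ | ⟨r', rfl, -, -, h₄, -⟩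
  · obtain ⟨rfl, h₅⟩ := mul_add_inj h₄ hj (j'.isLt.trans lt_roundLength)
    rw [Fin.ext h₅] at h₂
    omega
  · have h₅ : r' ≤ r := lt_of_mul_add_lt h₂ (deliverPos_lt i j)
    have := Nat.mul_le_mul_right (roundLength n) h₅
    omega

theorem slotOwner_send (r : ℕ) (i : Fin n) : slotOwner n (r * roundLength n + i) = i := by
  simp [slotOwner, slotAt_send]

end Plan

namespace Algorithm

variable {n : ℕ} [NeZero n] {A : Algorithm.{u, v} n} {P : Plan n} {x : Fin n → Bool}
  {σ : ℕ → Fin n → A.State} {N t : ℕ}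

theorem IsLocalRun.eq_roundStart (h : A.IsLocalRun P.move x σ N) {r : ℕ} {i : Fin n}
    (hN : r * roundLength n + i ≤ N) : σ (r * roundLength n + i) i = σ (r * roundLength n) i := by
  refine h.eq_of_forall_ne (by omega) hN fun p h₁ h₂ => ?_
  obtain ⟨d, rfl⟩ := Nat.exists_eq_add_of_le h₁
  have hd : d < n := by omega
  rw [P.owner_move, Plan.slotOwner_send r ⟨d, hd⟩]
  intro h₃
  have := congrArg Fin.val h₃
  simp only at this
  omega

theorem inbox_plan {r : ℕ} {i j : Fin n} (hj : j ∈ P.hearAt r i) :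
    A.inbox P.move σ (r * roundLength n + deliverPos i j) i (r * roundLength n + j) =
      (A.send j (σ (r * roundLength n + j) j) i).map fun m => (j, m) := by
  have h₁ := lt_deliverPos i j
  have h₂ := j.isLt
  unfold inbox
  rw [if_pos ⟨by omega, fun q' h₃ h₄ => Plan.move_ne_deliver q' h₃ h₄⟩,
    Plan.move_send r j (Plan.aliveAt_of_mem_hearAt hj)]

/-- In a legal plan, every processor that has not crashed is ready to send at the beginning of each
round. -/
theorem IsLocalRun.ready (h : A.IsLocalRun P.move x σ N) (hA : A.FullyCommunicative t)
    (hP : P.Legal t) {r : ℕ} (hr : r * roundLength n ≤ N) {i : Fin n} (hi : P.AliveAt r i)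
    (k : Fin n) : (A.send i (σ (r * roundLength n) i) k).isSome := by
  induction r generalizing i k with
  | zero =>
    rw [zero_mul, h.start]
    exact hA.1 i _ k
  | succ r ih =>
    have hrr : (r + 1) * roundLength n = r * roundLength n + roundLength n := Nat.succ_mul _ _
    have hlast : ∀ (r' : ℕ) (j : Fin n), r' * roundLength n + j < (r + 1) * roundLength n →
        r' * roundLength n ≤ r * roundLength n := by
      intro r' j h₁
      refine Nat.mul_le_mul_right _ ?_
      have : r' * roundLength n < (r + 1) * roundLength n := by omega
      have := Nat.lt_of_mul_lt_mul_right this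
      omega
    have hi' := hi.of_succ
    have hset : (P.hearAt r i : Set (Fin n)) ⊆
        {j | ∃ k, A.IsLatest (A.hist P.move σ ((r + 1) * roundLength n)) j i k ∧
          A.ReceivedSinceSending (A.hist P.move σ ((r + 1) * roundLength n)) i k} := by
      intro j hj
      have hj : j ∈ P.hearAt r i := hj
      have hja := Plan.aliveAt_of_mem_hearAt hj
      have hjn := j.isLt
      have hin := i.isLt
      have hL := lt_roundLength (n := n)
      have hd := deliverPos_lt i j
      have hd' := lt_deliverPos i j
      have hsome := ih (by omega) hja i
      rw [← h.eq_roundStart (by omega)] at hsome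
      obtain ⟨m, hm⟩ := Option.isSome_iff_exists.1 hsome
      refine ⟨r * roundLength n + j, ⟨⟨m, _, getElem?_hist_eq_some.2 ⟨by omega,
        record_send (Plan.move_send r j hja)⟩, hm⟩, ?_⟩, ?_⟩
      · rintro k' m' ⟨w, hw, -⟩
        obtain ⟨h₁, h₂⟩ := getElem?_hist_eq_some.1 hw
        obtain ⟨r', rfl, -⟩ := Plan.move_eq_send (record_eq_send h₂).1
        have := hlast r' j h₁
        omega
      · have hin : A.inbox P.move σ (r * roundLength n + deliverPos i j) i
            (r * roundLength n + j) = some (j, m) := by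
          rw [inbox_plan hj, hm]; rfl
        refine ⟨r * roundLength n + deliverPos i j, j, m, _, getElem?_hist_eq_some.2
          ⟨by omega, record_deliver (Plan.move_deliver r i j hj) hin⟩, ?_⟩
        rintro q e he ⟨w, rfl, -⟩
        obtain ⟨h₁, h₂⟩ := getElem?_hist_eq_some.1 he
        obtain ⟨r', rfl, -⟩ := Plan.move_eq_send (record_eq_send h₂).1
        have := hlast r' i h₁
        omega
    have hcard : n - t ≤ {j | ∃ k, A.IsLatest (A.hist P.move σ ((r + 1) * roundLength n)) j i k ∧
          A.ReceivedSinceSending (A.hist P.move σ ((r + 1) * roundLength n)) i k}.ncard := by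
      refine (hP.card_hearAt hi').trans ?_
      rw [← Set.ncard_coe_finset]
      exact Set.ncard_le_ncard hset (Set.toFinite _)
    have := hA.2 x _ (h.reachable hr) i hcard k
    rwa [h.stateAt_hist hr] at this

/-- Messages that are heard in a round are received. -/
theorem IsLocalRun.record_deliver (h : A.IsLocalRun P.move x σ N) (hA : A.FullyCommunicative t)
    (hP : P.Legal t) {r : ℕ} {i j : Fin n} (hN : r * roundLength n + n ≤ N)
    (hj : j ∈ P.hearAt r i) :
    ∃ m, A.send j (σ (r * roundLength n) j) i = some m ∧
      A.record P.move σ (r * roundLength n + deliverPos i j) =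
        .recv i (r * roundLength n + j) j m (σ (r * roundLength n + deliverPos i j + 1) i) := by
  have hjn := j.isLt
  obtain ⟨m, hm⟩ := Option.isSome_iff_exists.1
    (h.ready hA hP (r := r) (by omega) (Plan.aliveAt_of_mem_hearAt hj) i)
  refine ⟨m, hm, Algorithm.record_deliver (Plan.move_deliver r i j hj) ?_⟩
  rw [inbox_plan hj, h.eq_roundStart (by omega), hm]
  rfl

/-! ### Fairness of round plans -/

variable {ω : ℕ → A.History}

theorem sendsForever_of_plan (hω : ∀ q, ω q = A.hist P.move σ q) {i : Fin n} (hi : i ∈ P.alive) :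
    A.SendsForever ω i := by
  intro N₀
  have hL : N₀ ≤ N₀ * roundLength n := Nat.le_mul_of_pos_right _ roundLength_pos
  refine ⟨N₀ * roundLength n + i, by omega, A.send i (σ (N₀ * roundLength n + i) i), ?_⟩
  rw [hω]
  exact getElem?_hist_eq_some.2 ⟨by omega, record_send (Plan.move_send _ i (.inr hi))⟩

theorem receivesForever_of_plan (hA : A.FullyCommunicative t) (hP : P.Legal t)
    (hσ : ∀ N, A.IsLocalRun P.move x σ N) (hω : ∀ q, ω q = A.hist P.move σ q) {i : Fin n}
    (hi : i ∈ P.alive) : A.ReceivesForever ω i := by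
  intro N₀
  set r := max N₀ P.horizon
  have hL : r ≤ r * roundLength n := Nat.le_mul_of_pos_right _ roundLength_pos
  obtain ⟨m, -, hm⟩ := (hσ _).record_deliver hA hP (r := r) le_rfl
    (Plan.mem_hearAt_of_le (le_max_right _ _) hi hi)
  have hrec := getElem?_hist_eq_some.2 ⟨Nat.lt_succ_self (r * roundLength n + deliverPos i i), hm⟩
  rw [← hω] at hrec
  exact ⟨_, by omega, _, _, _, _, hrec⟩

theorem not_sendsForever_of_plan (hω : ∀ q, ω q = A.hist P.move σ q) {i : Fin n}
    (hi : i ∉ P.alive) : ¬ A.SendsForever ω i := by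
  intro h
  obtain ⟨q, hq, w, hw⟩ := h (P.horizon * roundLength n)
  rw [hω] at hw
  obtain ⟨r, rfl, hr⟩ := Plan.move_eq_send (record_eq_send (getElem?_hist_eq_some.1 hw).2).1
  have hr : r < P.horizon := by simpa [Plan.AliveAt, hi] using hr
  have := Nat.mul_le_mul_right (roundLength n) hr
  rw [Nat.succ_mul] at this
  have := i.isLt
  have := lt_roundLength (n := n)
  omega

theorem not_receivesForever_of_plan (hω : ∀ q, ω q = A.hist P.move σ q) {i : Fin n}
    (hi : i ∉ P.alive) : ¬ A.ReceivesForever ω i := by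
  intro h
  obtain ⟨q, hq, k, j, m, s, hw⟩ := h (P.horizon * roundLength n)
  rw [hω] at hw
  obtain ⟨h₁, h₂, -⟩ := record_eq_recv (getElem?_hist_eq_some.1 hw).2
  have hk := (inbox_eq_some.1 h₂).1
  rcases Plan.move_eq_deliver h₁ hk with ⟨r, j', rfl, -, hj'⟩ | ⟨r, -, -, h₄, -⟩
  · unfold Plan.hearAt at hj'
    rw [if_neg hi] at hj'
    split_ifs at hj' with hr
    · have := Nat.mul_le_mul_right (roundLength n) (Nat.succ_le_of_lt hr)
      rw [Nat.succ_mul] at this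
      have := deliverPos_lt i j'
      omega
    · simp at hj'
  · exact hi h₄

theorem delivers_of_plan (hω : ∀ q, ω q = A.hist P.move σ q) {i j : Fin n} (hi : i ∈ P.alive)
    (hj : j ∈ P.alive) : A.Delivers ω j i := by
  rintro N k m ⟨w, hw, hm⟩
  rw [hω] at hw
  obtain ⟨-, hk⟩ := getElem?_hist_eq_some.1 hw
  obtain ⟨hmk, rfl⟩ := record_eq_send hk
  obtain ⟨r₀, rfl, -⟩ := Plan.move_eq_send hmk
  set k := r₀ * roundLength n + j
  -- a round in which the delivery of this message is requested
  set r := Nat.pair i (Nat.pair k (max (k + 1) P.horizon)) with hr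
  have h₁ : max (k + 1) P.horizon ≤ r :=
    (Nat.right_le_pair k _).trans (Nat.right_le_pair i _)
  have h₂ : Plan.lateReceiver n r = i := by
    simp [Plan.lateReceiver, hr]
  have h₃ : Plan.lateStep r = k := by simp [Plan.lateStep, hr]
  have hL : r ≤ r * roundLength n := Nat.le_mul_of_pos_right _ roundLength_pos
  have hmv := Plan.move_late (P := P) (r := r) (by omega) (by rw [h₂]; exact hi)
    (by rw [h₃]; omega) ⟨j, hj, by rw [h₃]; exact slotAt_send r₀ j⟩
  rw [h₂, h₃] at hmv
  obtain ⟨q, hq, -, hrec⟩ := exists_record_recv (A := A) (σ := σ) (by omega) hmv hmk hm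
  exact ⟨q + 1, m, _, by rw [hω]; exact mem_hist.2 ⟨q, by omega, hrec⟩⟩

end Algorithm

/-! ### Recombination of executions -/

namespace Algorithm

variable {n : ℕ} {A : Algorithm.{u, v} n} {x : Fin n → Bool}

open Classical in
theorem localStep_iff {mv : ℕ → AdvMove n} {σ : ℕ → Fin n → A.State} {q : ℕ} :
    A.LocalStep mv σ q ↔ (∀ j, (mv q).owner ≠ j → σ (q + 1) j = σ q j) ∧
      match mv q with
      | .send i => σ (q + 1) i =
          if ∃ k, (A.send i (σ q i) k).isSome then A.sent i (σ q i) else σ q i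
      | .deliver i k =>
        match A.inbox mv σ q i k with
        | some (j, m) => σ (q + 1) i ∈ (A.recv i (σ q i) j m).support
        | none => σ (q + 1) i = σ q i := by
  have hupd : ∀ (i : Fin n) (s : A.State), σ (q + 1) = Function.update (σ q) i s ↔
      (∀ j, i ≠ j → σ (q + 1) j = σ q j) ∧ σ (q + 1) i = s := by
    intro i s
    rw [Function.eq_update_iff]
    exact ⟨fun h => ⟨fun j hj => h.2 j hj.symm, h.1⟩, fun h => ⟨h.2, fun j hj => h.1 j hj.symm⟩⟩
  have hsame : ∀ i : Fin n, σ (q + 1) = σ q ↔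
      (∀ j, i ≠ j → σ (q + 1) j = σ q j) ∧ σ (q + 1) i = σ q i := by
    intro i
    rw [← hupd, Function.update_eq_self]
  unfold LocalStep
  split
  · rename_i i hi
    simp only [hi, AdvMove.owner]
    split_ifs
    · exact hupd i _
    · exact hsame i
  · rename_i i k hi
    simp only [hi, AdvMove.owner]
    split
    · rename_i j m hm
      simp only [hupd]
      exact ⟨fun ⟨s, hs, h₁, h₂⟩ => ⟨h₁, h₂ ▸ hs⟩, fun ⟨h₁, h₂⟩ => ⟨_, h₂, h₁, rfl⟩⟩
    · exact hsame i

theorem IsLocalRun.congr {mv mv' : ℕ → AdvMove n} {σ : ℕ → Fin n → A.State} {N : ℕ}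
    (h : A.IsLocalRun mv x σ N) (hmv : ∀ q < N, mv q = mv' q) : A.IsLocalRun mv' x σ N := by
  refine ⟨h.start, fun q hq => ?_⟩
  have hin : ∀ i k, A.inbox mv σ q i k = A.inbox mv' σ q i k := by
    intro i k
    refine Option.ext fun ⟨j, m⟩ => ?_
    rw [inbox_eq_some, inbox_eq_some]
    refine and_congr_right fun hk => and_congr (forall_congr' fun q' => ?_) ?_
    · refine imp_congr_right fun _ => forall_congr' fun hq' => ?_
      rw [hmv q' (by omega)]
    · rw [hmv k (by omega)]
  have := h.step q hq
  unfold LocalStep at this ⊢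
  simpa only [hin, hmv q hq] using this

/-- Processor `a` can follow one execution while all others follow another one, provided that no
message between `a` and the others makes the difference. -/
theorem IsLocalRun.mix {mv₁ mv₂ : ℕ → AdvMove n} {x₁ x₂ : Fin n → Bool}
    {σ₁ σ₂ : ℕ → Fin n → A.State} {M : ℕ} (h₁ : A.IsLocalRun mv₁ x₁ σ₁ M)
    (h₂ : A.IsLocalRun mv₂ x₂ σ₂ M) (own : ℕ → Fin n) (ho₁ : ∀ q, (mv₁ q).owner = own q)
    (ho₂ : ∀ q, (mv₂ q).owner = own q) (a : Fin n)
    (hc₁ : ∀ q < M, ∀ k < q, mv₁ q = .deliver a k → own k ≠ a →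
      mv₁ k = mv₂ k ∧ A.send (own k) (σ₁ k (own k)) a = A.send (own k) (σ₂ k (own k)) a)
    (hc₂ : ∀ q < M, ∀ k < q, ∀ i ≠ a, mv₂ q = .deliver i k → own k = a →
      mv₁ k = mv₂ k ∧ A.send a (σ₁ k a) i = A.send a (σ₂ k a) i) :
    A.IsLocalRun (fun q => if own q = a then mv₁ q else mv₂ q) (Function.update x₂ a (x₁ a))
      (fun q => Function.update (σ₂ q) a (σ₁ q a)) M := by
  set mv : ℕ → AdvMove n := fun q => if own q = a then mv₁ q else mv₂ q with hmv
  set σ : ℕ → Fin n → A.State := fun q => Function.update (σ₂ q) a (σ₁ q a) with hσ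
  have hmva : ∀ q, own q = a → mv q = mv₁ q := fun q hq => by simp [hmv, hq]
  have hmvo : ∀ q, own q ≠ a → mv q = mv₂ q := fun q hq => by simp [hmv, hq]
  have hσa : ∀ q, σ q a = σ₁ q a := fun q => by simp [hσ]
  have hσo : ∀ q i, i ≠ a → σ q i = σ₂ q i := fun q i hi => by simp [hσ, hi]
  have hown : ∀ q, (mv q).owner = own q := fun q => by
    by_cases hq : own q = a
    · rw [hmva q hq, ho₁]
    · rw [hmvo q hq, ho₂]
  have hdel : ∀ {mv' : ℕ → AdvMove n} {q i k}, (∀ q, (mv' q).owner = own q) →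
      mv' q = .deliver i k → own q = i := by
    intro mv' q i k ho h
    rw [← ho q, h]; rfl
  have hsend : ∀ {mv' : ℕ → AdvMove n} {q i}, (∀ q, (mv' q).owner = own q) →
      mv' q = .send i → own q = i := by
    intro mv' q i ho h
    rw [← ho q, h]; rfl
  have hin₁ : ∀ q < M, ∀ k, mv₁ q = .deliver a k → A.inbox mv σ q a k = A.inbox mv₁ σ₁ q a k := by
    intro q hq k hqk
    refine Option.ext fun ⟨j, m⟩ => ?_
    rw [inbox_eq_some, inbox_eq_some]
    refine and_congr_right fun hk => and_congr (forall_congr' fun q' => ?_) ?_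
    · refine imp_congr_right fun _ => forall_congr' fun _ => not_congr ?_
      by_cases hq' : own q' = a
      · rw [hmva q' hq']
      · exact ⟨fun h => absurd (hdel hown h) hq', fun h => absurd (hdel ho₁ h) hq'⟩
    · by_cases hka : own k = a
      · rw [hmva k hka]
        refine and_congr_right fun h => ?_
        rw [← hsend ho₁ h, hka, hσa]
      · obtain ⟨e₁, e₂⟩ := hc₁ q hq k hk hqk hka
        rw [hmvo k hka, e₁]
        refine and_congr_right fun h => ?_
        rw [← hsend ho₂ h, hσo _ _ hka, e₂]
  have hin₂ : ∀ q < M, ∀ k, ∀ i ≠ a, mv₂ q = .deliver i k →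
      A.inbox mv σ q i k = A.inbox mv₂ σ₂ q i k := by
    intro q hq k i hi hqk
    refine Option.ext fun ⟨j, m⟩ => ?_
    rw [inbox_eq_some, inbox_eq_some]
    refine and_congr_right fun hk => and_congr (forall_congr' fun q' => ?_) ?_
    · refine imp_congr_right fun _ => forall_congr' fun _ => not_congr ?_
      by_cases hq' : own q' = a
      · exact ⟨fun h => absurd ((hdel hown h).symm.trans hq') hi,
          fun h => absurd ((hdel ho₂ h).symm.trans hq') hi⟩
      · rw [hmvo q' hq']
    · by_cases hka : own k = a
      · obtain ⟨e₁, e₂⟩ := hc₂ q hq k hk i hi hqk hka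
        rw [hmva k hka, e₁]
        refine and_congr_right fun h => ?_
        rw [← hsend ho₂ h, hka, hσa, e₂]
      · rw [hmvo k hka]
        refine and_congr_right fun h => ?_
        rw [← hsend ho₂ h, hσo _ _ hka]
  refine ⟨?_, fun q hq => localStep_iff.2 ⟨fun j hj => ?_, ?_⟩⟩
  · funext i
    by_cases hi : i = a
    · subst hi
      rw [hσa, h₁.start, Function.update_self]
    · rw [hσo _ _ hi, h₂.start, Function.update_of_ne hi]
  · rw [hown] at hj
    by_cases hja : j = a
    · rw [hja, hσa, hσa]
      exact (h₁.step q hq).eq_of_ne (by rw [ho₁, ← hja]; exact hj)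
    · rw [hσo _ _ hja, hσo _ _ hja]
      exact (h₂.step q hq).eq_of_ne (by rw [ho₂]; exact hj)
  · by_cases hqa : own q = a
    · have h := (localStep_iff.1 (h₁.step q hq)).2
      rw [hmva q hqa]
      split at h
      · rename_i i hi
        obtain rfl : i = a := (hsend ho₁ hi).symm.trans hqa
        simpa only [hi, hσa] using h
      · rename_i i k hi
        obtain rfl : i = a := (hdel ho₁ hi).symm.trans hqa
        simpa only [hi, hσa, hin₁ q hq k hi] using h
    · have h := (localStep_iff.1 (h₂.step q hq)).2
      rw [hmvo q hqa]
      split at h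
      · rename_i i hi
        have hia : i ≠ a := fun h => hqa ((hsend ho₂ hi).trans h)
        simpa only [hi, hσo _ _ hia] using h
      · rename_i i k hi
        have hia : i ≠ a := fun h => hqa ((hdel ho₂ hi).trans h)
        simpa only [hi, hσo _ _ hia, hin₂ q hq k i hia hi] using h

/-! ### Executions with different decisions -/

variable [NeZero n] {t : ℕ}

/-- An execution under a legal plan can be continued until a given surviving processor has
decided. -/
theorem IsLocalRun.exists_decided (hA : A.FullyCommunicative t) (hT : A.Terminating t)
    {P : Plan n} (hP : P.Legal t) {σ : ℕ → Fin n → A.State} {N : ℕ}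
    (hσ : A.IsLocalRun P.move x σ N) {i : Fin n} (hi : i ∈ P.alive) :
    ∃ σ' N', N ≤ N' ∧ A.IsLocalRun P.move x σ' N' ∧ (∀ q ≤ N, σ' q = σ q) ∧
      ∃ b, A.out (σ' N' i) = some b := by
  set adv : A.Adversary := fun _ h => P.move h.length with hadv
  have hpos := A.runMeasure_pos adv x (A.hist P.move σ) N rfl fun q hq => by
    have := hσ.hist_succ_mem hq
    change _ ∈ (A.stepLaw x _ (P.move (A.hist P.move σ q).length)).support
    rwa [hist_length]
  obtain ⟨ω, hωN, hrun, hterm⟩ : ∃ ω : ℕ → A.History, ω N = A.hist P.move σ N ∧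
      A.IsRun adv x ω ∧ (A.AtMostCrashes t ω →
        (∀ j i, ¬ A.Crashes ω j → ¬ A.Crashes ω i → A.Delivers ω j i) →
        ∀ i, ¬ A.Crashes ω i → ∃ N b, A.out (A.stateAt x (ω N) i) = some b) := by
    by_contra hcon
    push Not at hcon
    refine hpos.ne' (measure_mono_null (fun ω hω => ?_)
      (ae_iff.1 ((A.ae_isRun adv x).and (hT adv x))))
    rw [Set.mem_ofPred_eq, not_and]
    intro hrun hterm
    obtain ⟨h₁, h₂, i, h₃, h₄⟩ := hcon ω hω hrun
    obtain ⟨N, b, h₅⟩ := hterm h₁ h₂ i h₃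
    exact h₄ N b h₅
  have hmv : (fun q => adv x (ω q)) = P.move := by
    funext q
    rw [hadv]
    simp only
    rw [hrun.eq_hist q, hist_length]
  set σ' : ℕ → Fin n → A.State := fun q => A.stateAt x (ω q) with hσ'
  have hloc : ∀ N, A.IsLocalRun P.move x σ' N := fun N => by
    have := hrun.isLocalRun N
    rwa [hmv] at this
  have hhist : ∀ q, ω q = A.hist P.move σ' q := fun q => by
    have := hrun.eq_hist q
    rwa [hmv] at this
  have hcrash : ∀ i, A.Crashes ω i ↔ i ∉ P.alive := fun i =>
    ⟨fun h hi => h.1 (sendsForever_of_plan hhist hi), fun h =>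
      ⟨not_sendsForever_of_plan hhist h, not_receivesForever_of_plan hhist h⟩⟩
  have hmost : A.AtMostCrashes t ω := by
    refine ⟨?_, fun i hi => ?_⟩
    · have : {i | A.Crashes ω i} = ((P.aliveᶜ : Finset (Fin n)) : Set (Fin n)) := by
        ext i
        simp [hcrash]
      rw [this, Set.ncard_coe_finset, Finset.card_compl, Fintype.card_fin]
      have := hP.2
      omega
    · rw [hcrash, not_not] at hi
      exact ⟨sendsForever_of_plan hhist hi, receivesForever_of_plan hA hP hloc hhist hi⟩
  obtain ⟨N₁, b, hb⟩ := hterm hmost (fun j i hj hi => by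
    rw [hcrash, not_not] at hi hj
    exact delivers_of_plan hhist hi hj) i (by rw [hcrash, not_not]; exact hi)
  refine ⟨σ', max N N₁, le_max_left _ _, hloc _, fun q hq => ?_, b,
    (hloc (max N N₁)).out_eq (le_max_right _ _) le_rfl hb⟩
  rw [hσ']
  simp only
  rw [hhist q, ← take_hist hq, ← hhist N, hωN, take_hist hq, hσ.stateAt_hist hq]

/-- The plan whose first `r` rounds are given by `S`; the other rounds do not matter. -/
def stagePlan (S : ℕ → Fin n → Finset (Fin n)) (r : ℕ) : Plan n := ⟨S, r, Finset.univ⟩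

/-- The transcript that consists of the inputs `x`, the messages `V r' i` that the processors send
in the rounds `r' ≤ r`, and the choice `S r'` of the messages that are received in the rounds
`r' < r`, is compatible with a decision for `b` before round `r`. The transcript does not
determine the states, and hence the decisions: a processor may remember more than its messages
show. -/
def CanDecide (A : Algorithm.{u, v} n) (b : Bool) (r : ℕ) (x : Fin n → Bool)
    (V : ℕ → Fin n → Fin n → Option A.Msg) (S : ℕ → Fin n → Finset (Fin n)) : Prop :=
  ∃ σ, A.IsLocalRun (stagePlan S r).move x σ (r * roundLength n) ∧
    (∀ r' ≤ r, ∀ i, A.send i (σ (r' * roundLength n) i) = V r' i) ∧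
    ∃ i, A.out (σ (r * roundLength n) i) = some b

/-- All messages that are received before round `r` are the same in two transcripts, whichever of
the two says that they are received. -/
def Compatible {μ : Type*} (r : ℕ) (V : ℕ → Fin n → Fin n → μ)
    (S : ℕ → Fin n → Finset (Fin n)) (V' : ℕ → Fin n → Fin n → μ)
    (S' : ℕ → Fin n → Finset (Fin n)) : Prop :=
  ∀ r' < r, ∀ i j, j ∈ S r' i ∨ j ∈ S' r' i → V r' j i = V' r' j i

omit [NeZero n] in
theorem round_lt {r r' p : ℕ} (h : r' * roundLength n + p < r * roundLength n) : r' < r :=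
  Nat.lt_of_mul_lt_mul_right (lt_of_le_of_lt (Nat.le_add_right _ p) h)

theorem move_congr {P P' : Plan n} {r : ℕ} (h : P.horizon = r) (h' : P'.horizon = r)
    (hear : ∀ r' < r, P.hear r' = P'.hear r') {q : ℕ} (hq : q < r * roundLength n) :
    P.move q = P'.move q := by
  rcases exists_slot n q with ⟨r', i, rfl⟩ | ⟨r', rfl⟩ | ⟨r', i, j, rfl⟩
  · have := round_lt hq
    rw [Plan.move_send r' i (.inl (by omega)), Plan.move_send r' i (.inl (by omega))]
  · have := round_lt hq
    rw [Plan.move_late_of_lt (by omega), Plan.move_late_of_lt (by omega)]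
  · have := round_lt hq
    have hh : P.hearAt r' i = P'.hearAt r' i := by
      rw [Plan.hearAt, Plan.hearAt, if_pos (by omega), if_pos (by omega), hear r' this]
    by_cases hj : j ∈ P.hearAt r' i
    · rw [Plan.move_deliver r' i j hj, Plan.move_deliver r' i j (hh ▸ hj)]
    · rw [Plan.move_deliver_of_notMem r' i j hj, Plan.move_deliver_of_notMem r' i j (hh ▸ hj)]

/-- Compatible transcripts cannot go with different decisions. If `a` has decided `false` in one
execution and somebody has decided `true` in the other, crash `a` in the second one and wait until
some other processor has decided, necessarily for `true`; then let `a` follow the first execution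
and all others the second one. -/
theorem not_canDecide_both (hA : A.FullyCommunicative t) (hC : A.Correct) (hT : A.Terminating t)
    (ht : 0 < t) (htn : t < n) {r : ℕ} {x x' : Fin n → Bool}
    {V V' : ℕ → Fin n → Fin n → Option A.Msg} {S S' : ℕ → Fin n → Finset (Fin n)}
    (hS' : ∀ r' < r, ∀ i, n - t ≤ (S' r' i).card) (hcomp : Compatible r V S V' S')
    (h : A.CanDecide false r x V S) (h' : A.CanDecide true r x' V' S') : False := by
  obtain ⟨σ, hσ, hV, a, ha⟩ := h
  obtain ⟨σ', hσ', hV', a', ha'⟩ := h'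
  set N := r * roundLength n with hN
  set P' : Plan n := ⟨S', r, Finset.univ.erase a⟩ with hP'
  have hmove' : ∀ q < N, (stagePlan S' r).move q = P'.move q := fun q hq =>
    move_congr (P := stagePlan S' r) (P' := P') rfl rfl (fun _ _ => rfl) hq
  have hP'l : P'.Legal t := by
    refine ⟨hS', ?_⟩
    change n - t ≤ (Finset.univ.erase a).card
    rw [Finset.card_erase_of_mem (Finset.mem_univ a), Finset.card_univ, Fintype.card_fin]
    omega
  obtain ⟨b, hba⟩ : ∃ b : Fin n, b ≠ a := by
    have : Nontrivial (Fin n) := Fin.nontrivial_iff_two_le.2 (by omega)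
    exact exists_ne a
  obtain ⟨σ₂, M, hNM, hσ₂, hext, v, hv⟩ := (hσ'.congr hmove').exists_decided hA hT hP'l
    (i := b) (Finset.mem_erase.2 ⟨hba, Finset.mem_univ b⟩)
  obtain rfl : v = true := by
    have h₁ := hσ₂.out_eq hNM le_rfl (by rw [hext N le_rfl]; exact ha')
    refine (hC x' _ (hσ₂.reachable le_rfl)).1 b a' v true ?_ ?_ <;>
      rw [hσ₂.stateAt_hist le_rfl] <;> assumption
  -- the first execution, prolonged by idle moves
  set mv₁ : ℕ → AdvMove n := fun q =>
    if q < N then (stagePlan S r).move q else .deliver (Plan.slotOwner n q) q with hmv₁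
  have hmv₁lt : ∀ q < N, mv₁ q = (stagePlan S r).move q := fun q hq => by simp [hmv₁, hq]
  have hσ₁ : A.IsLocalRun mv₁ x (fun q => σ (min q N)) M := by
    refine ⟨by simpa using hσ.start, fun q hq => ?_⟩
    by_cases hqN : q < N
    · have h₀ := (hσ.congr fun q hq => (hmv₁lt q hq).symm).step q hqN
      have h₁ : ∀ q' ≤ N, σ (min q' N) = σ q' := fun q' hq' => by rw [min_eq_left hq']
      have hin : ∀ i k, A.inbox mv₁ (fun q => σ (min q N)) q i k = A.inbox mv₁ σ q i k := by
        intro i k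
        refine Option.ext fun ⟨j, m⟩ => ?_
        rw [inbox_eq_some, inbox_eq_some]
        refine and_congr_right fun hk => ?_
        rw [h₁ k (by omega)]
      unfold LocalStep at h₀ ⊢
      simpa only [hin, h₁ q hqN.le, h₁ (q + 1) hqN] using h₀
    · have hmq : mv₁ q = .deliver (Plan.slotOwner n q) q := by simp [hmv₁, hqN]
      unfold LocalStep
      simp only [hmq, inbox_self]
      rw [min_eq_right (by omega), min_eq_right (by omega)]
  have hown₁ : ∀ q, (mv₁ q).owner = Plan.slotOwner n q := fun q => by
    simp only [hmv₁]
    split_ifs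
    · exact Plan.owner_move _ q
    · rfl
  -- moves and messages of the two executions agree where a message is received
  have hagree : ∀ r' < r, ∀ i j, j ∈ S r' i ∨ j ∈ S' r' i →
      mv₁ (r' * roundLength n + j) = P'.move (r' * roundLength n + j) ∧
        A.send j (σ (min (r' * roundLength n + j) N) j) i =
          A.send j (σ₂ (r' * roundLength n + j) j) i := by
    intro r' hr' i j hj
    have hle := Nat.mul_le_mul_right (roundLength n) (Nat.succ_le_of_lt hr')
    rw [Nat.succ_mul, ← hN] at hle
    have hjn := j.isLt
    have hL := lt_roundLength (n := n)
    refine ⟨?_, ?_⟩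
    · rw [hmv₁lt _ (by omega), Plan.move_send r' j (.inl hr'), Plan.move_send r' j (.inl hr')]
    · rw [min_eq_left (by omega), hext _ (by omega), hσ.eq_roundStart (by omega),
        hσ'.eq_roundStart (by omega), hV r' hr'.le, hV' r' hr'.le, hcomp r' hr' i j hj]
  have hmix := hσ₁.mix hσ₂ (fun q => Plan.slotOwner n q) hown₁ (Plan.owner_move _) a ?_ ?_
  · have := (hC _ _ (hmix.reachable le_rfl)).1 a b false true
    rw [hmix.stateAt_hist le_rfl] at this
    simp only [Function.update_self, Function.update_of_ne hba, min_eq_right hNM] at this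
    exact absurd (this ha hv) (by simp)
  · intro q hq k hk hqk hka
    have hqN : q < N := by
      by_contra hqN
      simp only [hmv₁, hqN, if_false] at hqk
      injection hqk with _ h₂
      omega
    rw [hmv₁lt q hqN] at hqk
    rcases Plan.move_eq_deliver hqk hk with ⟨r', j, rfl, rfl, hj⟩ | ⟨r', rfl, h₁, -⟩
    · have hr' := round_lt hqN
      rw [Plan.slotOwner_send]
      have hj' : j ∈ S r' a := by
        rw [Plan.hearAt, if_pos (show r' < (stagePlan S r).horizon from hr')] at hj
        exact hj
      exact hagree r' hr' a j (.inl hj')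
    · have hr' := round_lt hqN
      change r ≤ r' at h₁
      omega
  · intro q hq k hk i hia hqk hka
    rcases Plan.move_eq_deliver hqk hk with ⟨r', j, rfl, rfl, hj⟩ | ⟨r', rfl, -, -, -, j, hj, hkj⟩
    · rw [Plan.slotOwner_send] at hka
      subst hka
      by_cases hr' : r' < r
      · have hj' : j ∈ S' r' i := by
          rw [Plan.hearAt, if_pos (show r' < P'.horizon from hr')] at hj
          exact hj
        exact hagree r' hr' i j (.inr hj')
      · rw [Plan.hearAt, if_neg (show ¬ r' < P'.horizon from hr')] at hj
        split_ifs at hj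
        · exact absurd rfl (Finset.mem_erase.1 hj).1
        · simp at hj
    · have : Plan.slotOwner n k = j := by simp [Plan.slotOwner, hkj]
      rw [this] at hka
      exact absurd hka (Finset.mem_erase.1 hj).1

end Algorithm

/-! ### The law of a round -/

theorem PMF.bind_congr_support {Ω Ω' : Type*} (p : PMF Ω) {f g : Ω → PMF Ω'}
    (h : ∀ ω ∈ p.support, f ω = g ω) : p.bind f = p.bind g := by
  ext b
  simp only [PMF.bind_apply]
  exact p.tsum_congr_support fun ω hω => by rw [h ω hω]

theorem PMF.map_eq_pure_of_support {Ω Ω' : Type*} (p : PMF Ω) {f : Ω → Ω'} {c : Ω'}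
    (h : ∀ ω ∈ p.support, f ω = c) : p.map f = PMF.pure c := by
  rw [← PMF.bind_pure_comp, p.bind_congr_support (g := fun _ => PMF.pure c)
    fun ω hω => by rw [Function.comp_apply, h ω hω], PMF.bind_const]

namespace Algorithm

open scoped ENNReal

variable {n : ℕ} {A : Algorithm.{u, v} n} {x : Fin n → Bool}

variable (A) in
/-- State after a sending step that is taken in state `s`. -/
def afterSend (i : Fin n) (s : A.State) : A.State :=
  if ∃ k, (A.send i s k).isSome then A.sent i s else s

/-- The messages that `i` receives in a round, with their senders, if `W j i` is the message from
`j` to `i` and `i` hears the processors in `s i`. -/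
def inboxList {μ : Type*} (s : Fin n → Finset (Fin n)) (W : Fin n → Fin n → Option μ) (i : Fin n) :
    List (Fin n × μ) :=
  (List.finRange n).filterMap fun j => if j ∈ s i then (W j i).map fun m => (j, m) else none

variable (A) in
/-- The expectation of `Φ` of the states after one slot of a round. -/
noncomputable def slotExp (s : Fin n → Finset (Fin n)) (W : Fin n → Fin n → Option A.Msg)
    (Φ : (Fin n → A.State) → ℝ≥0∞) (σ : Fin n → A.State) : Slot n → ℝ≥0∞
  | .send i => Φ (Function.update σ i (A.afterSend i (σ i)))
  -- before the horizon of a plan, no old message is delivered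
  | .late => Φ σ
  | .deliver i j =>
    match if j ∈ s i then (W j i).map fun m => (j, m) else none with
    | some (j, m) => ∑' a, A.recv i (σ i) j m a * Φ (Function.update σ i a)
    | none => Φ σ

variable (A) in
/-- The expectation of `Φ` of the states after `m` slots, the first of which is that of
step `q`. -/
noncomputable def slotsExp (s : Fin n → Finset (Fin n)) (W : Fin n → Fin n → Option A.Msg)
    (Φ : (Fin n → A.State) → ℝ≥0∞) : ℕ → ℕ → (Fin n → A.State) → ℝ≥0∞
  | 0, _, σ => Φ σ
  | m + 1, q, σ => A.slotExp s W (slotsExp s W Φ m (q + 1)) σ (slotAt n q)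

section SlotsExp

variable (s : Fin n → Finset (Fin n)) (W : Fin n → Fin n → Option A.Msg)
  (Φ : (Fin n → A.State) → ℝ≥0∞)

theorem slotsExp_sends (r m d i : ℕ) (hd : i + d = n) (σ : Fin n → A.State) :
    A.slotsExp s W Φ (d + m) (r * roundLength n + i) σ =
      A.slotsExp s W Φ m (r * roundLength n + n)
        fun j => if i ≤ j then A.afterSend j (σ j) else σ j := by
  induction d generalizing i σ with
  | zero =>
    obtain rfl : i = n := by omega
    rw [zero_add]
    congr 1
    funext j
    rw [if_neg (by omega)]
  | succ d ih =>
    rw [show d + 1 + m = (d + m) + 1 by ring, slotsExp]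
    rw [slotAt_send r ⟨i, by omega⟩]
    simp only [slotExp]
    rw [add_assoc, ih (i + 1) (by omega)]
    congr 1
    funext j
    by_cases hj : j = ⟨i, by omega⟩
    · subst hj
      simp
    · have hj' : (j : ℕ) ≠ i := fun h => hj (Fin.ext h)
      rw [Function.update_of_ne hj]
      by_cases hij : i ≤ j
      · rw [if_pos hij, if_pos (by omega)]
      · rw [if_neg hij, if_neg (by omega)]

theorem slotsExp_block (r m : ℕ) (i : Fin n) (d j : ℕ) (hd : j + d = n) (σ : Fin n → A.State) :
    A.slotsExp s W Φ (d + m) (r * roundLength n + (n + 1 + (j + n * i))) σ =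
      ∑' a, A.recvAll i (σ i) (((List.finRange n).drop j).filterMap fun j =>
        if j ∈ s i then (W j i).map fun m => (j, m) else none) a *
          A.slotsExp s W Φ m (r * roundLength n + (n + 1 + n * (i + 1)))
            (Function.update σ i a) := by
  induction d generalizing j σ with
  | zero =>
    obtain rfl : j = n := by omega
    rw [zero_add, List.drop_of_length_le (by simp), List.filterMap_nil, recvAll,
      PMF.tsum_pure_mul, Function.update_eq_self]
    congr 2
    ring
  | succ d ih =>
    have hj : j < n := by omega
    rw [show d + 1 + m = (d + m) + 1 by ring, slotsExp,
      show n + 1 + (j + n * i) = deliverPos i ⟨j, hj⟩ from rfl, slotAt_deliver]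
    rw [List.drop_eq_getElem_cons (by simpa using hj), List.getElem_finRange]
    have hpos : r * roundLength n + deliverPos i ⟨j, hj⟩ + 1 =
        r * roundLength n + (n + 1 + ((j + 1) + n * i)) := by
      rw [deliverPos_eq]; ring
    rw [hpos]
    simp only [slotExp]
    have hfin : (Fin.cast (List.length_finRange) ⟨j, by simpa using hj⟩ : Fin n) = ⟨j, hj⟩ := rfl
    rw [hfin, List.filterMap_cons]
    split
    · rename_i j' m' heq
      rw [heq]
      simp only [recvAll, PMF.tsum_bind_mul]
      refine tsum_congr fun a => ?_
      rw [ih (j + 1) (by omega)]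
      simp only [Function.update_self, Function.update_idem]
    · rename_i heq
      rw [heq]
      exact ih (j + 1) (by omega) σ

theorem slotsExp_blocks (r d i : ℕ) (hd : i + d = n) (σ σ₀ : Fin n → A.State)
    (hσ : ∀ j : Fin n, i ≤ j → σ j = σ₀ j) :
    A.slotsExp s W Φ (n * d) (r * roundLength n + (n + 1 + n * i)) σ =
      iterExp (fun i => A.recvAll i (σ₀ i) (inboxList s W i)) ((List.finRange n).drop i) Φ σ := by
  induction d generalizing i σ with
  | zero =>
    rw [List.drop_of_length_le (by simp; omega)]
    rfl
  | succ d ih =>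
    have hi : i < n := by omega
    have h := slotsExp_block s W Φ r (n * d) ⟨i, hi⟩ n 0 (by omega) σ
    rw [zero_add, List.drop_zero] at h
    rw [mul_add, mul_one, add_comm, h, List.drop_eq_getElem_cons (by simpa using hi),
      List.getElem_finRange]
    have hfin : (Fin.cast (List.length_finRange) ⟨i, by simpa using hi⟩ : Fin n) = ⟨i, hi⟩ := rfl
    rw [hfin, iterExp, ← hσ ⟨i, hi⟩ le_rfl]
    refine tsum_congr fun a => ?_
    congr 1
    refine ih (i + 1) (by omega) _ fun j hj => ?_
    rw [Function.update_of_ne (fun h => by subst h; simp at hj), hσ j (by omega)]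

theorem slotsExp_round (r : ℕ) (σ : Fin n → A.State) :
    A.slotsExp s W Φ (roundLength n) (r * roundLength n) σ =
      iterExp (fun i => A.recvAll i (A.afterSend i (σ i)) (inboxList s W i)) (List.finRange n) Φ
        fun i => A.afterSend i (σ i) := by
  have h₁ := slotsExp_sends s W Φ r (n * n + 1) n 0 (by omega) σ
  rw [add_zero] at h₁
  rw [show roundLength n = n + (n * n + 1) by unfold roundLength; ring] at h₁ ⊢
  rw [h₁]
  rw [show n + (n * n + 1) = roundLength n by unfold roundLength; ring]
  simp only [Nat.zero_le, if_true]
  rw [slotsExp, slotAt_late, slotExp]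
  have h₂ := slotsExp_blocks s W Φ r n 0 (by omega) (fun i => A.afterSend i (σ i))
    (fun i => A.afterSend i (σ i)) fun _ _ => rfl
  rw [mul_zero, add_zero, List.drop_zero] at h₂
  exact h₂

end SlotsExp

/-- The partial execution `g` is possible when the adversary makes the moves `mv`. -/
def Follows (mv : ℕ → AdvMove n) (x : Fin n → Bool) (g : A.History) : Prop :=
  ∀ q < g.length, g.take (q + 1) ∈ (A.stepLaw x (g.take q) (mv q)).support

theorem exists_of_mem_stepLaw {g g' : A.History} {a : AdvMove n}
    (h : g' ∈ (A.stepLaw x g a).support) : ∃ e, g' = g ++ [e] := by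
  unfold stepLaw at h
  split at h
  · exact ⟨_, by simpa using h⟩
  · split at h
    · simp only [PMF.support_map, Set.mem_image] at h
      obtain ⟨s, -, rfl⟩ := h
      exact ⟨_, rfl⟩
    · exact ⟨_, by simpa using h⟩

theorem Follows.step {mv : ℕ → AdvMove n} {g g' : A.History} (h : Follows mv x g)
    (h' : g' ∈ (A.stepLaw x g (mv g.length)).support) :
    Follows mv x g' ∧ g <+: g' ∧ g'.length = g.length + 1 := by
  obtain ⟨e, rfl⟩ := exists_of_mem_stepLaw h'
  refine ⟨fun q hq => ?_, ⟨[e], rfl⟩, by simp⟩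
  rw [List.length_append, List.length_singleton] at hq
  by_cases hqg : q < g.length
  · rw [List.take_append_of_le_length hqg, List.take_append_of_le_length hqg.le]
    exact h q hqg
  · obtain rfl : q = g.length := by omega
    rw [List.take_append_of_le_length le_rfl, List.take_length, List.take_of_length_le (by simp)]
    exact h'

theorem Follows.isLocalRun {mv : ℕ → AdvMove n} {g : A.History} (h : Follows mv x g) :
    A.IsLocalRun mv x (fun q => A.stateAt x (g.take q)) g.length ∧
      ∀ q ≤ g.length, g.take q = A.hist mv (fun q => A.stateAt x (g.take q)) q :=
  isLocalRun_of_steps mv x (fun q => g.take q) g.length (by simp) h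

variable [NeZero n] {P : Plan n} {adv : A.Adversary} {r t : ℕ} {h : A.History}

theorem stepsExp_eq_slotsExp (hr : r < P.horizon) (hh : h.length = r * roundLength n)
    (hadv : ∀ g, h <+: g → g.length < (r + 1) * roundLength n → adv x g = P.move g.length)
    (Φ : (Fin n → A.State) → ℝ≥0∞) (m : ℕ) (g : A.History) (hg : h <+: g)
    (hf : Follows P.move x g) (hm : g.length + m = (r + 1) * roundLength n) :
    A.stepsExp adv x m (fun g => Φ (A.stateAt x g)) g =
      A.slotsExp (P.hear r) (fun j => A.send j (A.stateAt x h j)) Φ m g.length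
        (A.stateAt x g) := by
  induction m generalizing g with
  | zero => rfl
  | succ m ih =>
    have hlen := hg.length_le
    have hLs : (r + 1) * roundLength n = r * roundLength n + roundLength n := Nat.succ_mul _ _
    rw [stepsExp, slotsExp, hadv g hg (by omega)]
    rw [PMF.tsum_congr_support (g := fun g' => A.slotsExp (P.hear r)
      (fun j => A.send j (A.stateAt x h j)) Φ m (g.length + 1) (A.stateAt x g')) _
      fun g' hg' => ?_]
    swap
    · obtain ⟨h₁, h₂, h₃⟩ := hf.step hg'
      rw [ih g' (hg.trans h₂) h₁ (by omega), h₃]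
    obtain ⟨hloc, hhist⟩ := hf.isLocalRun
    have hgh := hhist g.length le_rfl
    rw [List.take_length] at hgh
    set τ : ℕ → Fin n → A.State := fun q => A.stateAt x (g.take q) with hτ
    generalize hq : g.length = q at *
    have hin : ∀ i k, A.pending g i k = A.inbox P.move τ q i k := fun i k => by
      rw [hgh, pending_hist]
    have hround : ∀ r' p, q = r' * roundLength n + p → p < roundLength n → r' = r := by
      intro r' p h₁ h₂
      refine (mul_add_inj (r' := r) (p' := q - r * roundLength n) ?_ h₂ (by omega)).1
      omega
    rcases exists_slot n q with ⟨r', i, h₁⟩ | ⟨r', h₁⟩ | ⟨r', i, j, h₁⟩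
    · obtain rfl := hround r' i h₁ (i.isLt.trans lt_roundLength)
      rw [show P.move q = .send i by rw [h₁, Plan.move_send r' i (.inl hr)],
        show slotAt n q = .send i by rw [h₁, slotAt_send]]
      simp only [stepLaw, slotExp]
      rw [PMF.tsum_pure_mul, stateAt_append]
      congr 1
      simp only [List.foldl_cons, List.foldl_nil, applyEvent, afterSend]
      split_ifs with hex
      · rfl
      · rw [Function.update_eq_self]
    · obtain rfl := hround r' n h₁ lt_roundLength
      rw [show P.move q = .deliver (Plan.lateReceiver n r') q by
        rw [h₁, Plan.move_late_of_lt hr], show slotAt n q = .late by rw [h₁, slotAt_late]]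
      simp only [stepLaw, slotExp]
      rw [hin, inbox_self]
      simp only
      rw [PMF.tsum_pure_mul, stateAt_append]
      rfl
    · obtain rfl := hround r' _ h₁ (deliverPos_lt i j)
      rw [show slotAt n q = .deliver i j by rw [h₁, slotAt_deliver]]
      have hhear : P.hearAt r' i = P.hear r' i := by rw [Plan.hearAt, if_pos hr]
      simp only [slotExp]
      by_cases hj : j ∈ P.hear r' i
      · rw [show P.move q = .deliver i (r' * roundLength n + j) by
          rw [h₁, Plan.move_deliver r' i j (hhear ▸ hj)]]
        simp only [stepLaw]
        have hW : A.send j (τ (r' * roundLength n + j) j) i = A.send j (A.stateAt x h j) i := by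
          have hp := lt_deliverPos i j
          have hjn := j.isLt
          rw [hloc.eq_roundStart (by omega), hτ]
          simp only
          rw [← hh, ← List.prefix_iff_eq_take.1 hg]
        rw [hin, if_pos hj, h₁, inbox_plan (hhear ▸ hj), hW, ← h₁]
        split
        · rw [PMF.tsum_map_mul]
          refine tsum_congr fun a => ?_
          rw [stateAt_append]
          rfl
        · rw [PMF.tsum_pure_mul, stateAt_append]
          rfl
      · rw [show P.move q = .deliver i q by
          rw [h₁, Plan.move_deliver_of_notMem r' i j (hhear ▸ hj)]]
        simp only [stepLaw]
        rw [hin, inbox_self, if_neg hj]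
        simp only
        rw [PMF.tsum_pure_mul, stateAt_append]
        rfl

/-- The states after a round are independent, each processor having received its messages. -/
theorem stepsExp_round (hr : r < P.horizon) (hh : h.length = r * roundLength n)
    (hadv : ∀ g, h <+: g → g.length < (r + 1) * roundLength n → adv x g = P.move g.length)
    (hf : Follows P.move x h) (Φ : (Fin n → A.State) → ℝ≥0∞) :
    A.stepsExp adv x (roundLength n) (fun g => Φ (A.stateAt x g)) h =
      iterExp (fun i => A.recvAll i (A.afterSend i (A.stateAt x h i))
          (inboxList (P.hear r) (fun j => A.send j (A.stateAt x h j)) i)) (List.finRange n) Φ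
        fun i => A.afterSend i (A.stateAt x h i) := by
  rw [stepsExp_eq_slotsExp hr hh hadv Φ _ h (List.prefix_refl h) hf
    (by rw [hh, Nat.succ_mul]), hh, slotsExp_round]

theorem stepsExp_mono_follows (N : ℕ)
    (hadv : ∀ g, h <+: g → g.length < N → adv x g = P.move g.length)
    {f f' : A.History → ℝ≥0∞}
    (hff : ∀ g, h <+: g → Follows P.move x g → g.length = N → f g ≤ f' g)
    (m : ℕ) (g : A.History) (hg : h <+: g) (hf : Follows P.move x g) (hm : g.length + m = N) :
    A.stepsExp adv x m f g ≤ A.stepsExp adv x m f' g := by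
  induction m generalizing g with
  | zero => exact hff g hg hf (by omega)
  | succ m ih =>
    refine PMF.tsum_le_support _ fun g' hg' => ?_
    rw [hadv g hg (by omega)] at hg'
    obtain ⟨h₁, h₂, h₃⟩ := hf.step hg'
    exact ih g' (hg.trans h₂) h₁ (by omega)

omit [NeZero n] in
theorem stepsExp_zero (m : ℕ) (g : A.History) : A.stepsExp adv x m (fun _ => 0) g = 0 := by
  induction m generalizing g with
  | zero => rfl
  | succ m ih => simp [stepsExp, ih]

end Algorithm

/-! ### Forgetfulness: the law of the next messages -/

namespace Algorithm

open scoped ENNReal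

variable {n : ℕ} {A : Algorithm.{u, v} n} {x : Fin n → Bool}

theorem receivedBy_append (i : Fin n) (h h' : A.History) :
    A.receivedBy i (h ++ h') = A.receivedBy i h ++ A.receivedBy i h' := by
  simp [receivedBy]

theorem receivedBy_recv (i k : _) (j : Fin n) (m : A.Msg) (s : A.State) :
    A.receivedBy i [.recv i k j m s] = [(j, m)] := by
  simp [receivedBy]

theorem receivedBy_eq_nil {i : Fin n} {e : ExecStep n A.State A.Msg}
    (h : ∀ k j m s, e ≠ .recv i k j m s) : A.receivedBy i [e] = [] := by
  cases e with
  | send => rfl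
  | skip => rfl
  | recv i' k j m s =>
    have : i' ≠ i := fun hi => h k j m s (by rw [hi])
    simp [receivedBy, this]

theorem receivedBy_map_eq_nil {i : Fin n} {l : List ℕ} {f : ℕ → ExecStep n A.State A.Msg}
    (h : ∀ q ∈ l, A.receivedBy i [f q] = []) : A.receivedBy i (l.map f) = [] := by
  induction l with
  | nil => rfl
  | cons q l ih =>
    rw [List.map_cons, ← List.singleton_append, receivedBy_append, h q (by simp),
      ih fun q hq => h q (by simp [hq]), List.append_nil]

theorem receivedBy_map {i : Fin n} {l : List (Fin n)} {f : Fin n → ExecStep n A.State A.Msg}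
    {f' : Fin n → Option (Fin n × A.Msg)} (h : ∀ j, A.receivedBy i [f j] = (f' j).toList) :
    A.receivedBy i (l.map f) = l.filterMap f' := by
  induction l with
  | nil => rfl
  | cons q l ih =>
    rw [List.map_cons, ← List.singleton_append, receivedBy_append, h q, ih, List.filterMap_cons]
    cases f' q <;> rfl

variable [NeZero n] {P : Plan n} {r t : ℕ}

/-- The messages that `i` receives after its sending step in round `r`. -/
theorem receivedBy_round {σ : ℕ → Fin n → A.State}
    (hσ : A.IsLocalRun P.move x σ ((r + 1) * roundLength n)) (hr : r < P.horizon) (i : Fin n) :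
    A.receivedBy i ((A.hist P.move σ ((r + 1) * roundLength n)).drop (r * roundLength n + i + 1)) =
      inboxList (P.hear r) (fun j => A.send j (σ (r * roundLength n) j)) i := by
  have hin := i.isLt
  have hLs : (r + 1) * roundLength n = r * roundLength n + roundLength n := Nat.succ_mul _ _
  have hLd : roundLength n = n + 1 + n * n := rfl
  have hni : n * i + n ≤ n * n := by
    have := Nat.mul_le_mul_left n (Nat.succ_le_of_lt hin)
    rwa [Nat.mul_succ] at this
  have hother : ∀ q, r * roundLength n ≤ q → q < (r + 1) * roundLength n →
      (∀ j : Fin n, q ≠ r * roundLength n + deliverPos i j) →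
        A.receivedBy i [A.record P.move σ q] = [] := by
    intro q hq₁ hq₂ hq
    refine receivedBy_eq_nil fun k j m s hrec => ?_
    obtain ⟨h₁, h₂, -⟩ := record_eq_recv hrec
    rcases Plan.move_eq_deliver h₁ (inbox_eq_some.1 h₂).1 with
      ⟨r', j', rfl, -, -⟩ | ⟨r', rfl, h₃, -⟩
    · have := (mul_add_inj (n := n) (r := r') (p := deliverPos i j') (r' := r)
        (p' := r' * roundLength n + deliverPos i j' - r * roundLength n) (by omega)
        (deliverPos_lt i j') (by omega)).1
      exact hq j' (by rw [this])
    · have := (mul_add_inj (n := n) (r := r') (p := n) (r' := r)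
        (p' := r' * roundLength n + n - r * roundLength n) (by omega) lt_roundLength (by omega)).1
      omega
  have hsplit : (A.hist P.move σ ((r + 1) * roundLength n)).drop (r * roundLength n + i + 1) =
      (List.range' (r * roundLength n + i + 1) (n - i + n * i)).map (A.record P.move σ) ++
      ((List.finRange n).map (fun j => A.record P.move σ (r * roundLength n + deliverPos i j)) ++
      (List.range' (r * roundLength n + (n + 1 + n * i) + n) (n * n - n * i - n)).map
        (A.record P.move σ)) := by
    have hmid : (List.finRange n).map
        (fun j => A.record P.move σ (r * roundLength n + deliverPos i j)) =
        (List.range' (r * roundLength n + (n + 1 + n * i)) n).map (A.record P.move σ) := by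
      rw [List.range'_eq_map_range, ← List.map_coe_finRange_eq_range, List.map_map, List.map_map]
      refine List.map_congr_left fun j _ => ?_
      simp only [Function.comp_apply, deliverPos_eq]
      congr 1
      ring
    rw [hmid, hist, ← List.map_drop, List.range_eq_range', List.drop_range', ← List.map_append,
      ← List.map_append, List.range'_append_1]
    rw [show r * roundLength n + (n + 1 + n * ↑i) =
      r * roundLength n + ↑i + 1 + (n - ↑i + n * ↑i) by omega, List.range'_append_1]
    congr 2 <;> omega
  rw [hsplit, receivedBy_append, receivedBy_append, receivedBy_map_eq_nil, receivedBy_map_eq_nil,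
    List.append_nil, List.nil_append, inboxList]
  · refine receivedBy_map fun j => ?_
    have hjn := j.isLt
    have hp := deliverPos_lt i j
    have hp' := lt_deliverPos i j
    have hhear : P.hearAt r i = P.hear r i := by rw [Plan.hearAt, if_pos hr]
    split_ifs with hj
    · have hmv := Plan.move_deliver (P := P) r i j (hhear ▸ hj)
      have hib := inbox_plan (A := A) (σ := σ) (P := P) (i := i) (j := j) (r := r) (hhear ▸ hj)
      rw [hσ.eq_roundStart (by omega)] at hib
      cases hm : A.send j (σ (r * roundLength n) j) i with
      | none =>
        rw [hm] at hib
        rw [Algorithm.record_skip hmv hib]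
        rfl
      | some m =>
        rw [hm] at hib
        rw [Algorithm.record_deliver hmv hib, receivedBy_recv]
        rfl
    · have hmv := Plan.move_deliver_of_notMem (P := P) r i j (hhear ▸ hj)
      rw [Algorithm.record_skip hmv (inbox_self _ _)]
      rfl
  · intro q hq
    rw [List.mem_range'_1] at hq
    refine hother q (by omega) (by omega) fun j hj => ?_
    rw [deliverPos_eq] at hj
    omega
  · intro q hq
    rw [List.mem_range'_1] at hq
    refine hother q (by omega) (by omega) fun j hj => ?_
    rw [deliverPos_eq] at hj
    omega

variable (A) in
/-- `κ i b L` is the law of the messages that `i`, with input `b`, sends after it has received the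
messages `L` since its previous sending event. The laws `γ s` supply what is missing in a state `s`
in which `i` is not ready to send to everybody. -/
def IsMessageLaw (κ : Fin n → Bool → List (Fin n × A.Msg) → PMF (Fin n → A.Msg)) : Prop :=
  ∀ (x : Fin n → Bool) (h₀ h₁ : A.History), A.Reachable x (h₀ ++ h₁) →
    ∀ i : Fin n, (h₀ = [] ∨ ∃ e, h₀.getLast? = some e ∧ A.IsSendingEvent i e) →
    (∀ e ∈ h₁, ¬ A.IsSendingEvent i e) →
    ∃ γ : A.State → PMF (Fin n → A.Msg),
      (A.recvAll i (A.stateAt x h₀ i) (A.receivedBy i h₁)).bind γ =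
        κ i (x i) (A.receivedBy i h₁) ∧
      ∀ s ∈ (A.recvAll i (A.stateAt x h₀ i) (A.receivedBy i h₁)).support,
        ∀ v ∈ (γ s).support, ∀ k m, A.send i s k = some m → v k = m

variable {κ : Fin n → Bool → List (Fin n × A.Msg) → PMF (Fin n → A.Msg)} {h : A.History}

/-- Every state that has positive probability after the messages of a round have been received
occurs in some execution. -/
theorem exists_follows (hr : r < P.horizon) (hh : h.length = r * roundLength n)
    (hf : Follows P.move x h) (i : Fin n) (s : A.State)
    (hs : s ∈ (A.recvAll i (A.afterSend i (A.stateAt x h i))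
      (inboxList (P.hear r) (fun j => A.send j (A.stateAt x h j)) i)).support) :
    ∃ g, h <+: g ∧ Follows P.move x g ∧ g.length = (r + 1) * roundLength n ∧
      A.stateAt x g i = s := by
  classical
  by_contra hcon
  push Not at hcon
  have h₁ := stepsExp_round (adv := fun _ g => P.move g.length) hr hh (fun _ _ _ => rfl) hf
    fun σ => if σ i = s then 1 else 0
  rw [iterExp_of_coordinate _ _ (List.nodup_finRange n) i (List.mem_finRange i)
    fun a => if a = s then 1 else 0] at h₁
  have h₂ := stepsExp_mono_follows (A := A) (x := x) (P := P) (h := h)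
    (adv := fun _ g => P.move g.length) ((r + 1) * roundLength n) (fun _ _ _ => rfl)
    (f := fun g => if A.stateAt x g i = s then 1 else 0) (f' := fun _ => 0)
    (fun g hg₁ hg₂ hg₃ => by rw [if_neg (hcon g hg₁ hg₂ hg₃)]) (roundLength n) h
    (List.prefix_refl h) hf (by rw [hh, Nat.succ_mul])
  rw [stepsExp_zero, h₁, tsum_eq_single s fun b hb => by simp [hb], if_pos rfl, mul_one] at h₂
  exact (PMF.mem_support_iff _ _).1 hs (le_antisymm h₂ bot_le)

/-- The messages that `i` sends in round `r + 1` have the law that forgetfulness prescribes. -/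
theorem map_send_recvAll (hκ : A.IsMessageLaw κ) (hA : A.FullyCommunicative t) (hP : P.Legal t)
    (hal : P.alive = Finset.univ) (hr : r < P.horizon) (hh : h.length = r * roundLength n)
    (hf : Follows P.move x h) (i : Fin n) :
    (A.recvAll i (A.afterSend i (A.stateAt x h i))
      (inboxList (P.hear r) (fun j => A.send j (A.stateAt x h j)) i)).map (A.send i) =
    (κ i (x i) (inboxList (P.hear r) (fun j => A.send j (A.stateAt x h j)) i)).map
      fun v k => some (v k) := by
  have halive : ∀ r i, P.AliveAt r i := fun r i => .inr (by rw [hal]; exact Finset.mem_univ i)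
  have hin := i.isLt
  have hL := lt_roundLength (n := n)
  have hLs : (r + 1) * roundLength n = r * roundLength n + roundLength n := Nat.succ_mul _ _
  set p := A.recvAll i (A.afterSend i (A.stateAt x h i))
    (inboxList (P.hear r) (fun j => A.send j (A.stateAt x h j)) i) with hp
  have hrun : ∀ g, h <+: g → Follows P.move x g → g.length = (r + 1) * roundLength n →
      ∃ σ, A.IsLocalRun P.move x σ ((r + 1) * roundLength n) ∧
        g = A.hist P.move σ ((r + 1) * roundLength n) ∧
        σ ((r + 1) * roundLength n) = A.stateAt x g ∧
        σ (r * roundLength n) = A.stateAt x h := by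
    intro g hg hfg hlen
    obtain ⟨h₁, h₂⟩ := hfg.isLocalRun
    refine ⟨_, hlen ▸ h₁, ?_, ?_, ?_⟩
    · have := h₂ g.length le_rfl
      rwa [List.take_length, hlen] at this
    · simp only [← hlen, List.take_length]
    · simp only [← hh]
      rw [← List.prefix_iff_eq_take.1 hg]
  have hready : ∀ s ∈ p.support, ∀ k, (A.send i s k).isSome := by
    intro s hs k
    obtain ⟨g, hg, hfg, hlen, rfl⟩ := exists_follows hr hh hf i s hs
    obtain ⟨σ, h₁, -, h₃, -⟩ := hrun g hg hfg hlen
    rw [← h₃]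
    exact h₁.ready hA hP le_rfl (halive _ _) k
  obtain ⟨s₀, hs₀⟩ := p.support_nonempty
  obtain ⟨g, hg, hfg, hlen, -⟩ := exists_follows hr hh hf i s₀ hs₀
  obtain ⟨σ, h₁, h₂, -, h₄⟩ := hrun g hg hfg hlen
  have hmv : P.move (r * roundLength n + i) = .send i := Plan.move_send r i (halive r i)
  have hfirst : ∀ k, (A.send i (σ (r * roundLength n + i) i) k).isSome := fun k => by
    rw [h₁.eq_roundStart (by omega)]
    exact h₁.ready hA hP (by omega) (halive _ _) k
  have key := hκ x (g.take (r * roundLength n + i + 1)) (g.drop (r * roundLength n + i + 1))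
    (by rw [List.take_append_drop, h₂]; exact h₁.reachable le_rfl) i
    (.inr ⟨A.record P.move σ (r * roundLength n + i), by
      rw [h₂, take_hist (by omega), hist_succ]; simp,
      A.send i (σ (r * roundLength n + i) i), record_send hmv, i, hfirst i⟩) (by
    rintro e he ⟨w, rfl, -⟩
    obtain ⟨d, hd⟩ := List.mem_iff_getElem?.1 he
    rw [List.getElem?_drop, h₂, getElem?_hist_eq_some] at hd
    obtain ⟨hd₁, hd₂⟩ := hd
    obtain ⟨r', h₅, -⟩ := Plan.move_eq_send (record_eq_send hd₂).1
    have := (mul_add_inj (n := n) (r := r) (p := i + 1 + d) (r' := r') (p' := i) (by omega)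
      (by omega) (by omega)).2
    omega)
  rw [h₂, receivedBy_round h₁ hr, take_hist (by omega), h₁.stateAt_hist (by omega), h₄] at key
  have hst : σ (r * roundLength n + i + 1) i = A.afterSend i (A.stateAt x h i) := by
    have h₅ := h₁.step (r * roundLength n + i) (by omega)
    unfold LocalStep at h₅
    simp only [hmv] at h₅
    rw [h₅, ← h₄, ← h₁.eq_roundStart (i := i) (by omega), afterSend, if_pos ⟨i, hfirst i⟩,
      if_pos ⟨i, hfirst i⟩, Function.update_self]
  rw [hst, ← hp] at key
  obtain ⟨γ, hγ, hv⟩ := key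
  rw [← hγ, PMF.map_bind, ← PMF.bind_pure_comp]
  refine p.bind_congr_support fun s hs => (PMF.map_eq_pure_of_support _ fun v hvs => ?_).symm
  funext k
  obtain ⟨m, hm⟩ := Option.isSome_iff_exists.1 (hready s hs k)
  rw [hm, hv s hs v hvs k m hm]

/-- Given the past, the messages of the next round are independent, and their laws depend only on
the inputs and on the messages that are received in this round. -/
theorem stepsExp_messages (hκ : A.IsMessageLaw κ) (hA : A.FullyCommunicative t) (hP : P.Legal t)
    (hal : P.alive = Finset.univ) (hr : r < P.horizon) (hh : h.length = r * roundLength n)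
    {adv : A.Adversary}
    (hadv : ∀ g, h <+: g → g.length < (r + 1) * roundLength n → adv x g = P.move g.length)
    (hf : Follows P.move x h) (Ψ : (Fin n → Fin n → Option A.Msg) → ℝ≥0∞)
    (y : Fin n → Fin n → Option A.Msg) :
    A.stepsExp adv x (roundLength n) (fun g => Ψ fun i => A.send i (A.stateAt x g i)) h =
      iterExp (fun i => (κ i (x i)
          (inboxList (P.hear r) (fun j => A.send j (A.stateAt x h j)) i)).map fun v k => some (v k))
        (List.finRange n) Ψ y := by
  rw [stepsExp_round hr hh hadv hf fun σ => Ψ fun i => A.send i (σ i)]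
  rw [iterExp_comp _ _ A.send (List.finRange n)
    (fun i _ => map_send_recvAll hκ hA hP hal hr hh hf i) Ψ]
  exact iterExp_congr _ _ _ _ _ fun i hi => absurd (List.mem_finRange i) hi

end Algorithm

/-! ### The valence game -/

namespace Algorithm

open scoped ENNReal

variable {n : ℕ} [NeZero n] {A : Algorithm.{u, v} n}

/-- Law of the messages that `i` sends in the next round, if `W` holds the messages of this round,
and `s` tells which of them are received. -/
noncomputable def nextLaw (κ : Fin n → Bool → List (Fin n × A.Msg) → PMF (Fin n → A.Msg))
    (x : Fin n → Bool) (W : Fin n → Fin n → Option A.Msg) (s : Fin n → Finset (Fin n))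
    (i : Fin n) : PMF (Fin n → Option A.Msg) :=
  (κ i (x i) (inboxList s W i)).map fun v k => some (v k)

/-- The probability above which a set of message tables counts as likely. It is the bound of
`exists_close_of_lt_iterExp`. -/
noncomputable def threshold (n t : ℕ) : ℝ≥0∞ :=
  ENNReal.ofReal (Real.exp (-(t : ℝ) ^ 2 / (2 * n)))

/-- The transcript `(x, V, S)` of `r` rounds leans to `b` with `k` rounds to go: whatever the
adversary does in the next round, the new transcript is likely to lean to `b` with `k - 1` rounds to
go; and with no round to go, the transcript is compatible with a decision for `b`. -/
def Leans (A : Algorithm.{u, v} n)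
    (κ : Fin n → Bool → List (Fin n × A.Msg) → PMF (Fin n → A.Msg)) (t : ℕ) (b : Bool) :
    ℕ → ℕ → (Fin n → Bool) → (ℕ → Fin n → Fin n → Option A.Msg) → (ℕ → Fin n → Finset (Fin n)) →
      Prop
  | 0, r, x, V, S => A.CanDecide b r x V S
  | k + 1, r, x, V, S => ∀ s : Fin n → Finset (Fin n), (∀ i, n - t ≤ (s i).card) →
      threshold n t < iterExp (nextLaw κ x (V r) s) (List.finRange n)
        ({v | Leans A κ t b k (r + 1) x (Function.update V (r + 1) v)
          (Function.update S r s)}.indicator 1) (V r)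

/-- Probability that the transcript leans to `b` after the next round, if the adversary chooses `s`
for this round. -/
noncomputable def leanProb (A : Algorithm.{u, v} n)
    (κ : Fin n → Bool → List (Fin n × A.Msg) → PMF (Fin n → A.Msg)) (t : ℕ) (b : Bool) (k r : ℕ)
    (x : Fin n → Bool) (V : ℕ → Fin n → Fin n → Option A.Msg) (S : ℕ → Fin n → Finset (Fin n))
    (s : Fin n → Finset (Fin n)) : ℝ≥0∞ :=
  iterExp (nextLaw κ x (V r) s) (List.finRange n)
    ({v | A.Leans κ t b k (r + 1) x (Function.update V (r + 1) v)
      (Function.update S r s)}.indicator 1) (V r)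

variable {κ : Fin n → Bool → List (Fin n × A.Msg) → PMF (Fin n → A.Msg)} {t : ℕ}

theorem leans_succ {b : Bool} {k r : ℕ} {x : Fin n → Bool}
    {V : ℕ → Fin n → Fin n → Option A.Msg} {S : ℕ → Fin n → Finset (Fin n)} :
    A.Leans κ t b (k + 1) r x V S ↔
      ∀ s : Fin n → Finset (Fin n), (∀ i, n - t ≤ (s i).card) →
        threshold n t < A.leanProb κ t b k r x V S s := Iff.rfl

omit [NeZero n] in
theorem inboxList_congr {s : Fin n → Finset (Fin n)} {s' : Fin n → Finset (Fin n)}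
    {W W' : Fin n → Fin n → Option A.Msg} {i : Fin n} (hs : s i = s' i)
    (hW : ∀ j ∈ s i, W j i = W' j i) : inboxList s W i = inboxList s' W' i := by
  unfold inboxList
  refine List.filterMap_congr fun j _ => ?_
  rw [← hs]
  split_ifs with hj
  · rw [hW j hj]
  · rfl

omit [NeZero n] in
theorem legal_update {S : ℕ → Fin n → Finset (Fin n)} {s : Fin n → Finset (Fin n)} {r : ℕ}
    (hS : ∀ r' < r, ∀ i, n - t ≤ (S r' i).card) (hs : ∀ i, n - t ≤ (s i).card) :
    ∀ r' < r + 1, ∀ i, n - t ≤ (Function.update S r s r' i).card := by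
  intro r' hr' i
  by_cases h : r' = r
  · subst h
    rw [Function.update_self]
    exact hs i
  · rw [Function.update_of_ne h]
    exact hS r' (by omega) i

open Classical in
/-- Compatible transcripts whose last messages differ only in `w` and in fewer than `t` other
processors do not lean to different decisions; the inputs may differ in `w`. Otherwise the
adversary can silence these processors. Then, except for those of `w`, the messages of the next
round have the same laws in both cases, and by isoperimetry there are two outcomes, one for each
decision, that again differ only in `w` and in fewer than `t` other processors. -/
theorem not_leans_both (hA : A.FullyCommunicative t) (hC : A.Correct) (hT : A.Terminating t)
    (ht : 0 < t) (htn : t < n) (w : Fin n) (k : ℕ) :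
    ∀ (r : ℕ) (x x' : Fin n → Bool) (V V' : ℕ → Fin n → Fin n → Option A.Msg)
      (S S' : ℕ → Fin n → Finset (Fin n)), (∀ r' < r, ∀ i, n - t ≤ (S' r' i).card) →
      Compatible r V S V' S' → (∀ i, i ≠ w → x i = x' i) →
      ((List.finRange n).filter fun i => i ≠ w ∧ V r i ≠ V' r i).length < t →
      A.Leans κ t false k r x V S → A.Leans κ t true k r x' V' S' → False := by
  induction k with
  | zero =>
    intro r x x' V V' S S' hS' hcomp _ _ h h'
    exact not_canDecide_both hA hC hT ht htn hS' hcomp h h'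
  | succ k ih =>
    intro r x x' V V' S S' hS' hcomp hx hlen h h'
    set Q : Finset (Fin n) :=
      insert w ((List.finRange n).filter fun i => i ≠ w ∧ V r i ≠ V' r i).toFinset with hQ
    have hQc : Q.card ≤ t := by
      rw [hQ]
      exact (Finset.card_insert_le _ _).trans
        ((Nat.succ_le_succ (List.toFinset_card_le _)).trans hlen)
    have hs : ∀ _ : Fin n, n - t ≤ (Qᶜ).card := fun _ => by
      rw [Finset.card_compl, Fintype.card_fin]
      omega
    have hV : ∀ j ∈ Qᶜ, V r j = V' r j := by
      intro j hj
      by_contra hne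
      rw [Finset.mem_compl, hQ, Finset.mem_insert, not_or] at hj
      refine hj.2 (List.mem_toFinset.2 (List.mem_filter.2 ⟨List.mem_finRange j, ?_⟩))
      simpa using ⟨hj.1, hne⟩
    have hlaw : ∀ i, i ≠ w →
        nextLaw κ x (V r) (fun _ => Qᶜ) i = nextLaw κ x' (V' r) (fun _ => Qᶜ) i := by
      intro i hi
      rw [nextLaw, nextLaw, hx i hi, inboxList_congr rfl fun j hj => by rw [hV j hj]]
    have h₁ := h (fun _ => Qᶜ) hs
    have h₂ := h' (fun _ => Qᶜ) hs
    obtain ⟨z, hz, z', hz', hzz⟩ := exists_close_of_lt_iterExp _ _ w hlaw _ _ (List.finRange n)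
      (List.nodup_finRange n) List.mem_finRange t (V r) (V' r)
      (by rw [List.length_finRange]; exact h₁) (by rw [List.length_finRange]; exact h₂)
    refine ih (r + 1) x x' _ _ _ _ (legal_update hS' hs) ?_ hx ?_ hz hz'
    · intro r' hr' i j hj
      rw [Function.update_of_ne (by omega), Function.update_of_ne (by omega)]
      by_cases hrr : r' = r
      · subst hrr
        simp only [Function.update_self, or_self] at hj
        rw [hV j hj]
      · rw [Function.update_of_ne hrr, Function.update_of_ne hrr] at hj
        exact hcomp r' (by omega) i j hj
    · simpa only [Function.update_self] using hzz

open Classical in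
/-- If a transcript leans to neither decision, the adversary has a choice for the next round after
which it is unlikely to lean to either decision. The choice is found on a path that changes one
processor at a time, from a choice that is good against `false` to one that is good against
`true`. -/
theorem exists_leanProb_le (hA : A.FullyCommunicative t) (hC : A.Correct) (hT : A.Terminating t)
    (ht : 0 < t) (htn : t < n) {k r : ℕ} {x : Fin n → Bool}
    {V : ℕ → Fin n → Fin n → Option A.Msg} {S : ℕ → Fin n → Finset (Fin n)}
    (hS : ∀ r' < r, ∀ i, n - t ≤ (S r' i).card)
    (h : ∀ b, ¬ A.Leans κ t b (k + 1) r x V S) :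
    ∃ s : Fin n → Finset (Fin n), (∀ i, n - t ≤ (s i).card) ∧
      ∀ b, A.leanProb κ t b k r x V S s ≤ threshold n t := by
  by_contra hcon
  push Not at hcon
  have h₀ := h false
  have h₁ := h true
  rw [leans_succ] at h₀ h₁
  push Not at h₀ h₁
  obtain ⟨s₀, hs₀, hle₀⟩ := h₀
  obtain ⟨s₁, hs₁, hle₁⟩ := h₁
  set s : ℕ → Fin n → Finset (Fin n) := fun m i => if (i : ℕ) < m then s₁ i else s₀ i with hsdef
  have hs : ∀ m i, n - t ≤ (s m i).card := by
    intro m i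
    simp only [hsdef]
    split_ifs
    · exact hs₁ i
    · exact hs₀ i
  have hpath : ∀ m ≤ n, A.leanProb κ t false k r x V S (s m) ≤ threshold n t := by
    intro m hm
    induction m with
    | zero =>
      have : s 0 = s₀ := by funext i; simp [hsdef]
      rw [this]
      exact hle₀
    | succ m ih =>
      have ih := ih (by omega)
      have hG : threshold n t < A.leanProb κ t true k r x V S (s m) := by
        obtain ⟨b, hb⟩ := hcon (s m) (hs m)
        cases b with
        | false => exact absurd ih (not_le.2 hb)
        | true => exact hb
      by_contra hF
      rw [not_le] at hF
      set w : Fin n := ⟨m, by omega⟩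
      have hsw : ∀ i, i ≠ w → s (m + 1) i = s m i := by
        intro i hi
        have : (i : ℕ) ≠ m := fun h => hi (Fin.ext h)
        simp only [hsdef]
        by_cases him : (i : ℕ) < m
        · rw [if_pos him, if_pos (by omega)]
        · rw [if_neg him, if_neg (by omega)]
      obtain ⟨z, hz, z', hz', hzz⟩ := exists_close_of_lt_iterExp (nextLaw κ x (V r) (s (m + 1)))
        (nextLaw κ x (V r) (s m)) w
        (fun i hi => by rw [nextLaw, nextLaw, inboxList_congr (hsw i hi) fun _ _ => rfl])
        _ _ (List.finRange n) (List.nodup_finRange n) List.mem_finRange t (V r) (V r)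
        (by rw [List.length_finRange]; exact hF) (by rw [List.length_finRange]; exact hG)
      refine not_leans_both hA hC hT ht htn w k (r + 1) x x _ _ _ _ (legal_update hS (hs m)) ?_
        (fun _ _ => rfl) ?_ hz hz'
      · intro r' hr' i j _
        rw [Function.update_of_ne (by omega), Function.update_of_ne (by omega)]
      · simpa only [Function.update_self] using hzz
  obtain ⟨b, hb⟩ := hcon s₁ hs₁
  have hn : s n = s₁ := by funext i; simp [hsdef]
  cases b with
  | false => exact absurd (hn ▸ hpath n le_rfl) (not_le.2 hb)
  | true => exact absurd hle₁ (not_le.2 hb)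

theorem not_leans_of_inputs (hC : A.Correct) {b : Bool} {x : Fin n → Bool} (hx : ∀ i, x i ≠ b)
    (k : ℕ) : ∀ (r : ℕ) (V : ℕ → Fin n → Fin n → Option A.Msg) (S : ℕ → Fin n → Finset (Fin n)),
      ¬ A.Leans κ t b k r x V S := by
  induction k with
  | zero =>
    rintro r V S ⟨σ, hσ, -, i, hi⟩
    rw [← hσ.stateAt_hist le_rfl] at hi
    obtain ⟨j, hj⟩ := (hC x _ (hσ.reachable le_rfl)).2 i b hi
    exact hx j hj
  | succ k ih =>
    intro r V S h
    have := (h (fun _ => Finset.univ) fun i => by simp).trans_le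
      (iterExp_mono _ _ (g := fun _ => 0) _ fun z => by
        have hz : z ∉ {v | A.Leans κ t b k (r + 1) x (Function.update V (r + 1) v)
            (Function.update S r fun _ => Finset.univ)} := ih _ _ _
        exact le_of_eq (Set.indicator_of_notMem hz _))
    rw [iterExp_const] at this
    exact not_lt_bot this

/-! ### The adversary -/

variable (A) in
/-- The messages of the rounds up to `r`, computed from a partial execution. -/
def msgTable (x : Fin n → Bool) (h : A.History) (r : ℕ) : ℕ → Fin n → Fin n → Option A.Msg :=
  fun r' => if r' ≤ r then fun j => A.send j (A.stateAt x (h.take (r' * roundLength n)) j)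
    else fun _ _ => none

/-- There are inputs for which the empty execution leans to neither decision. -/
theorem exists_not_leans (hA : A.FullyCommunicative t) (hC : A.Correct) (hT : A.Terminating t)
    (ht : 0 < t) (htn : t < n) (k : ℕ) :
    ∃ x, ∀ b, ¬ A.Leans κ t b k 0 x (A.msgTable x [] 0) fun _ _ => ∅ := by
  classical
  by_contra hcon
  push Not at hcon
  set x : ℕ → Fin n → Bool := fun m i => decide ((i : ℕ) < m) with hx
  have hpath : ∀ m ≤ n, A.Leans κ t false k 0 (x m) (A.msgTable (x m) [] 0) fun _ _ => ∅ := by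
    intro m hm
    obtain ⟨b, hb⟩ := hcon (x m)
    cases b with
    | false => exact hb
    | true =>
      exfalso
      induction m with
      | zero => exact not_leans_of_inputs hC (by simp [hx]) _ _ _ _ hb
      | succ m ih =>
        obtain ⟨b', hb'⟩ := hcon (x m)
        cases b' with
        | true => exact ih (by omega) hb'
        | false =>
          have hne : ∀ i : Fin n, i ≠ ⟨m, by omega⟩ → x m i = x (m + 1) i := by
            intro i hi
            have : (i : ℕ) ≠ m := fun h => hi (Fin.ext h)
            simp only [hx, decide_eq_decide]
            omega
          refine not_leans_both hA hC hT ht htn ⟨m, by omega⟩ k 0 _ _ _ _ _ _ (by simp)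
            (fun r' hr' => absurd hr' (by omega)) hne ?_ hb' hb
          rw [List.filter_eq_nil_iff.2]
          · exact ht
          · intro i _
            simp only [ne_eq, decide_eq_true_eq, not_and, not_not]
            intro hi
            simp only [msgTable, le_refl, if_true, List.take_nil, stateAt, List.foldl_nil,
              hne i hi]
  exact not_leans_of_inputs hC (by simp [hx]) _ _ _ _ (hpath n le_rfl)

open Classical in
/-- The choice of the adversary for round `r`, after which `k` rounds are left. -/
noncomputable def choice (A : Algorithm.{u, v} n)
    (κ : Fin n → Bool → List (Fin n × A.Msg) → PMF (Fin n → A.Msg)) (t k r : ℕ)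
    (x : Fin n → Bool) (V : ℕ → Fin n → Fin n → Option A.Msg) (S : ℕ → Fin n → Finset (Fin n)) :
    Fin n → Finset (Fin n) :=
  if h : ∃ s : Fin n → Finset (Fin n), (∀ i, n - t ≤ (s i).card) ∧
      ∀ b, A.leanProb κ t b k r x V S s ≤ threshold n t then h.choose
  else fun _ => Finset.univ

theorem card_choice (k r : ℕ) (x : Fin n → Bool) (V : ℕ → Fin n → Fin n → Option A.Msg)
    (S : ℕ → Fin n → Finset (Fin n)) (i : Fin n) :
    n - t ≤ (A.choice κ t k r x V S i).card := by
  unfold choice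
  split_ifs with h
  · exact h.choose_spec.1 i
  · simp

theorem leanProb_choice_le (hA : A.FullyCommunicative t) (hC : A.Correct) (hT : A.Terminating t)
    (ht : 0 < t) (htn : t < n) {k r : ℕ} {x : Fin n → Bool}
    {V : ℕ → Fin n → Fin n → Option A.Msg} {S : ℕ → Fin n → Finset (Fin n)}
    (hS : ∀ r' < r, ∀ i, n - t ≤ (S r' i).card)
    (h : ∀ b, ¬ A.Leans κ t b (k + 1) r x V S) (b : Bool) :
    A.leanProb κ t b k r x V S (A.choice κ t k r x V S) ≤ threshold n t := by
  have hex := exists_leanProb_le hA hC hT ht htn hS h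
  unfold choice
  rw [dif_pos hex]
  exact hex.choose_spec.2 b

/-- The choices of the adversary in the first `r` of `T` rounds, along a partial execution. -/
noncomputable def choices (A : Algorithm.{u, v} n)
    (κ : Fin n → Bool → List (Fin n × A.Msg) → PMF (Fin n → A.Msg)) (t T : ℕ)
    (x : Fin n → Bool) (h : A.History) : ℕ → ℕ → Fin n → Finset (Fin n)
  | 0 => fun _ _ => ∅
  | r + 1 => Function.update (choices A κ t T x h r) r
      (A.choice κ t (T - (r + 1)) r x (A.msgTable x h r) (choices A κ t T x h r))

/-- The plan that the adversary follows, as far as it is determined by a partial execution: it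
avoids transcripts that lean to a decision for `T` rounds, and is fair afterwards. -/
noncomputable def choicePlan (A : Algorithm.{u, v} n)
    (κ : Fin n → Bool → List (Fin n × A.Msg) → PMF (Fin n → A.Msg)) (t T : ℕ)
    (x : Fin n → Bool) (h : A.History) : Plan n :=
  ⟨fun r => A.choices κ t T x h (r + 1) r, T, Finset.univ⟩

/-- The adversary that keeps the transcript from leaning to a decision for `T` rounds. It delays
messages, but lets no processor crash. -/
noncomputable def delayingAdversary (A : Algorithm.{u, v} n)
    (κ : Fin n → Bool → List (Fin n × A.Msg) → PMF (Fin n → A.Msg)) (t T : ℕ) : A.Adversary :=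
  fun x h => (A.choicePlan κ t T x h).move h.length

variable {T : ℕ} {x : Fin n → Bool}

omit [NeZero n] in
theorem msgTable_congr {g h : A.History} (hgh : g <+: h) {r : ℕ}
    (hr : r * roundLength n ≤ g.length) : A.msgTable x g r = A.msgTable x h r := by
  funext r'
  unfold msgTable
  split_ifs with hr'
  · obtain ⟨e, rfl⟩ := hgh
    rw [List.take_append_of_le_length ((Nat.mul_le_mul_right _ hr').trans hr)]
  · rfl

theorem choices_congr {g h : A.History} (hgh : g <+: h) {r : ℕ}
    (hr : r * roundLength n ≤ g.length) :
    A.choices κ t T x g (r + 1) = A.choices κ t T x h (r + 1) := by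
  induction r with
  | zero => rw [choices, choices, msgTable_congr hgh hr]; rfl
  | succ r ih =>
    have := ih ((Nat.mul_le_mul_right _ r.le_succ).trans hr)
    rw [choices, this, msgTable_congr hgh hr]
    rfl

theorem choices_eq (h : A.History) {r R : ℕ} (hr : r < R) :
    A.choices κ t T x h R r = A.choices κ t T x h (r + 1) r := by
  induction R with
  | zero => omega
  | succ R ih =>
    rcases Nat.lt_succ_iff_lt_or_eq.1 hr with hr | rfl
    · rw [choices, Function.update_of_ne (by omega), ih hr]
    · rfl

theorem card_choices (h : A.History) {r R : ℕ} (hr : r < R) (i : Fin n) :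
    n - t ≤ (A.choices κ t T x h R r i).card := by
  rw [choices_eq h hr, choices, Function.update_self]
  exact card_choice _ _ _ _ _ _

theorem move_eq_of_hear {P P' : Plan n} {q : ℕ} (h₁ : P.horizon = P'.horizon)
    (h₂ : P.alive = P'.alive) (h₃ : P.hear (q / roundLength n) = P'.hear (q / roundLength n)) :
    P.move q = P'.move q := by
  classical
  unfold Plan.move
  split
  · exact if_congr (by rw [Plan.AliveAt, Plan.AliveAt, h₁, h₂]) rfl rfl
  · exact if_congr (by rw [h₁, h₂]) rfl rfl
  · exact if_congr (by rw [Plan.hearAt, Plan.hearAt, h₁, h₂, h₃]) rfl rfl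

theorem choicePlan_move {g h : A.History} (hgh : g <+: h) {q : ℕ}
    (hq : q / roundLength n * roundLength n ≤ g.length) :
    (A.choicePlan κ t T x g).move q = (A.choicePlan κ t T x h).move q := by
  refine move_eq_of_hear rfl rfl ?_
  simp only [choicePlan]
  rw [choices_congr hgh hq]

theorem choicePlan_legal (h : A.History) : (A.choicePlan κ t T x h).Legal t :=
  ⟨fun _ _ i => card_choices h (Nat.lt_succ_self _) i, by simp [choicePlan]⟩

theorem delayingAdversary_eq {g h : A.History} (hgh : g <+: h) :
    A.delayingAdversary κ t T x g = (A.choicePlan κ t T x h).move g.length :=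
  choicePlan_move hgh (Nat.div_mul_le_self _ _)

omit [NeZero n] in
theorem IsRun.isPrefix {adv : A.Adversary} {ω : ℕ → A.History} (hω : A.IsRun adv x ω) {q q' : ℕ}
    (h : q ≤ q') : ω q <+: ω q' := by
  rw [hω.eq_hist q, hω.eq_hist q', ← take_hist h]
  exact List.take_prefix _ _

omit [NeZero n] in
theorem IsRun.length {adv : A.Adversary} {ω : ℕ → A.History} (hω : A.IsRun adv x ω) (q : ℕ) :
    (ω q).length = q := by
  rw [hω.eq_hist q, hist_length]

theorem isAsyncAdversary_delayingAdversary (hA : A.FullyCommunicative t) :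
    A.IsAsyncAdversary t (A.delayingAdversary κ t T) := by
  intro x ω hω
  set P : Plan n :=
    ⟨fun r => A.choices κ t T x (ω (r * roundLength n)) (r + 1) r, T, Finset.univ⟩ with hPdef
  have hP : P.Legal t :=
    ⟨fun _ _ i => card_choices _ (Nat.lt_succ_self _) i, by simp [hPdef]⟩
  have hmv : (fun q => A.delayingAdversary κ t T x (ω q)) = P.move := by
    funext q
    have hle : q / roundLength n * roundLength n ≤ q := Nat.div_mul_le_self _ _
    unfold delayingAdversary
    rw [hω.length]
    refine move_eq_of_hear rfl rfl ?_
    simp only [choicePlan, hPdef]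
    rw [choices_congr (hω.isPrefix hle) (by rw [hω.length])]
  have hloc : ∀ N, A.IsLocalRun P.move x (fun q => A.stateAt x (ω q)) N := fun N =>
    hmv ▸ hω.isLocalRun N
  have hhist : ∀ q, ω q = A.hist P.move (fun q => A.stateAt x (ω q)) q := fun q => by
    have := hω.eq_hist q
    rwa [hmv] at this
  have hal : ∀ i, i ∈ P.alive := fun i => Finset.mem_univ i
  refine ⟨⟨?_, fun i _ => ⟨sendsForever_of_plan hhist (hal i),
    receivesForever_of_plan hA hP hloc hhist (hal i)⟩⟩,
    fun j i _ => delivers_of_plan hhist (hal i) (hal j)⟩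
  have : {i | A.Crashes ω i} = ∅ :=
    Set.eq_empty_of_forall_notMem fun i hi => hi.1 (sendsForever_of_plan hhist (hal i))
  simp [this]

theorem IsRun.follows {ω : ℕ → A.History} (hω : A.IsRun (A.delayingAdversary κ t T) x ω)
    (N : ℕ) : Follows (A.choicePlan κ t T x (ω N)).move x (ω N) := by
  have htake : ∀ q ≤ N, (ω N).take q = ω q := fun q hq => by
    have := List.prefix_iff_eq_take.1 (hω.isPrefix hq)
    rwa [hω.length, eq_comm] at this
  intro q hq
  rw [hω.length] at hq
  rw [htake _ hq, htake _ hq.le]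
  have := hω.2 q
  rwa [delayingAdversary_eq (hω.isPrefix hq.le), hω.length] at this

variable (A κ t T x) in
/-- The partial executions whose first `r` rounds lean to a decision. -/
def leaning (r : ℕ) : Set A.History :=
  {h | ∃ b, A.Leans κ t b (T - r) r x (A.msgTable x h r) (A.choices κ t T x h r)}

/-- A round of the adversary is unlikely to lead to a transcript that leans to a decision. -/
theorem stepsExp_leaning_le (hκ : A.IsMessageLaw κ) (hA : A.FullyCommunicative t)
    (hC : A.Correct) (hT : A.Terminating t) (ht : 0 < t) (htn : t < n) {r : ℕ} (hr : r < T)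
    {h : A.History} (hh : h.length = r * roundLength n)
    (hf : Follows (A.choicePlan κ t T x h).move x h) (hl : h ∉ A.leaning κ t T x r) :
    A.stepsExp (A.delayingAdversary κ t T) x (roundLength n)
      ((A.leaning κ t T x (r + 1)).indicator 1) h ≤ 2 * threshold n t := by
  set V := A.msgTable x h r with hV
  set S := A.choices κ t T x h r with hS
  set s := A.choice κ t (T - (r + 1)) r x V S with hs
  have hhear : (A.choicePlan κ t T x h).hear r = s := by
    simp [choicePlan, choices, hs, hV, hS]
  have hVr : V r = fun j => A.send j (A.stateAt x h j) := by
    simp [hV, msgTable, ← hh]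
  have hadv : ∀ g, h <+: g → g.length < (r + 1) * roundLength n →
      A.delayingAdversary κ t T x g = (A.choicePlan κ t T x h).move g.length := by
    intro g hg hlt
    refine (choicePlan_move hg ?_).symm
    rw [hh]
    refine Nat.mul_le_mul_right _ (Nat.lt_succ_iff.1 ?_)
    exact (Nat.div_lt_iff_lt_mul roundLength_pos).2 hlt
  have hle : ∀ b, A.leanProb κ t b (T - (r + 1)) r x V S s ≤ threshold n t :=
    leanProb_choice_le hA hC hT ht htn (fun r' hr' i => card_choices h hr' i) fun b hb =>
      hl ⟨b, by rwa [show T - r = T - (r + 1) + 1 by omega]⟩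
  set E : Bool → Set (Fin n → Fin n → Option A.Msg) := fun b =>
    {v | A.Leans κ t b (T - (r + 1)) (r + 1) x (Function.update V (r + 1) v)
      (Function.update S r s)} with hE
  calc A.stepsExp (A.delayingAdversary κ t T) x (roundLength n)
        ((A.leaning κ t T x (r + 1)).indicator 1) h
      ≤ A.stepsExp (A.delayingAdversary κ t T) x (roundLength n) (fun g =>
          (fun v => (E false).indicator 1 v + (E true).indicator 1 v)
            fun i => A.send i (A.stateAt x g i)) h := by
        refine stepsExp_mono_follows ((r + 1) * roundLength n) hadv ?_ _ h (List.prefix_refl h) hf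
          (by rw [hh, Nat.succ_mul])
        intro g hg _ hlen
        by_cases hgl : g ∈ A.leaning κ t T x (r + 1)
        · rw [Set.indicator_of_mem hgl]
          obtain ⟨b, hb⟩ := hgl
          have hVg : A.msgTable x g (r + 1) =
              Function.update V (r + 1) fun i => A.send i (A.stateAt x g i) := by
            funext r'
            by_cases hr' : r' = r + 1
            · subst hr'
              simp [msgTable, ← hlen]
            · rw [Function.update_of_ne hr', hV, msgTable_congr hg hh.ge]
              unfold msgTable
              by_cases hr'' : r' ≤ r
              · rw [if_pos hr'', if_pos (by omega)]
              · rw [if_neg hr'', if_neg (by omega)]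
          have hSg : A.choices κ t T x g (r + 1) = Function.update S r s := by
            rw [← choices_congr hg hh.ge]
            rfl
          rw [hVg, hSg] at hb
          have hmem : (fun i => A.send i (A.stateAt x g i)) ∈ E b := hb
          cases b with
          | false => simp only [Set.indicator_of_mem hmem, Pi.one_apply]; exact le_self_add
          | true => simp only [Set.indicator_of_mem hmem, Pi.one_apply]; exact le_add_self
        · rw [Set.indicator_of_notMem hgl]
          exact bot_le
    _ = A.leanProb κ t false (T - (r + 1)) r x V S s +
        A.leanProb κ t true (T - (r + 1)) r x V S s := by
        rw [stepsExp_messages hκ hA (choicePlan_legal h) rfl hr hh hadv hf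
          (fun v => (E false).indicator 1 v + (E true).indicator 1 v) (V r), iterExp_add, hhear,
          ← hVr]
        rfl
    _ ≤ threshold n t + threshold n t := add_le_add (hle _) (hle _)
    _ = 2 * threshold n t := (two_mul _).symm

theorem runMeasure_leaning_le (hκ : A.IsMessageLaw κ) (hA : A.FullyCommunicative t)
    (hC : A.Correct) (hT : A.Terminating t) (ht : 0 < t) (htn : t < n)
    (hx : ∀ b, ¬ A.Leans κ t b T 0 x (A.msgTable x [] 0) fun _ _ => ∅) {r : ℕ} (hr : r ≤ T) :
    A.runMeasure (A.delayingAdversary κ t T) x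
      {ω | ω (r * roundLength n) ∈ A.leaning κ t T x r} ≤ r * (2 * threshold n t) := by
  induction r with
  | zero =>
    refine (le_of_eq ?_).trans zero_le
    have h₀ : ∀ᵐ ω ∂A.runMeasure (A.delayingAdversary κ t T) x,
        ¬ ω (0 * roundLength n) ∈ A.leaning κ t T x 0 := by
      filter_upwards [A.run_zero (A.delayingAdversary κ t T) x] with ω hω hmem
      rw [zero_mul, hω] at hmem
      obtain ⟨b, hb⟩ := hmem
      exact hx b hb
    simpa only [ae_iff, not_not] using h₀
  | succ r ih =>
    have ih := ih (by omega)
    rw [← lintegral_run_indicator, Nat.succ_mul, lintegral_run_add]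
    calc _ ≤ ∫⁻ ω, (A.leaning κ t T x r).indicator 1 (ω (r * roundLength n)) + 2 * threshold n t
          ∂A.runMeasure (A.delayingAdversary κ t T) x := by
          refine lintegral_mono_ae ?_
          filter_upwards [A.ae_isRun (A.delayingAdversary κ t T) x] with ω hω
          by_cases hl : ω (r * roundLength n) ∈ A.leaning κ t T x r
          · rw [Set.indicator_of_mem hl, Pi.one_apply]
            refine (A.stepsExp_le (f := (A.leaning κ t T x (r + 1)).indicator 1) (c := 1)
              (fun g => ?_) _ _).trans le_self_add
            exact Set.indicator_apply_le' (fun _ => le_rfl) fun _ => zero_le_one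
          · exact (stepsExp_leaning_le hκ hA hC hT ht htn (by omega) (hω.length _)
              (hω.follows _) hl).trans le_add_self
      _ = A.runMeasure (A.delayingAdversary κ t T) x
            {ω | ω (r * roundLength n) ∈ A.leaning κ t T x r} + 2 * threshold n t := by
          rw [lintegral_add_right _ measurable_const, lintegral_run_indicator]
          simp
      _ ≤ r * (2 * threshold n t) + 2 * threshold n t := by gcongr
      _ = _ := by push_cast; ring

/-! ### The running time -/

/-- In a legal plan, each message of round `r` is the last one of a chain of length `r + 1`. -/
theorem IsLocalRun.messageChain {P : Plan n} {σ : ℕ → Fin n → A.State} {N : ℕ}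
    (hσ : A.IsLocalRun P.move x σ N) (hA : A.FullyCommunicative t) (hP : P.Legal t) (htn : t < n)
    {r : ℕ} {i : Fin n} (hi : P.AliveAt r i) (hN : r * roundLength n + i < N) (b : Fin n) :
    A.MessageChain (A.hist P.move σ N) (r + 1) (r * roundLength n + i) b := by
  have hsent : ∀ {r : ℕ} {i : Fin n}, P.AliveAt r i → r * roundLength n + i < N → ∀ b,
      ∃ m, A.SentAt (A.hist P.move σ N) (r * roundLength n + i) i b m := by
    intro r i hi hN b
    have := hσ.ready hA hP (r := r) (by omega) hi b
    rw [← hσ.eq_roundStart hN.le] at this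
    obtain ⟨m, hm⟩ := Option.isSome_iff_exists.1 this
    exact ⟨m, _, getElem?_hist_eq_some.2 ⟨hN, record_send (Plan.move_send r i hi)⟩, hm⟩
  induction r generalizing i b with
  | zero =>
    obtain ⟨m, hm⟩ := hsent hi hN b
    exact .single _ _ _ m hm
  | succ r ih =>
    have hLs : (r + 1) * roundLength n = r * roundLength n + roundLength n := Nat.succ_mul _ _
    have hL := lt_roundLength (n := n)
    obtain ⟨j, hj⟩ : (P.hearAt r i).Nonempty := by
      rw [← Finset.card_pos]
      have := hP.card_hearAt hi.of_succ
      omega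
    have hjn := j.isLt
    have hd := deliverPos_lt i j
    obtain ⟨m, -, hm⟩ := hσ.record_deliver hA hP (by omega) hj
    obtain ⟨m', hm'⟩ := hsent hi hN b
    exact .snoc _ _ _ _ j i b m m' _ (ih (Plan.aliveAt_of_mem_hearAt hj) (by omega) i)
      (getElem?_hist_eq_some.2 ⟨by omega, hm⟩) (by omega) hm'

/-- As long as the transcript does not lean to a decision, nobody has decided; so the running time
is more than the number of rounds. -/
theorem runningTimeAtLeast_of_notMem_leaning (hA : A.FullyCommunicative t) (htn : t < n)
    {ω : ℕ → A.History} (hω : A.IsRun (A.delayingAdversary κ t T) x ω)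
    (hl : ω (T * roundLength n) ∉ A.leaning κ t T x T) {c : ℝ} (hc : c ≤ T + 1) :
    A.RunningTimeAtLeast x c ω := by
  set M := T * roundLength n with hM
  set h := ω (M + 1) with hh
  set P := A.choicePlan κ t T x h with hPdef
  have hal : ∀ r i, P.AliveAt r i := fun r i => .inr (Finset.mem_univ i)
  have hlen : h.length = M + 1 := hω.length _
  obtain ⟨hloc, hhist⟩ := (hω.follows (M + 1)).isLocalRun
  rw [hω.length] at hloc hhist
  have htake : ∀ q ≤ M + 1, h.take q = ω q := fun q hq => by
    have := List.prefix_iff_eq_take.1 (hω.isPrefix hq)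
    rwa [hω.length, eq_comm] at this
  -- nobody has decided after `T` rounds
  have hund : ∀ i, A.out (A.stateAt x (ω M) i) = none := by
    intro i
    by_contra hne
    obtain ⟨b, hb⟩ := Option.ne_none_iff_exists'.1 hne
    have hpre : ω M <+: h := hω.isPrefix (Nat.le_succ M)
    have hlM : (ω M).length = M := hω.length M
    refine hl ⟨b, ?_⟩
    rw [Nat.sub_self]
    refine ⟨fun q => A.stateAt x (h.take q), (hloc.mono (Nat.le_succ M)).congr fun q hq => ?_,
      fun r' hr' i => ?_, i, ?_⟩
    · refine move_congr (r := T) rfl rfl (fun r' hr' => ?_) hq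
      change A.choices κ t T x h (r' + 1) r' = A.choices κ t T x (ω M) T r'
      rw [choices_eq _ hr', choices_congr hpre]
      rw [hlM]
      exact Nat.mul_le_mul_right _ hr'.le
    · have hle : r' * roundLength n ≤ M := Nat.mul_le_mul_right _ hr'
      simp only [msgTable, if_pos hr']
      have h₅ := List.prefix_iff_eq_take.1 (hω.isPrefix hle)
      rw [hω.length] at h₅
      rw [htake _ (by omega), ← h₅]
    · simp only
      rw [htake _ (by omega)]
      exact hb
  refine ⟨M + 1, fun i => ?_, T + 1, M, 0, ?_, by exact_mod_cast hc⟩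
  · -- the first sending step of the next round does not change the outputs
    have hstep := hloc.step M (Nat.lt_succ_self M)
    have hmv : (A.choicePlan κ t T x (ω (M + 1))).move M = .send 0 := by
      have := Plan.move_send (P := P) T 0 (hal T 0)
      rwa [Fin.val_zero, add_zero] at this
    have hst : ∀ q ≤ M + 1, A.stateAt x (h.take q) = A.stateAt x (ω q) := fun q hq => by
      rw [htake q hq]
    unfold LocalStep at hstep
    simp only [hmv] at hstep
    rw [hst _ le_rfl, hst _ (Nat.le_succ M)] at hstep
    rw [hstep]
    split_ifs
    · by_cases hi : i = 0
      · rw [hi, Function.update_self, A.out_sent]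
        exact hund 0
      · rw [Function.update_of_ne hi]
        exact hund i
    · exact hund i
  · have hmc := hloc.messageChain hA (choicePlan_legal h) htn (r := T) (i := 0) (hal T 0)
      (by rw [Fin.val_zero]; omega) 0
    rw [← hhist (M + 1) le_rfl, htake _ le_rfl, Fin.val_zero, add_zero] at hmc
    exact hmc

end Algorithm

theorem mainTheorem3 (c : ℝ) (hc : 0 < c) :
    ∃ C : ℝ, 0 < C ∧ ∃ α : ℝ, 0 < α ∧
      ∀ n t : ℕ, 0 < t → t < n → t = ⌊c * (n : ℝ)⌋₊ →
      ∀ A : Algorithm.{u, v} n,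
        A.Forgetful → A.FullyCommunicative t → A.Correct → A.Terminating t →
        ∃ adv : A.Adversary, A.IsAsyncAdversary t adv ∧
          ∃ x : Fin n → Bool,
            1 / 2 ≤ A.runMeasure adv x
              {ω | A.RunningTimeAtLeast x (C * Real.exp (α * (n : ℝ))) ω} := by
  refine ⟨1 / 4, by norm_num, c ^ 2 / 8, by positivity, ?_⟩
  intro n t ht htn htc A hF hA hC hT
  obtain ⟨κ, hκ⟩ := hF
  have hκ : A.IsMessageLaw κ := hκ
  have : NeZero n := ⟨by omega⟩
  have hn : (0 : ℝ) < n := by exact_mod_cast ht.trans htn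
  set δ : ℝ := Real.exp ((t : ℝ) ^ 2 / (2 * n)) with hδ
  have hδ0 : 0 < δ := Real.exp_pos _
  -- the largest `T` with `T * (2 * δ⁻¹) ≤ 1 / 2`
  set T : ℕ := ⌊δ / 4⌋₊ with hTdef
  obtain ⟨x, hx⟩ := Algorithm.exists_not_leans (κ := κ) hA hC hT ht htn T
  refine ⟨A.delayingAdversary κ t T, Algorithm.isAsyncAdversary_delayingAdversary hA, x, ?_⟩
  -- `c n < t + 1 ≤ 2 t`
  have htn2 : c * n ≤ 2 * t := by
    have h₁ := Nat.lt_floor_add_one (c * (n : ℝ))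
    rw [← htc] at h₁
    have h₂ : (1 : ℝ) ≤ t := by exact_mod_cast ht
    linarith
  have hlen : 1 / 4 * Real.exp (c ^ 2 / 8 * (n : ℝ)) ≤ T + 1 := by
    have h₁ : c ^ 2 / 8 * (n : ℝ) ≤ (t : ℝ) ^ 2 / (2 * n) := by
      rw [le_div_iff₀ (by positivity)]
      nlinarith [mul_self_le_mul_self (by positivity) htn2]
    have h₂ := Real.exp_le_exp.2 h₁
    have h₃ := (Nat.lt_floor_add_one (δ / 4)).le
    rw [← hTdef] at h₃
    linarith
  have hbad : A.runMeasure (A.delayingAdversary κ t T) x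
      {ω | ω (T * roundLength n) ∈ A.leaning κ t T x T} ≤ 1 / 2 := by
    refine (Algorithm.runMeasure_leaning_le hκ hA hC hT ht htn hx le_rfl).trans ?_
    have hth : Algorithm.threshold n t = ENNReal.ofReal δ⁻¹ := by
      rw [Algorithm.threshold, hδ, ← Real.exp_neg, neg_div]
    have hT4 : (T : ℝ) ≤ δ / 4 := Nat.floor_le (by positivity)
    have h2 : (1 / 2 : ENNReal) = ENNReal.ofReal (1 / 2) := by
      rw [ENNReal.ofReal_div_of_pos two_pos, ENNReal.ofReal_one, ENNReal.ofReal_ofNat]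
    rw [hth, h2, ← ENNReal.ofReal_natCast, ← ENNReal.ofReal_ofNat 2,
      ← ENNReal.ofReal_mul (by positivity), ← ENNReal.ofReal_mul (by positivity)]
    refine ENNReal.ofReal_le_ofReal ?_
    have : (T : ℝ) * (2 * δ⁻¹) ≤ δ / 4 * (2 * δ⁻¹) := by gcongr
    refine this.trans (le_of_eq ?_)
    field_simp
    norm_num
  calc (1 / 2 : ENNReal)
      ≤ 1 - A.runMeasure (A.delayingAdversary κ t T) x
          {ω | ω (T * roundLength n) ∈ A.leaning κ t T x T} := by
        refine le_trans ?_ (tsub_le_tsub_left hbad 1)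
        simp
    _ = A.runMeasure (A.delayingAdversary κ t T) x
          {ω | ω (T * roundLength n) ∈ A.leaning κ t T x T}ᶜ :=
        (prob_compl_eq_one_sub (A.measurableSet_run_apply _ _)).symm
    _ ≤ _ := by
        refine measure_mono_ae ?_
        filter_upwards [A.ae_isRun (A.delayingAdversary κ t T) x] with ω hω hl
        exact Algorithm.runningTimeAtLeast_of_notMem_leaning hA htn hω hl hlen
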